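/- \textbf{Theorem.} All algorithms are deterministic word-RAM programs. A $3$-OV instance consists of three families $A,B,C$ of $n\ge 1$ vectors in $\{0,1\}^d$, $d\ge 1$; a solution is a triple $a\in A$, $b\in B$, $c\in C$ with $\sum_{i=1}^d a[i]\,b[i]\,c[i]=0$. For a weighted undirected graph, $d(u,v)$ is the minimum total weight of a path from $u$ to $v$ ($\infty$ if there is none), and the Diameter is $\max_{u,v}d(u,v)$. (i) There is an algorithm (with words of $O(\log(n+d))$ bits) that, given a $3$-OV instance, constructs in $O(n^2d^2)$ time a weighted, undirected simple graph with $O(n^2+nd^2)$ vertices and $O(n^2d^2)$ edges, each edge having weight $1$ or $2$, such that \begin{itemize} \item if the $3$-OV instance has no solution, then $d(u,v)\le 6$ for all pairs of vertices $u,v$; \item if the $3$-OV instance has a solution, then there is a pair of vertices $u,v$ with $d(u,v)\ge 10$. \end{itemize} (ii) The Strong Exponential Time Hypothesis (SETH) states that for every $\varepsilon>0$ there is a $K$ such that satisfiability of $K$-CNF formulas with $N$ variables and $M$ clauses cannot be decided in time $2^{(1-\varepsilon)N}\,\mathrm{poly}(N+M)$ on a word-RAM (with words of $O(N+\log M)$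 bits). Assume SETH. Then there is a constant $C_0$ such that for all $\varepsilon,\delta>0$ there is no algorithm which, given a connected undirected graph with $n$ vertices, at most $C_0n$ edges and all edge weights in $\{1,2\}$, computes in time $O(n^{3/2-\delta})$ (with words of $O(\log n)$ bits) a $(5/3-\varepsilon)$-approximation of its Diameter $D$. Here an $\alpha$-approximation is a rational number $x$ with $\mathrm{lo}\cdot D\le x\le \mathrm{hi}\cdot D$ for constants $\mathrm{lo}>0$ and $\mathrm{hi}\le\alpha\cdot\mathrm{lo}$ fixed for the algorithm; this includes both conventions $D\le x\le\alpha D$ and $D/\alpha\le x\le D$. -/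

import Mathlib

/-! ### Word-RAM

A unit-cost random access machine with structured control flow.  Registers and memory cells hold
natural numbers.  The word length is enforced by a bound `W`: an execution is legal only if every
value it writes is smaller than `W`, so that `W = 2 ^ w` means words of `w` bits and
`W = x ^ c` with a constant `c` means words of `O(log x)` bits. -/

namespace WordRAM

/-- Binary word operations. Comparisons return `1` or `0`; `sub` is truncated at `0`. -/
inductive Op where
  | add | sub | mul | div | mod | and | or | xor | shl | shr | lt | eq

def Op.eval : Op → ℕ → ℕ → ℕ
  | .add, a, b => a + b
  | .sub, a, b => a - b
  | .mul, a, b => a * b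
  | .div, a, b => a / b
  | .mod, a, b => a % b
  | .and, a, b => a &&& b
  | .or, a, b => a ||| b
  | .xor, a, b => a ^^^ b
  | .shl, a, b => a <<< b
  | .shr, a, b => a >>> b
  | .lt, a, b => if a < b then 1 else 0
  | .eq, a, b => if a = b then 1 else 0

structure State where
  reg : ℕ → ℕ
  mem : ℕ → ℕ

/-- Elementary instructions, each of which costs one step. -/
inductive Instr where
  /-- `reg r := k` -/
  | const (r k : ℕ)
  /-- `reg r := o (reg a) (reg b)` -/
  | op (o : Op) (r a b : ℕ)
  /-- `reg r := mem (reg a)` -/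
  | load (r a : ℕ)
  /-- `mem (reg a) := reg b` -/
  | store (a b : ℕ)

/-- The word that an instruction writes. -/
def Instr.value : Instr → State → ℕ
  | .const _ k, _ => k
  | .op o _ a b, s => o.eval (s.reg a) (s.reg b)
  | .load _ a, s => s.mem (s.reg a)
  | .store _ b, s => s.reg b

def Instr.exec (i : Instr) (s : State) : State :=
  match i with
  | .const r _ => ⟨Function.update s.reg r (i.value s), s.mem⟩
  | .op _ r _ _ => ⟨Function.update s.reg r (i.value s), s.mem⟩
  | .load r _ => ⟨Function.update s.reg r (i.value s), s.mem⟩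
  | .store a _ => ⟨s.reg, Function.update s.mem (s.reg a) (i.value s)⟩

/-- Programs. A program is a fixed finite object, independent of the input. -/
inductive Prog where
  | skip
  | instr (i : Instr)
  | seq (p q : Prog)
  /-- if `reg r ≠ 0` then `p` else `q` -/
  | ite (r : ℕ) (p q : Prog)
  /-- while `reg r ≠ 0` do `p` -/
  | loop (r : ℕ) (p : Prog)

/-- `Runs W p s t s'`: started in state `s`, the program `p` halts after exactly `t` steps in
state `s'`, and every value written on the way is smaller than `W`.  Every instruction and every
test of a register costs one step. -/
inductive Runs (W : ℕ) : Prog → State → ℕ → State → Prop where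
  | skip (s : State) : Runs W .skip s 1 s
  | instr (i : Instr) (s : State) (h : i.value s < W) : Runs W (.instr i) s 1 (i.exec s)
  | seq {p q : Prog} {s s' s'' : State} {t t' : ℕ} (hp : Runs W p s t s')
      (hq : Runs W q s' t' s'') : Runs W (.seq p q) s (t + t') s''
  | ite_true {r : ℕ} {p q : Prog} {s s' : State} {t : ℕ} (hr : s.reg r ≠ 0)
      (hp : Runs W p s t s') : Runs W (.ite r p q) s (t + 1) s'
  | ite_false {r : ℕ} {p q : Prog} {s s' : State} {t : ℕ} (hr : s.reg r = 0)
      (hq : Runs W q s t s') : Runs W (.ite r p q) s (t + 1) s'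
  | loop_done {r : ℕ} {p : Prog} {s : State} (hr : s.reg r = 0) : Runs W (.loop r p) s 1 s
  | loop_step {r : ℕ} {p : Prog} {s s' s'' : State} {t t' : ℕ} (hr : s.reg r ≠ 0)
      (hp : Runs W p s t s') (hl : Runs W (.loop r p) s' t' s'') :
      Runs W (.loop r p) s (t + t' + 1) s''

/-- Initial state: the input words in the cells `0, 1, 2, …`, everything else zero. -/
def initState (input : List ℕ) : State where
  reg := fun _ => 0
  mem := fun i => input.getD i 0

/-- On the given input, whose words are smaller than `W`, the program halts after `t` steps in
state `s`, all words staying smaller than `W`. -/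
def HaltsOn (W : ℕ) (p : Prog) (input : List ℕ) (t : ℕ) (s : State) : Prop :=
  (∀ x ∈ input, x < W) ∧ Runs W p (initState input) t s

/-- The memory starts with the words `output`. -/
def State.Outputs (s : State) (output : List ℕ) : Prop :=
  ∀ i (h : i < output.length), s.mem i = output[i]

end WordRAM

/-! ### Weighted undirected graphs -/

/-- A simple undirected graph with edge weights; the values of `weight` off the edges are never
used. -/
structure WeightedGraph (V : Type*) where
  graph : SimpleGraph V
  weight : Sym2 V → ℕ

namespace WeightedGraph

variable {V : Type*} (G : WeightedGraph V)

/-- The total weight of a walk. -/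
def walkLength {u v : V} (p : G.graph.Walk u v) : ℕ := (p.edges.map G.weight).sum

/-- Weighted distance, `⊤` if there is no path. -/
noncomputable def dist (u v : V) : ℕ∞ := ⨅ p : G.graph.Walk u v, (G.walkLength p : ℕ∞)

noncomputable def diameter : ℕ∞ := ⨆ u : V, ⨆ v : V, G.dist u v

/-- Each edge has weight `1` or `2`. -/
def WeightsOneOrTwo : Prop := ∀ e ∈ G.graph.edgeSet, G.weight e = 1 ∨ G.weight e = 2

end WeightedGraph

/-- `L` lists every edge of `G` exactly once (in one of its two orientations, in any order),
together with its weight. -/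
def IsEdgeList {n : ℕ} (G : WeightedGraph (Fin n)) (L : List (Fin n × Fin n × ℕ)) : Prop :=
  (L.map fun e => s(e.1, e.2.1)).Nodup ∧
  (∀ e, e ∈ G.graph.edgeSet ↔ e ∈ L.map fun e => s(e.1, e.2.1)) ∧
  ∀ e ∈ L, G.weight s(e.1, e.2.1) = e.2.2

/-- Number of vertices, number of edges, then the triples (endpoint, endpoint, weight). -/
def encodeGraph (n : ℕ) (L : List (Fin n × Fin n × ℕ)) : List ℕ :=
  n :: L.length :: L.flatMap fun e => [(e.1 : ℕ), (e.2.1 : ℕ), e.2.2]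

/-! ### Orthogonal vectors -/

/-- An instance of `k`-OV: `k` families of `n` vectors in `{0,1}^d`. -/
def OVInstance (k n d : ℕ) : Type := Fin k → Fin n → Fin d → Bool

/-- One can choose a vector from each family so that the generalized inner product is `0`. -/
def OVInstance.HasSolution {k n d : ℕ} (I : OVInstance k n d) : Prop :=
  ∃ f : Fin k → Fin n, ∑ x : Fin d, ∏ j : Fin k, (I j (f j) x).toNat = 0

/-- `n`, `d`, then all bits, family by family and vector by vector. -/
def OVInstance.encode {k n d : ℕ} (I : OVInstance k n d) : List ℕ :=
  n :: d :: (List.finRange k).flatMap fun j => (List.finRange n).flatMap fun i =>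
    (List.finRange d).map fun x => (I j i x).toNat

/-! ### Satisfiability and the Strong Exponential Time Hypothesis -/

/-- A CNF formula on `N` variables: a list of clauses, each of which is a list of literals; the
literal `(v, true)` is the variable `v`, and `(v, false)` is its negation. -/
abbrev CNF (N : ℕ) : Type := List (List (Fin N × Bool))

def CNF.Satisfiable {N : ℕ} (φ : CNF N) : Prop :=
  ∃ σ : Fin N → Bool, ∀ cl ∈ φ, ∃ l ∈ cl, σ l.1 = l.2

/-- `N`, the number of clauses, then each clause as its length followed by its literals. -/
def CNF.encode {N : ℕ} (φ : CNF N) : List ℕ :=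
  N :: φ.length :: φ.flatMap fun cl => cl.length :: cl.map fun l => 2 * (l.1 : ℕ) + l.2.toNat

/-- Satisfiability of CNF formulas with `N` variables, `M` clauses and at most `K` literals per
clause is decidable (answer in register `0`) in time `2 ^ ((1 - ε) N) * poly (N + M)` on a
word-RAM with words of `O(N + log M)` bits.  Words must be long enough to address the memory that
an exponential-time algorithm uses.  Up to repetitions, there are only polynomially many clauses
for fixed `K`, so that `poly (N + M)` means `poly N`. -/
def KSATSolvable (K : ℕ) (ε : ℝ) : Prop :=
  ∃ (P : WordRAM.Prog) (c : ℕ), ∀ (N : ℕ) (φ : CNF N), (∀ cl ∈ φ, cl.length ≤ K) →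
    ∃ (t : ℕ) (s : WordRAM.State),
      WordRAM.HaltsOn ((2 ^ N * (φ.length + 2)) ^ c) P φ.encode t s ∧
      (t : ℝ) ≤ c * (2 : ℝ) ^ ((1 - ε) * N) * ((N : ℝ) + φ.length + 1) ^ c ∧
      (s.reg 0 ≠ 0 ↔ φ.Satisfiable)

/-- The Strong Exponential Time Hypothesis. -/
def SETH : Prop := ∀ ε : ℝ, 0 < ε → ∃ K : ℕ, ¬ KSATSolvable K ε

/-! ### Approximating the diameter -/

/-- There is a word-RAM algorithm with words of `O(log n)` bits which, on every connected
undirected graph with `n ≥ 1` vertices, at most `C₀ * n` edges and all edge weights in `{1, 2}`,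
runs in time `O(n ^ τ)` and outputs a rational number `x` (numerator in register `0`, denominator
in register `1`) such that `lo * D ≤ x ≤ hi * D`, where `D` is the diameter.  (For `n ≥ 1`,
connected means that the diameter is finite.)  An `α`-approximation is the case
`(lo, hi) = (1, α)`, or `(lo, hi) = (1 / α, 1)` for estimates from below. -/
def SparseDiameterApprox (C₀ : ℕ) (lo hi τ : ℝ) : Prop :=
  ∃ (P : WordRAM.Prog) (c : ℕ), ∀ (n D : ℕ) (G : WeightedGraph (Fin n))
    (L : List (Fin n × Fin n × ℕ)), 0 < n → IsEdgeList G L → L.length ≤ C₀ * n →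
    G.WeightsOneOrTwo → G.diameter = D →
    ∃ (t : ℕ) (s : WordRAM.State),
      WordRAM.HaltsOn ((n + 2) ^ c) P (encodeGraph n L) t s ∧
      (t : ℝ) ≤ c * (n : ℝ) ^ τ ∧
      s.reg 1 ≠ 0 ∧
      lo * D ≤ (s.reg 0 : ℝ) / s.reg 1 ∧ (s.reg 0 : ℝ) / s.reg 1 ≤ hi * D

namespace WordRAM

/-! ### Executions -/

/-! Part (i) rests on a gadget with two sides, one for the first family and one for the third; the
middle family occurs on both. On its side a vector `g` has hubs `t g`, `h g`, a vertex `s g b` for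
each middle vector `b`, and a vertex `l g x y` for each pair of coordinates. The edge `s g b` – `l g
x y` says that `g` and `b` are 1 at `x` and that `g` is 1 at `y`; the edge `l (0, a) x y` – `l (1,
c) y x` says that `a` and `c` are 1 at both `x` and `y`. Hence the walk `s (0, a) b` – `l (0, a) x
y` – `l (1, c) y x` – `s (1, c) b'` of length 6 exists exactly when `x` refutes the triple `a, b, c`
and `y` refutes `a, b', c`. Each `l` vertex thus stores the witnesses for both middle vectors at
once.

Without a solution all these walks exist. Pairs on one side are joined through their hubs, and pairs
involving the center or a leaf through the center, which is within 5 of everything; so all distances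
are at most 6 (`near_of_not_hasSolution`). With a solution `a, b, c`, an explicit potential climbs
from 0 at `s (0, a) b` to 10 at `s (1, c) b` and changes along each edge by at most its weight
(`Edge.potential`, `le_dist_of_potential`). The solution is needed only at the edges between the two
sides: it forces `b` to vanish at both coordinates, so that no such edge is a shortcut.

For part (ii), cut the `N` variables into three blocks. The roughly `2 ^ (N / 3)` partial
assignments of a block are the vectors of a family and the clauses are the coordinates
(`toOV_hasSolution_iff`). Extra leaves at the center make the graph sparse without changing the
distance bounds. It has about `2 ^ (2 * N / 3)` vertices up to polynomial factors, so time `n ^ (3 /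
2 - δ)` becomes `2 ^ ((1 - 2 * δ / 3) * N)`. An approximation better than 5/3 tells 6 from 10 by
comparison with one fixed rational number.

Both reductions must be actual programs. `Exec` is a small Hoare calculus for programs that write a
list: register 0 is the write pointer, the variables form a stack in the next registers, and the
specification is the list of words written. The list `edges` is built by the same nested loops as
the program, so correctness is checked loop by loop. Overflow is controlled by assigning a
polynomial degree to each expression (`ev_lt_and_ok`). -/

theorem Runs.mono {W W' : ℕ} (h : W ≤ W') {p : Prog} {s s' : State} {t : ℕ}
    (r : Runs W p s t s') : Runs W' p s t s' := by
  induction r with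
  | skip s => exact .skip s
  | instr i s hv => exact .instr i s (hv.trans_le h)
  | seq _ _ h1 h2 => exact .seq h1 h2
  | ite_true hr _ h1 => exact .ite_true hr h1
  | ite_false hr _ h1 => exact .ite_false hr h1
  | loop_done hr => exact .loop_done hr
  | loop_step hr _ _ h1 h2 => exact .loop_step hr h1 h2

/-- Instructions write only to registers below this bound. -/
def Instr.regBound : Instr → ℕ
  | .const r _ => r + 1
  | .op _ r _ _ => r + 1
  | .load r _ => r + 1
  | .store _ _ => 0

/-- Programs write only to registers below this bound. -/
def Prog.regBound : Prog → ℕ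
  | .skip => 0
  | .instr i => i.regBound
  | .seq p q => max p.regBound q.regBound
  | .ite _ p q => max p.regBound q.regBound
  | .loop _ p => p.regBound

/-- Clearing the finitely many registers that a program can write to therefore restores the all-zero
register file of an initial state. -/
theorem Runs.reg_eq {W : ℕ} {p : Prog} {s s' : State} {t k : ℕ}
    (r : Runs W p s t s') (hk : p.regBound ≤ k) : s'.reg k = s.reg k := by
  induction r with
  | skip s => rfl
  | instr i s hv =>
    cases i with
    | store => rfl
    | _ =>
      simp only [Prog.regBound, Instr.regBound] at hk
      simp only [Instr.exec, Function.update_apply, ite_eq_right_iff]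
      omega
  | seq _ _ h1 h2 =>
    simp only [Prog.regBound, max_le_iff] at hk
    rw [h2 hk.2, h1 hk.1]
  | ite_true hr _ h1 => simp only [Prog.regBound, max_le_iff] at hk; exact h1 hk.1
  | ite_false hr _ h1 => simp only [Prog.regBound, max_le_iff] at hk; exact h1 hk.2
  | loop_done hr => rfl
  | loop_step hr _ _ h1 h2 => rw [h2 hk, h1 hk]

/-- Applied to the unknown diameter algorithm: its numerator and denominator fit into words, so that
they can be multiplied by constants without overflow in longer words. -/
theorem Runs.bounded {W : ℕ} {p : Prog} {s s' : State} {t : ℕ} (r : Runs W p s t s')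
    (h : (∀ k, s.reg k < W) ∧ ∀ k, s.mem k < W) :
    (∀ k, s'.reg k < W) ∧ ∀ k, s'.mem k < W := by
  induction r with
  | skip s => exact h
  | instr i s hv =>
    cases i <;> simp only [Instr.exec] <;> refine ⟨fun k => ?_, fun k => ?_⟩ <;>
      try simp only [Function.update_apply]
    all_goals first | exact h.1 k | exact h.2 k | skip
    all_goals split_ifs
    all_goals first | exact hv | exact h.1 k | exact h.2 k
  | seq _ _ h1 h2 => exact h2 (h1 h)
  | ite_true hr _ h1 => exact h1 h
  | ite_false hr _ h1 => exact h1 h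
  | loop_done hr => exact h
  | loop_step hr _ _ h1 h2 => exact h2 (h1 h)

/-- Set the registers below `k` to zero. -/
def clearRegs : ℕ → Prog
  | 0 => .skip
  | k + 1 => .seq (clearRegs k) (.instr (.const k 0))

theorem clearRegs_runs {W : ℕ} (hW : 0 < W) (k : ℕ) (s : State) :
    ∃ s', Runs W (clearRegs k) s (k + 1) s' ∧ (∀ r < k, s'.reg r = 0) ∧
      (∀ r, k ≤ r → s'.reg r = s.reg r) ∧ s'.mem = s.mem := by
  induction k with
  | zero => exact ⟨s, .skip s, by simp, by simp, rfl⟩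
  | succ k ih =>
    obtain ⟨s', h1, h2, h3, h4⟩ := ih
    refine ⟨_, .seq h1 (.instr (.const k 0) s' (by simpa [Instr.value] using hW)), ?_, ?_, h4⟩
    · intro r hr
      by_cases hk : r = k
      · subst hk; simp [Instr.exec, Instr.value]
      · simpa [Instr.exec, Instr.value, hk] using h2 r (by omega)
    · intro r hr
      simpa [Instr.exec, Instr.value, show r ≠ k by omega] using h3 r (by omega)

/-! ### Expressions -/

/-- Expressions over variables; the variable `i` is kept in register `i + 1`. -/
inductive Ex where
  | c (k : ℕ)
  | v (i : ℕ)
  | o (op : Op) (a b : Ex)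
  | ld (a : Ex)

namespace Ex

instance : Add Ex := ⟨.o .add⟩
instance : Sub Ex := ⟨.o .sub⟩
instance : Mul Ex := ⟨.o .mul⟩
instance : Div Ex := ⟨.o .div⟩
instance : Mod Ex := ⟨.o .mod⟩
instance {n : ℕ} : OfNat Ex n := ⟨.c n⟩

def ev (ρ M : ℕ → ℕ) : Ex → ℕ
  | c k => k
  | v i => ρ i
  | o op a b => op.eval (a.ev ρ M) (b.ev ρ M)
  | ld a => M (a.ev ρ M)

section
variable (ρ M : ℕ → ℕ) (a b : Ex)
@[simp] theorem ev_c (k : ℕ) : ev ρ M (c k) = k := rfl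
@[simp] theorem ev_ofNat (k : ℕ) : ev ρ M (no_index (OfNat.ofNat k : Ex)) = k := rfl
@[simp] theorem ev_v (i : ℕ) : ev ρ M (v i) = ρ i := rfl
@[simp] theorem ev_ld : ev ρ M (ld a) = M (a.ev ρ M) := rfl
@[simp] theorem ev_o (op : Op) : ev ρ M (o op a b) = op.eval (a.ev ρ M) (b.ev ρ M) := rfl
@[simp] theorem ev_add : ev ρ M (a + b) = a.ev ρ M + b.ev ρ M := rfl
@[simp] theorem ev_sub : ev ρ M (a - b) = a.ev ρ M - b.ev ρ M := rfl
@[simp] theorem ev_mul : ev ρ M (a * b) = a.ev ρ M * b.ev ρ M := rfl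
@[simp] theorem ev_div : ev ρ M (a / b) = a.ev ρ M / b.ev ρ M := rfl
@[simp] theorem ev_mod : ev ρ M (a % b) = a.ev ρ M % b.ev ρ M := rfl
end

/-- Evaluate into register `t`, using the registers from `t` on. -/
def comp : Ex → ℕ → Prog
  | c k, t => .instr (.const t k)
  -- The bitwise or of a register with itself is a copy.
  | v i, t => .instr (.op .or t (i + 1) (i + 1))
  | o op a b, t => .seq (a.comp t) (.seq (b.comp (t + 1)) (.instr (.op op t t (t + 1))))
  | ld a, t => .seq (a.comp t) (.instr (.load t t))

def cost : Ex → ℕ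
  | c _ => 1
  | v _ => 1
  | o _ a b => a.cost + (b.cost + 1)
  | ld a => a.cost + 1

/-- The variables are below this bound. -/
def varBound : Ex → ℕ
  | c _ => 0
  | v i => i + 1
  | o _ a b => max a.varBound b.varBound
  | ld a => a.varBound

/-- All values are smaller than `W`, and all loads are from `Ro`. -/
def Ok (W : ℕ) (Ro : Set ℕ) (ρ M : ℕ → ℕ) : Ex → Prop
  | c k => k < W
  | v i => ρ i < W
  | o op a b => a.Ok W Ro ρ M ∧ b.Ok W Ro ρ M ∧ op.eval (a.ev ρ M) (b.ev ρ M) < W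
  | ld a => a.Ok W Ro ρ M ∧ a.ev ρ M ∈ Ro ∧ M (a.ev ρ M) < W

/-- The registers from `t` on act as an evaluation stack: the value of the left operand rests in `t`
while the right one is computed from `t + 1` on. Hence `t` is generalized in the induction, and `n <
t` protects the variables. -/
theorem comp_runs {W n : ℕ} {Ro : Set ℕ} {ρ M : ℕ → ℕ} (e : Ex) (t : ℕ) (s : State)
    (hρ : ∀ i < n, s.reg (i + 1) = ρ i) (hM : ∀ a ∈ Ro, s.mem a = M a)
    (hv : e.varBound ≤ n) (hn : n < t) (hok : e.Ok W Ro ρ M) :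
    ∃ s', Runs W (e.comp t) s e.cost s' ∧ s'.reg t = e.ev ρ M ∧
      (∀ r < t, s'.reg r = s.reg r) ∧ s'.mem = s.mem := by
  induction e generalizing t s with
  | c k =>
    exact ⟨_, .instr (.const t k) s hok, by simp [Instr.exec, Instr.value],
      fun r hr => by simp [Instr.exec, hr.ne], rfl⟩
  | v i =>
    have h := hρ i hv
    refine ⟨_, .instr (.op .or t (i + 1) (i + 1)) s ?_, ?_, fun r hr => ?_, rfl⟩
    · simpa [Instr.value, Op.eval, h, Ok] using hok
    · simp [Instr.exec, Instr.value, Op.eval, h]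
    · simp [Instr.exec, hr.ne]
  | o op a b iha ihb =>
    simp only [varBound, max_le_iff] at hv
    obtain ⟨s1, r1, e1, k1, m1⟩ := iha t s hρ hM hv.1 hn hok.1
    obtain ⟨s2, r2, e2, k2, m2⟩ := ihb (t + 1) s1
      (fun i hi => by rw [k1 _ (by omega), hρ i hi]) (by simpa [m1] using hM) hv.2 (by omega) hok.2.1
    have h1 : s2.reg t = a.ev ρ M := by rw [k2 t (by omega), e1]
    refine ⟨_, .seq r1 (.seq r2 (.instr (.op op t t (t + 1)) s2 ?_)), ?_, fun r hr => ?_, ?_⟩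
    · simpa [Instr.value, h1, e2] using hok.2.2
    · simp [Instr.exec, Instr.value, h1, e2]
    · simp [Instr.exec, hr.ne, k2 r (by omega), k1 r hr]
    · simp [Instr.exec, m1, m2]
  | ld a iha =>
    obtain ⟨s1, r1, e1, k1, m1⟩ := iha t s hρ hM hv hn hok.1
    have h := hM _ hok.2.1
    refine ⟨_, .seq r1 (.instr (.load t t) s1 ?_), ?_, fun r hr => ?_, m1⟩
    · simpa [Instr.value, e1, m1, h] using hok.2.2
    · simp [Instr.exec, Instr.value, e1, m1, h]
    · simpa [Instr.exec, hr.ne] using k1 r hr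

/-- All loads are from `Ro`. -/
def Loads (Ro : Set ℕ) (ρ M : ℕ → ℕ) : Ex → Prop
  | c _ => True
  | v _ => True
  | o _ a b => a.Loads Ro ρ M ∧ b.Loads Ro ρ M
  | ld a => a.Loads Ro ρ M ∧ a.ev ρ M ∈ Ro

section
variable (Ro : Set ℕ) (ρ M : ℕ → ℕ) (a b : Ex)
@[simp] theorem loads_c (k : ℕ) : Loads Ro ρ M (c k) := trivial
@[simp] theorem loads_ofNat (k : ℕ) : Loads Ro ρ M (no_index (OfNat.ofNat k : Ex)) := trivial
@[simp] theorem loads_v (i : ℕ) : Loads Ro ρ M (v i) := trivial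
@[simp] theorem loads_o (op : Op) :
    Loads Ro ρ M (o op a b) ↔ Loads Ro ρ M a ∧ Loads Ro ρ M b := Iff.rfl
@[simp] theorem loads_add :
    Loads Ro ρ M (a + b) ↔ Loads Ro ρ M a ∧ Loads Ro ρ M b := Iff.rfl
@[simp] theorem loads_sub :
    Loads Ro ρ M (a - b) ↔ Loads Ro ρ M a ∧ Loads Ro ρ M b := Iff.rfl
@[simp] theorem loads_mul :
    Loads Ro ρ M (a * b) ↔ Loads Ro ρ M a ∧ Loads Ro ρ M b := Iff.rfl
@[simp] theorem loads_div :
    Loads Ro ρ M (a / b) ↔ Loads Ro ρ M a ∧ Loads Ro ρ M b := Iff.rfl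
@[simp] theorem loads_mod :
    Loads Ro ρ M (a % b) ↔ Loads Ro ρ M a ∧ Loads Ro ρ M b := Iff.rfl
@[simp] theorem loads_ld :
    Loads Ro ρ M (ld a) ↔ Loads Ro ρ M a ∧ a.ev ρ M ∈ Ro := Iff.rfl
end

/-- If all variables and all words in memory are smaller than `X`, then all values are smaller
than `X ^ e.deg`, provided that `e.Std`. -/
def deg : Ex → ℕ
  | c k => k + 1
  | v _ => 1
  | o .add a b => max a.deg b.deg + 1
  | o .mul a b => a.deg + b.deg
  | o _ a b => max a.deg b.deg
  | ld a => a.deg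

/-- Only operations whose value is polynomially bounded in the arguments. -/
def std : Ex → Bool
  | c _ => true
  | v _ => true
  | o .shl _ _ => false
  | o .or _ _ => false
  | o .xor _ _ => false
  | o _ a b => a.std && b.std
  | ld a => a.std

theorem one_le_deg (e : Ex) : 1 ≤ e.deg := by
  induction e with
  | c k => simp [deg]
  | v i => simp [deg]
  | o op a b iha ihb => cases op <;> simp [deg] <;> omega
  | ld a iha => simpa [deg] using iha

/-- Values are bounded by powers of `X`: a product adds the exponents, a sum costs one more since `X
≥ 2`, and the other permitted operations do not exceed their left operand or return a bit. One
inequality `X ^ e.deg ≤ W` then excludes overflow in every subexpression. -/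
theorem ev_lt_and_ok {W X : ℕ} {Ro : Set ℕ} {ρ M : ℕ → ℕ} (hX : 2 ≤ X) (hρ : ∀ i, ρ i < X)
    (hM : ∀ a ∈ Ro, M a < X) (e : Ex) (hs : e.std = true) (hl : e.Loads Ro ρ M)
    (hW : X ^ e.deg ≤ W) : e.ev ρ M < X ^ e.deg ∧ e.Ok W Ro ρ M := by
  have mono : ∀ {a b : ℕ}, a ≤ b → X ^ a ≤ X ^ b := fun h => Nat.pow_le_pow_right (by omega) h
  induction e with
  | c k =>
    -- A constant gets degree `k + 1` because `k < 2 ^ k ≤ X ^ k`; the extra one keeps every degree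
    -- positive.
    have : k < X ^ (k + 1) :=
      (Nat.lt_two_pow_self).trans_le ((Nat.pow_le_pow_left hX k).trans (mono (by omega)))
    exact ⟨this, this.trans_le hW⟩
  | v i =>
    have : ρ i < X ^ 1 := by simpa using hρ i
    exact ⟨this, this.trans_le hW⟩
  | ld a iha =>
    obtain ⟨-, h2⟩ := iha hs hl.1 hW
    have h3 : M (a.ev ρ M) < X ^ a.deg := (hM _ hl.2).trans_le (by simpa using mono (one_le_deg a))
    exact ⟨h3, h2, hl.2, h3.trans_le hW⟩
  | o op a b iha ihb =>
    have hda : a.deg ≤ (o op a b).deg := by cases op <;> simp [deg]; omega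
    have hdb : b.deg ≤ (o op a b).deg := by cases op <;> simp [deg]; omega
    have hsa : a.std = true ∧ b.std = true := by
      cases op <;> simp [std] at hs <;> exact hs
    obtain ⟨ha, oa⟩ := iha hsa.1 hl.1 ((mono hda).trans hW)
    obtain ⟨hb, ob⟩ := ihb hsa.2 hl.2 ((mono hdb).trans hW)
    suffices h : op.eval (a.ev ρ M) (b.ev ρ M) < X ^ (o op a b).deg from
      ⟨h, oa, ob, h.trans_le hW⟩
    have ha' := ha.trans_le (mono hda)
    have h1 : 1 < X ^ (o op a b).deg :=
      (show 1 < X ^ 1 by rw [pow_one]; omega).trans_le (mono (one_le_deg _))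
    cases op <;> simp only [Op.eval]
    case add =>
      have h2 : X ^ a.deg ≤ X ^ max a.deg b.deg := mono (le_max_left _ _)
      have h3 : X ^ b.deg ≤ X ^ max a.deg b.deg := mono (le_max_right _ _)
      simp only [deg, pow_succ]
      nlinarith
    case sub => omega
    case mul =>
      simp only [deg, pow_add]
      exact Nat.mul_lt_mul'' ha hb
    case div => exact (Nat.div_le_self _ _).trans_lt ha'
    case mod => exact (Nat.mod_le _ _).trans_lt ha'
    case and => exact Nat.and_le_left.trans_lt ha'
    case or => simp [std] at hs
    case xor => simp [std] at hs
    case shl => simp [std] at hs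
    case shr => exact (Nat.shiftRight_le _ _).trans_lt ha'
    case lt => split_ifs <;> omega
    case eq => split_ifs <;> omega

end Ex

/-! ### Programs that write a list -/

/-- Write the list `l` at the address `p`. -/
def writeList (m : ℕ → ℕ) (p : ℕ) (l : List ℕ) : ℕ → ℕ :=
  fun a => if p ≤ a ∧ a < p + l.length then l.getD (a - p) 0 else m a

@[simp] theorem writeList_nil (m : ℕ → ℕ) (p : ℕ) : writeList m p [] = m := by
  funext a; simp [writeList]

theorem writeList_singleton (m : ℕ → ℕ) (p x : ℕ) :
    writeList m p [x] = Function.update m p x := by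
  funext a
  simp only [writeList, Function.update_apply, List.length_singleton]
  split_ifs with h1 h2 h2
  · subst h2; simp
  · omega
  · omega
  · rfl

theorem writeList_append (m : ℕ → ℕ) (p : ℕ) (l l' : List ℕ) :
    writeList (writeList m p l) (p + l.length) l' = writeList m p (l ++ l') := by
  funext a
  simp only [writeList, List.length_append]
  split_ifs with h1 h2 h2 <;> try omega
  · rw [List.getD_append_right _ _ _ _ (by omega)]; congr 1; omega
  · rw [List.getD_append _ _ _ _ (by omega)]

theorem writeList_of_notMem {m : ℕ → ℕ} {p : ℕ} {l : List ℕ} {a : ℕ}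
    (h : ¬ (p ≤ a ∧ a < p + l.length)) : writeList m p l a = m a := if_neg h

/-- The valuation of the variables. -/
def val (Γ : List ℕ) : ℕ → ℕ := fun i => Γ.getD i 0

theorem val_append_left {Γ : List ℕ} (Δ : List ℕ) {i : ℕ} (h : i < Γ.length) :
    val (Γ ++ Δ) i = val Γ i := List.getD_append _ _ _ _ h

theorem val_append_length (Γ : List ℕ) (x : ℕ) : val (Γ ++ [x]) Γ.length = x := by
  simp [val]

theorem val_lt {Γ : List ℕ} {X : ℕ} (hX : 0 < X) (h : ∀ x ∈ Γ, x < X) (i : ℕ) : val Γ i < X := by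
  unfold val
  by_cases hi : i < Γ.length
  · rw [List.getD_eq_getElem _ _ hi]; exact h _ (List.getElem_mem hi)
  · rwa [List.getD_eq_default _ _ (by omega)]

/-- Started with the write pointer in register `0`, the values `Γ` in the registers from `1` on,
and the memory contents `M` on the set `Ro`, the program `p` writes `out` (which must not hit `Ro`)
and ends with the values `Γ'`, after at most `T` steps. -/
def Exec (W : ℕ) (Ro : Set ℕ) (M : ℕ → ℕ) (p : Prog) (T : ℕ) (Γ Γ' out : List ℕ) : Prop :=
  ∀ s : State, (∀ i < Γ.length, s.reg (i + 1) = val Γ i) → (∀ a ∈ Ro, s.mem a = M a) →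
    (∀ a ∈ Ro, ¬ (s.reg 0 ≤ a ∧ a < s.reg 0 + out.length)) → s.reg 0 + out.length < W →
    ∃ t ≤ T, ∃ s', Runs W p s t s' ∧ s'.reg 0 = s.reg 0 + out.length ∧
      (∀ i < Γ'.length, s'.reg (i + 1) = val Γ' i) ∧ s'.mem = writeList s.mem (s.reg 0) out

/-- Words up to `X` in the read-only memory, and polynomially larger words are allowed. -/
structure Ctx (W X D : ℕ) (Ro : Set ℕ) (M : ℕ → ℕ) : Prop where
  two_le : 2 ≤ X
  pow_le : X ^ D ≤ W
  mem_lt : ∀ a ∈ Ro, M a < X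

/-- A syntactic check that the expression can be evaluated without an overflow. -/
def Ex.fits (D k : ℕ) (e : Ex) : Bool := e.std && decide (e.deg ≤ D) && decide (e.varBound ≤ k)

/-- The check `fits` is purely syntactic, so for concrete programs the absence of overflow is
settled by `decide`. Only the loads depend on the state. -/
theorem Ctx.ok {W X D : ℕ} {Ro : Set ℕ} {M : ℕ → ℕ} (h : Ctx W X D Ro M) {Γ : List ℕ}
    (hΓ : ∀ x ∈ Γ, x < X) {e : Ex} (hf : e.fits D Γ.length = true)
    (hl : e.Loads Ro (val Γ) M) : e.Ok W Ro (val Γ) M := by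
  simp only [Ex.fits, Bool.and_eq_true, decide_eq_true_eq] at hf
  refine (Ex.ev_lt_and_ok h.two_le (val_lt (by have := h.two_le; omega) hΓ) h.mem_lt e hf.1.1 hl
    ((Nat.pow_le_pow_right (by have := h.two_le; omega) hf.1.2).trans h.pow_le)).2

theorem Ctx.mono {W X D D' : ℕ} {Ro : Set ℕ} {M : ℕ → ℕ} (h : Ctx W X D Ro M) (hD : D' ≤ D) :
    Ctx W X D' Ro M :=
  ⟨h.two_le, (Nat.pow_le_pow_right (by have := h.two_le; omega) hD).trans h.pow_le, h.mem_lt⟩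

section Exec
variable {W : ℕ} {Ro : Set ℕ} {M : ℕ → ℕ} {p q : Prog} {T T' : ℕ} {Γ Γ' Γ'' out out' : List ℕ}

theorem Exec.mono (h : Exec W Ro M p T Γ Γ' out) (hT : T ≤ T') : Exec W Ro M p T' Γ Γ' out := by
  intro s h1 h2 h3 h4
  obtain ⟨t, ht, r⟩ := h s h1 h2 h3 h4
  exact ⟨t, ht.trans hT, r⟩

/-- Local variables go out of scope at no cost: a register above the live variables is scratch
space. -/
theorem Exec.drop (h : Exec W Ro M p T Γ (Γ' ++ Γ'') out) : Exec W Ro M p T Γ Γ' out := by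
  intro s h1 h2 h3 h4
  obtain ⟨t, ht, s', r, h5, h6, h7⟩ := h s h1 h2 h3 h4
  refine ⟨t, ht, s', r, h5, fun i hi => ?_, h7⟩
  rw [h6 i (by simp; omega), val_append_left _ hi]

theorem Exec.seq (hp : Exec W Ro M p T Γ Γ' out) (hq : Exec W Ro M q T' Γ' Γ'' out') :
    Exec W Ro M (.seq p q) (T + T') Γ Γ'' (out ++ out') := by
  intro s h1 h2 h3 h4
  simp only [List.length_append] at h3 h4
  obtain ⟨t, ht, s1, r1, p1, g1, m1⟩ := hp s h1 h2 (fun a ha h => h3 a ha (by omega)) (by omega)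
  obtain ⟨t', ht', s2, r2, p2, g2, m2⟩ := hq s1 g1
    (fun a ha => by
      rw [m1, writeList_of_notMem (fun h => h3 a ha (by omega)), h2 a ha])
    (fun a ha h => h3 a ha (by omega)) (by omega)
  refine ⟨t + t', by omega, s2, .seq r1 r2, by simp; omega, g2, ?_⟩
  rw [m2, m1, p1, writeList_append]

/-- Add a new variable with the value of `e`. -/
theorem Exec.push (e : Ex) (hv : e.varBound ≤ Γ.length) (hok : e.Ok W Ro (val Γ) M) :
    Exec W Ro M (e.comp (Γ.length + 1)) e.cost Γ (Γ ++ [e.ev (val Γ) M]) [] := by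
  intro s h1 h2 h3 h4
  obtain ⟨s', r, e1, k1, m1⟩ := e.comp_runs (Γ.length + 1) s h1 h2 hv (by omega) hok
  refine ⟨_, le_rfl, s', r, by simp [k1 0 (by omega)], fun i hi => ?_, by simp [m1]⟩
  simp only [List.length_append, List.length_singleton] at hi
  rcases Nat.lt_succ_iff_lt_or_eq.1 hi with hi | hi
  · rw [k1 _ (by omega), h1 i hi, val_append_left _ hi]
  · subst hi; rw [e1, val_append_length]

/-- Write the value of `e`; `k` is the number of variables. -/
def emit (k : ℕ) (e : Ex) : Prog :=
  .seq (e.comp (k + 1)) (.seq (.instr (.store 0 (k + 1)))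
    (.seq (.instr (.const (k + 1) 1)) (.instr (.op .add 0 0 (k + 1)))))

theorem Exec.emit (e : Ex) (hv : e.varBound ≤ Γ.length) (hok : e.Ok W Ro (val Γ) M)
    (hlt : e.ev (val Γ) M < W) :
    Exec W Ro M (emit Γ.length e) (e.cost + 3) Γ Γ [e.ev (val Γ) M] := by
  intro s h1 h2 h3 h4
  simp only [List.length_singleton] at h4
  obtain ⟨s', r, e1, k1, m1⟩ := e.comp_runs (Γ.length + 1) s h1 h2 hv (by omega) hok
  have h0 := k1 0 (by omega)
  refine ⟨_, le_rfl, _, .seq r (.seq (.instr _ _ ?_) (.seq (.instr _ _ ?_) (.instr _ _ ?_))),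
    ?_, fun i hi => ?_, ?_⟩
  · simpa [Instr.value, e1] using hlt
  · simp only [Instr.value]; omega
  · simpa [Instr.value, Instr.exec, Op.eval, h0] using h4
  · simp [Instr.value, Instr.exec, Op.eval, h0]
  · simp [Instr.exec, show i ≠ Γ.length by omega, k1 (i + 1) (by omega), h1 i hi]
  · simp [Instr.exec, Instr.value, writeList_singleton, h0, e1, m1]

/-- Run `p` if `e` is not zero; `k` is the number of variables. -/
def ifThen (k : ℕ) (e : Ex) (p : Prog) : Prog :=
  .seq (e.comp (k + 1)) (.ite (k + 1) p .skip)

theorem Exec.ifThen (e : Ex) (hv : e.varBound ≤ Γ.length) (hok : e.Ok W Ro (val Γ) M)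
    (hT : 1 ≤ T) (hp : e.ev (val Γ) M ≠ 0 → Exec W Ro M p T Γ Γ out) :
    Exec W Ro M (ifThen Γ.length e p) (e.cost + T + 1) Γ Γ
      (if e.ev (val Γ) M ≠ 0 then out else []) := by
  intro s h1 h2 h3 h4
  obtain ⟨s1, r1, e1, k1, m1⟩ := e.comp_runs (Γ.length + 1) s h1 h2 hv (by omega) hok
  have h0 := k1 0 (by omega)
  have hg : ∀ i < Γ.length, s1.reg (i + 1) = val Γ i :=
    fun i hi => by rw [k1 _ (by omega), h1 i hi]
  by_cases hc : e.ev (val Γ) M = 0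
  · exact ⟨e.cost + (1 + 1), by omega, s1, .seq r1 (.ite_false (e1.trans hc) (.skip _)),
      by simp [hc, h0], hg, by simp [hc, m1]⟩
  · rw [if_pos hc] at h3 h4 ⊢
    obtain ⟨t, ht, s2, r2, p2, g2, m2⟩ := hp hc s1 hg (by simpa [m1] using h2)
      (by simpa [h0] using h3) (by simpa [h0] using h4)
    exact ⟨e.cost + (t + 1), by omega, s2, .seq r1 (.ite_true (by rwa [e1]) r2),
      by rw [p2, h0], g2, by rw [m2, m1, h0]⟩

/-- For the variable `k` from `0` to `e - 1`, run `p`; `k` is the number of variables outside the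
loop. -/
def forLoop (k : ℕ) (e : Ex) (p : Prog) : Prog :=
  .seq (.instr (.const (k + 1) 0)) (.seq ((Ex.o .lt (.v k) e).comp (k + 2))
    (.loop (k + 2) (.seq p (.seq (.instr (.const (k + 2) 1))
      (.seq (.instr (.op .add (k + 1) (k + 1) (k + 2))) ((Ex.o .lt (.v k) e).comp (k + 2)))))))

/-- `F i` holds the outer variables at the start of round `i`; the body may turn them into `F (i +
1)` but must preserve the counter. The bound `e` is evaluated anew before every round, so it must
equal `n` for all `F i`, including the final test at `i = n`. -/
theorem Exec.forLoop {k n : ℕ} (e : Ex) (F : ℕ → List ℕ) (f : ℕ → List ℕ)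
    (hF : ∀ i, (F i).length = k) (hv : e.varBound ≤ k + 1)
    (hok : ∀ i ≤ n, (Ex.o .lt (.v k) e).Ok W Ro (val (F i ++ [i])) M)
    (hev : ∀ i ≤ n, e.ev (val (F i ++ [i])) M = n) (hn : n < W) (hW : 2 ≤ W)
    (hp : ∀ i < n, Exec W Ro M p T (F i ++ [i]) (F (i + 1) ++ [i]) (f i)) :
    Exec W Ro M (forLoop k e p) ((n + 1) * (T + (2 * e.cost + 12))) (F 0) (F n)
      ((List.range n).flatMap f) := by
  set e' := Ex.o .lt (.v k) e with he'
  have hc : e'.cost = e.cost + 2 := by simp [e', Ex.cost]; omega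
  have hv' : e'.varBound ≤ k + 1 := by simpa [e', Ex.varBound] using hv
  have hval' : ∀ i x, val (F i ++ [x]) k = x := fun i x => by
    rw [← hF i]; exact val_append_length _ _
  have hval : ∀ i, val (F i ++ [i]) k = i := fun i => hval' i i
  have hev' : ∀ i ≤ n, e'.ev (val (F i ++ [i])) M = if i < n then 1 else 0 := by
    intro i hi
    simp [e', hev i hi, hval, Op.eval]
  -- Induction on the number `m` of remaining rounds, with the result of the current test already in
  -- register `k + 2`.
  have loop : ∀ (m i : ℕ) (s : State), i + m = n →
      (∀ j < k + 1, s.reg (j + 1) = val (F i ++ [i]) j) → (∀ a ∈ Ro, s.mem a = M a) →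
      s.reg (k + 2) = (if i < n then 1 else 0) →
      (∀ a ∈ Ro, ¬ (s.reg 0 ≤ a ∧ a < s.reg 0 + ((List.range' i m).flatMap f).length)) →
      s.reg 0 + ((List.range' i m).flatMap f).length < W →
      ∃ t ≤ m * (T + (e.cost + 6)) + 1, ∃ s',
        Runs W (.loop (k + 2) (.seq p (.seq (.instr (.const (k + 2) 1))
          (.seq (.instr (.op .add (k + 1) (k + 1) (k + 2))) (e'.comp (k + 2)))))) s t s' ∧
        s'.reg 0 = s.reg 0 + ((List.range' i m).flatMap f).length ∧
        (∀ j < k, s'.reg (j + 1) = val (F n) j) ∧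
        s'.mem = writeList s.mem (s.reg 0) ((List.range' i m).flatMap f) := by
    intro m
    induction m with
    | zero =>
      intro i s hi h1 h2 h3 h4 h5
      obtain rfl : i = n := by omega
      refine ⟨1, by omega, s, .loop_done (by simpa using h3), by simp, fun j hj => ?_, by simp⟩
      rw [h1 j (by omega), val_append_left _ (by rw [hF]; exact hj)]
    | succ m ih =>
      intro i s hi h1 h2 h3 h4 h5
      have hin : i < n := by omega
      simp only [List.range'_succ, List.flatMap_cons, List.length_append] at h4 h5 ⊢
      obtain ⟨t1, ht1, s1, r1, p1, g1, m1⟩ := hp i hin s (by simpa [hF] using h1) h2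
        (fun a ha h => h4 a ha (by omega)) (by omega)
      simp only [List.length_append, hF, List.length_singleton] at g1
      have hk : s1.reg (k + 1) = i := by
        rw [g1 k (by omega), hval']
      set s2 : State := (Instr.const (k + 2) 1).exec s1
      set s3 : State := (Instr.op .add (k + 1) (k + 1) (k + 2)).exec s2
      have v3 : (Instr.op .add (k + 1) (k + 1) (k + 2)).value s2 = i + 1 := by
        simp [s2, Instr.value, Instr.exec, Op.eval, hk]
      have m3 : s3.mem = s1.mem := rfl
      have p3 : s3.reg 0 = s1.reg 0 := by simp [s3, s2, Instr.exec]
      have g3 : ∀ j < k + 1, s3.reg (j + 1) = val (F (i + 1) ++ [i + 1]) j := by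
        intro j hj
        rcases Nat.lt_succ_iff_lt_or_eq.1 hj with hj | hj
        · rw [val_append_left _ (by rw [hF]; exact hj)]
          have := g1 j (by omega)
          rw [val_append_left _ (by rw [hF]; exact hj)] at this
          rw [← this]
          simp [s3, s2, Instr.exec, show j ≠ k by omega, show j ≠ k + 1 by omega]
        · subst hj
          rw [hval']
          simp [s3, Instr.exec, v3]
      have mM : ∀ a ∈ Ro, s3.mem a = M a := fun a ha => by
        rw [m3, m1, writeList_of_notMem (fun h => h4 a ha (by omega)), h2 a ha]
      obtain ⟨s4, r4, e4, k4, m4⟩ := e'.comp_runs (k + 2) s3 (n := k + 1)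
        (ρ := val (F (i + 1) ++ [i + 1])) g3 mM hv' (by omega) (hok (i + 1) hin)
      have p4 : s4.reg 0 = s.reg 0 + (f i).length := by rw [k4 0 (by omega), p3, p1]
      obtain ⟨t5, ht5, s5, r5, p5, g5, m5⟩ := ih (i + 1) s4 (by omega)
        (fun j hj => by rw [k4 _ (by omega), g3 j hj]) (by simpa [m4] using mM)
        (by rw [e4, hev' _ hin]) (fun a ha h => h4 a ha (by omega)) (by omega)
      refine ⟨_, ?_, s5, .loop_step (by simp [h3, hin]) (.seq r1 (.seq (.instr _ _ ?_)
        (.seq (.instr _ _ ?_) r4))) r5, by omega, g5, ?_⟩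
      · rw [hc]; nlinarith
      · simp only [Instr.value]; omega
      · rw [v3]; omega
      · rw [m5, m4, m3, m1, p4, writeList_append]
  intro s h1 h2 h3 h4
  rw [hF] at h1
  rw [hF, List.range_eq_range'] at *
  set s1 : State := (Instr.const (k + 1) 0).exec s
  have g1 : ∀ j < k + 1, s1.reg (j + 1) = val (F 0 ++ [0]) j := by
    intro j hj
    rcases Nat.lt_succ_iff_lt_or_eq.1 hj with hj | hj
    · rw [val_append_left _ (by rw [hF]; exact hj), ← h1 j hj]
      simp [s1, Instr.exec, show j ≠ k by omega]
    · subst hj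
      rw [hval']
      simp [s1, Instr.exec, Instr.value]
  obtain ⟨s2, r2, e2, k2, m2⟩ := e'.comp_runs (k + 2) s1 (n := k + 1)
    (ρ := val (F 0 ++ [0])) g1 h2 hv' (by omega) (hok 0 (by omega))
  have p2 : s2.reg 0 = s.reg 0 := by rw [k2 0 (by omega)]; simp [s1, Instr.exec]
  obtain ⟨t3, ht3, s3, r3, p3, g3, m3⟩ := loop n 0 s2 (by omega)
    (fun j hj => by rw [k2 _ (by omega), g1 j hj]) (by rw [m2]; exact h2)
    (by rw [e2, hev' _ (by omega)]) (by simpa [p2] using h3) (by simpa [p2] using h4)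
  refine ⟨_, ?_, s3, .seq (.instr _ _ (by simp only [Instr.value]; omega)) (.seq r2 r3), ?_, ?_, ?_⟩
  · rw [hc]; nlinarith
  · rw [p3, p2]
  · exact g3
  · rw [m3, m2, p2]; rfl

end Exec
end WordRAM


/-! ### Distances in weighted graphs -/

namespace WeightedGraph
variable {V : Type*} (G : WeightedGraph V)

/-- There is a walk of length at most `k`. -/
def Near (u v : V) (k : ℕ) : Prop := ∃ p : G.graph.Walk u v, G.walkLength p ≤ k

variable {G}

theorem Near.dist_le {u v : V} {k : ℕ} (h : G.Near u v k) : G.dist u v ≤ k := by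
  obtain ⟨p, hp⟩ := h
  exact (iInf_le _ p).trans (by exact_mod_cast hp)

theorem Near.mono {u v : V} {k k' : ℕ} (h : G.Near u v k) (hk : k ≤ k') : G.Near u v k' := by
  obtain ⟨p, hp⟩ := h
  exact ⟨p, hp.trans hk⟩

theorem Near.refl (u : V) (k : ℕ) : G.Near u u k := ⟨.nil, by simp [walkLength]⟩

theorem Near.symm {u v : V} {k : ℕ} (h : G.Near u v k) : G.Near v u k := by
  obtain ⟨p, hp⟩ := h
  exact ⟨p.reverse, by simpa [walkLength, List.map_reverse] using hp⟩

theorem Near.trans {u v w : V} {k k' : ℕ} (h : G.Near u v k) (h' : G.Near v w k') :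
    G.Near u w (k + k') := by
  obtain ⟨p, hp⟩ := h
  obtain ⟨q, hq⟩ := h'
  refine ⟨p.append q, ?_⟩
  simp only [walkLength, SimpleGraph.Walk.edges_append, List.map_append, List.sum_append] at *
  omega

theorem Near.of_adj {u v : V} (h : G.graph.Adj u v) : G.Near u v (G.weight s(u, v)) :=
  ⟨.cons h .nil, by simp [walkLength]⟩

theorem le_add_walkLength {φ : V → ℕ}
    (hφ : ∀ u v, G.graph.Adj u v → φ v ≤ φ u + G.weight s(u, v)) {u v : V}
    (p : G.graph.Walk u v) : φ v ≤ φ u + G.walkLength p := by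
  induction p with
  | nil => simp
  | cons h p ih =>
    have := hφ _ _ h
    simp only [walkLength, SimpleGraph.Walk.edges_cons, List.map_cons, List.sum_cons] at ih ⊢
    omega

/-- A potential that changes along an edge by at most its weight bounds distances from below. -/
theorem le_dist_of_potential {φ : V → ℕ}
    (hφ : ∀ u v, G.graph.Adj u v → φ v ≤ φ u + G.weight s(u, v)) {u v : V} (hu : φ u = 0) :
    (φ v : ℕ∞) ≤ G.dist u v :=
  le_iInf fun p => by
    have := le_add_walkLength hφ p
    rw [hu, zero_add] at this
    exact_mod_cast this

/-- The graph with a given list of edges. -/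
def ofEdges [DecidableEq V] (L : List (V × V × ℕ)) : WeightedGraph V where
  graph := .fromEdgeSet {e | e ∈ L.map fun e => s(e.1, e.2.1)}
  weight e := ((L.find? fun x => s(x.1, x.2.1) = e).map fun x => x.2.2).getD 0

end WeightedGraph

/-- The weight of an edge is read off its first occurrence in the list; without repeated endpoint
pairs, this is the only occurrence. -/
theorem isEdgeList_ofEdges {n : ℕ} {L : List (Fin n × Fin n × ℕ)}
    (hL : (L.map fun e => s(e.1, e.2.1)).Nodup) (hne : ∀ e ∈ L, e.1 ≠ e.2.1) :
    IsEdgeList (WeightedGraph.ofEdges L) L := by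
  refine ⟨hL, fun e => ?_, fun e he => ?_⟩
  · simp only [WeightedGraph.ofEdges, SimpleGraph.edgeSet_fromEdgeSet, Set.mem_sdiff,
      Set.mem_ofPred_eq, and_iff_left_iff_imp]
    intro h
    obtain ⟨x, hx, rfl⟩ := List.mem_map.1 h
    simpa using hne x hx
  · obtain ⟨x, hx⟩ : ∃ x, L.find? (fun x => s(x.1, x.2.1) = s(e.1, e.2.1)) = some x := by
      rw [← Option.isSome_iff_exists, List.find?_isSome]
      exact ⟨e, he, by simp⟩
    have h1 := List.find?_some hx
    have h2 := List.inj_on_of_nodup_map hL (List.mem_of_find?_eq_some hx) he (by simpa using h1)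
    show ((L.find? fun x => s(x.1, x.2.1) = s(e.1, e.2.1)).map fun x => x.2.2).getD 0 = e.2.2
    rw [hx, h2]
    rfl

theorem IsEdgeList.near {n : ℕ} {G : WeightedGraph (Fin n)} {L : List (Fin n × Fin n × ℕ)}
    (h : IsEdgeList G L) {u v : Fin n} {w : ℕ} (he : (u, v, w) ∈ L) : G.Near u v w := by
  have h1 : G.graph.Adj u v := (h.2.1 s(u, v)).2 (List.mem_map.2 ⟨_, he, rfl⟩)
  have h2 : G.weight s(u, v) = w := h.2.2 _ he
  exact h2 ▸ WeightedGraph.Near.of_adj h1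

theorem IsEdgeList.weightsOneOrTwo {n : ℕ} {G : WeightedGraph (Fin n)}
    {L : List (Fin n × Fin n × ℕ)} (h : IsEdgeList G L) (hw : ∀ e ∈ L, e.2.2 = 1 ∨ e.2.2 = 2) :
    G.WeightsOneOrTwo := by
  intro e he
  obtain ⟨x, hx, rfl⟩ := List.mem_map.1 ((h.2.1 e).1 he)
  rw [h.2.2 x hx]
  exact hw x hx

/-- An edge is listed in one orientation but may be traversed in both, so the hypothesis has two
inequalities. -/
theorem IsEdgeList.lipschitz {n : ℕ} {G : WeightedGraph (Fin n)}
    {L : List (Fin n × Fin n × ℕ)} (h : IsEdgeList G L) {φ : Fin n → ℕ}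
    (hφ : ∀ e ∈ L, φ e.1 ≤ φ e.2.1 + e.2.2 ∧ φ e.2.1 ≤ φ e.1 + e.2.2) (u v : Fin n)
    (ha : G.graph.Adj u v) : φ v ≤ φ u + G.weight s(u, v) := by
  obtain ⟨x, hx, hs⟩ := List.mem_map.1 ((h.2.1 s(u, v)).1 ha)
  have := hφ x hx
  rw [← hs, h.2.2 x hx]
  rcases Sym2.eq_iff.1 hs with ⟨h1, h2⟩ | ⟨h1, h2⟩
  · rw [← h1, ← h2]; exact this.2
  · rw [← h1, ← h2]; exact this.1

/-! ### The graph of a `3`-OV instance -/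

/-- The two sides of the graph belong to the families `0` and `2`. -/
def sideFamily (σ : Fin 2) : Fin 3 := ⟨2 * σ, by omega⟩

/-- The vertices: on both sides of the graph (for a vector `g` of the family of that side) a pair
of hubs `t g` and `h g`, a vertex `s g b` for every vector `b` of the middle family, and a
vertex `l g x y` for every pair of coordinates; moreover a center `m` and leaves `p i`. -/
inductive OVVertex (n d q : ℕ) where
  | m
  | p (i : Fin q)
  | t (g : Fin 2 × Fin n)
  | h (g : Fin 2 × Fin n)
  | s (g : Fin 2 × Fin n) (b : Fin n)
  | l (g : Fin 2 × Fin n) (x y : Fin d)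

namespace OVInstance
open OVVertex
variable {n d : ℕ} (I : OVInstance 3 n d) (q : ℕ)

/-- Here `x` is where `g` meets the middle vector of its own side, and `y` is reserved for the
middle vector of the other side, so `b` is not tested at `y`. Crossing to the other side exchanges
the two roles, which is why `ll` edges swap `x` and `y`. -/
def SL (g : Fin 2 × Fin n) (b : Fin n) (x y : Fin d) : Prop :=
  I (sideFamily g.1) g.2 x = true ∧ I (sideFamily g.1) g.2 y = true ∧ I 1 b x = true

def LL (a c : Fin n) (x y : Fin d) : Prop :=
  (I 0 a x = true ∧ I 0 a y = true) ∧ I 2 c x = true ∧ I 2 c y = true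

instance (g : Fin 2 × Fin n) (b : Fin n) (x y : Fin d) : Decidable (I.SL g b x y) :=
  inferInstanceAs (Decidable (_ ∧ _))

instance (a c : Fin n) (x y : Fin d) : Decidable (I.LL a c x y) :=
  inferInstanceAs (Decidable (_ ∧ _))

/-- The edges with their weights. -/
inductive Edge : OVVertex n d q × OVVertex n d q × ℕ → Prop
  | mp (i : Fin q) : Edge (m, p i, 1)
  | th (g : Fin 2 × Fin n) : Edge (t g, h g, 1)
  | mh (g : Fin 2 × Fin n) : Edge (m, h g, 2)
  | tt (σ : Fin 2) (a a' : Fin n) (ha : a' < a) : Edge (t (σ, a), t (σ, a'), 2)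
  | hl (g : Fin 2 × Fin n) (x y : Fin d) : Edge (h g, l g x y, 1)
  | ts (g : Fin 2 × Fin n) (b : Fin n) : Edge (t g, s g b, 2)
  | sl (g : Fin 2 × Fin n) (b : Fin n) (x y : Fin d) (hs : I.SL g b x y) :
      Edge (s g b, l g x y, 2)
  | ll (a c : Fin n) (x y : Fin d) (hl : I.LL a c x y) : Edge (l (0, a) x y, l (1, c) y x, 2)

/-- The edges at a block of vertices. -/
def blockEdges (g : Fin 2 × Fin n) : List (OVVertex n d q × OVVertex n d q × ℕ) :=
  [(t g, h g, 1)] ++ ([(m, h g, 2)] ++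
  (((List.finRange n).flatMap fun a' => if a' < g.2 then [(t g, t (g.1, a'), 2)] else []) ++
  (((List.finRange d).flatMap fun x => (List.finRange d).flatMap fun y => [(h g, l g x y, 1)]) ++
  (List.finRange n).flatMap fun b => [(t g, s g b, 2)] ++
    ((List.finRange d).flatMap fun x => (List.finRange d).flatMap fun y =>
      if I.SL g b x y then [(s g b, l g x y, 2)] else []))))

def crossEdges : List (OVVertex n d q × OVVertex n d q × ℕ) :=
  (List.finRange n).flatMap fun a => (List.finRange n).flatMap fun c =>
    (List.finRange d).flatMap fun x => (List.finRange d).flatMap fun y =>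
      if I.LL a c x y then [(l (0, a) x y, l (1, c) y x, 2)] else []

def leafEdges : List (OVVertex n d q × OVVertex n d q × ℕ) :=
  (List.finRange q).flatMap fun i => [(m, p i, 1)]

def edges : List (OVVertex n d q × OVVertex n d q × ℕ) :=
  leafEdges q ++ (((List.finRange 2).flatMap fun σ => (List.finRange n).flatMap fun a =>
    I.blockEdges q (σ, a)) ++ I.crossEdges q)

variable {I q}

theorem mem_blockEdges {g : Fin 2 × Fin n} {e : OVVertex n d q × OVVertex n d q × ℕ} :
    e ∈ I.blockEdges q g ↔ e = (t g, h g, 1) ∨ e = (m, h g, 2) ∨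
      (∃ a' < g.2, e = (t g, t (g.1, a'), 2)) ∨ (∃ x y, e = (h g, l g x y, 1)) ∨
      ∃ b, e = (t g, s g b, 2) ∨ ∃ x y, I.SL g b x y ∧ e = (s g b, l g x y, 2) := by
  simp [blockEdges]

theorem mem_crossEdges {e : OVVertex n d q × OVVertex n d q × ℕ} :
    e ∈ I.crossEdges q ↔ ∃ a c x y, I.LL a c x y ∧ e = (l (0, a) x y, l (1, c) y x, 2) := by
  simp [crossEdges]

theorem mem_leafEdges {e : OVVertex n d q × OVVertex n d q × ℕ} :
    e ∈ leafEdges (n := n) (d := d) q ↔ ∃ i, e = (m, p i, 1) := by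
  simp [leafEdges]

theorem mem_edges {e : OVVertex n d q × OVVertex n d q × ℕ} : e ∈ I.edges q ↔ I.Edge q e := by
  simp only [edges, List.mem_append, List.mem_flatMap, List.mem_finRange, true_and,
    mem_blockEdges, mem_crossEdges, mem_leafEdges]
  constructor
  · rintro (⟨i, rfl⟩ | ⟨σ, a, rfl | rfl | ⟨a', ha, rfl⟩ | ⟨x, y, rfl⟩ | ⟨b, rfl | ⟨x, y, hs, rfl⟩⟩⟩ |
      ⟨a, c, x, y, hl, rfl⟩)
    · exact .mp i
    · exact .th _
    · exact .mh _
    · exact .tt _ _ _ ha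
    · exact .hl _ _ _
    · exact .ts _ _
    · exact .sl _ _ _ _ hs
    · exact .ll _ _ _ _ hl
  · rintro (i | ⟨σ, a⟩ | ⟨σ, a⟩ | ⟨σ, a, a', ha⟩ | ⟨⟨σ, a⟩, x, y⟩ | ⟨⟨σ, a⟩, b⟩ |
      ⟨⟨σ, a⟩, b, x, y, hs⟩ | ⟨a, c, x, y, hl⟩)
    · exact .inl ⟨i, rfl⟩
    · exact .inr (.inl ⟨σ, a, .inl rfl⟩)
    · exact .inr (.inl ⟨σ, a, .inr (.inl rfl)⟩)
    · exact .inr (.inl ⟨σ, a, .inr (.inr (.inl ⟨a', ha, rfl⟩))⟩)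
    · exact .inr (.inl ⟨σ, a, .inr (.inr (.inr (.inl ⟨x, y, rfl⟩)))⟩)
    · exact .inr (.inl ⟨σ, a, .inr (.inr (.inr (.inr ⟨b, .inl rfl⟩)))⟩)
    · exact .inr (.inl ⟨σ, a, .inr (.inr (.inr (.inr ⟨b, .inr ⟨x, y, hs, rfl⟩⟩)))⟩)
    · exact .inr (.inr ⟨a, c, x, y, hl, rfl⟩)

theorem nodup_flatMap_finRange {β : Type*} {k : ℕ} {f : Fin k → List β}
    (h1 : ∀ i, (f i).Nodup) (h2 : ∀ i j e, e ∈ f i → e ∈ f j → i = j) :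
    ((List.finRange k).flatMap f).Nodup := by
  refine List.nodup_flatMap.2 ⟨fun i _ => h1 i, (List.nodup_finRange k).imp fun {i j} hij => ?_⟩
  intro e h h'
  exact hij (h2 i j e h h')

theorem nodup_blockEdges (g : Fin 2 × Fin n) : (I.blockEdges q g).Nodup := by
  refine List.nodup_append'.2 ⟨by simp, List.nodup_append'.2 ⟨by simp, List.nodup_append'.2
    ⟨nodup_flatMap_finRange (fun i => ?_) (fun i j e => ?_), List.nodup_append'.2
    ⟨nodup_flatMap_finRange (fun i => nodup_flatMap_finRange (fun j => by simp) (fun i j e => ?_))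
      (fun i j e => ?_),
     nodup_flatMap_finRange (fun b => List.nodup_append'.2 ⟨by simp,
      nodup_flatMap_finRange (fun i => nodup_flatMap_finRange (fun j => ?_) (fun i j e => ?_))
        (fun i j e => ?_), ?_⟩)
      (fun i j e => ?_), ?_⟩, ?_⟩, ?_⟩, ?_⟩
  · split_ifs <;> simp
  · simp; grind
  · simp; grind
  · simp; grind
  · split_ifs <;> simp
  · simp; grind
  · simp; grind
  · intro e; simp; grind
  · simp; grind
  · intro e; simp; grind
  · intro e; simp; grind
  · intro e; simp; grind
  · intro e; simp; grind

theorem nodup_edges : (I.edges q).Nodup := by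
  refine List.nodup_append'.2 ⟨nodup_flatMap_finRange (by simp) (by simp),
    List.nodup_append'.2 ⟨nodup_flatMap_finRange (fun σ => nodup_flatMap_finRange
      (fun a => nodup_blockEdges _) fun a a' e => ?_) fun σ σ' e => ?_,
    nodup_flatMap_finRange (fun a => nodup_flatMap_finRange (fun c => nodup_flatMap_finRange
      (fun x => nodup_flatMap_finRange (fun y => ?_) ?_) ?_) ?_) ?_, ?_⟩, ?_⟩
  · simp only [mem_blockEdges]; grind (splits := 20)
  · simp only [mem_blockEdges, List.mem_flatMap]; grind (splits := 20)
  · split_ifs <;> simp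
  · intro i j e; simp; grind
  · intro i j e; simp; grind
  · intro i j e; simp; grind
  · intro i j e; simp; grind
  · intro e; simp only [mem_blockEdges, List.mem_flatMap, mem_crossEdges]; grind
  · intro e
    simp only [mem_blockEdges, List.mem_flatMap, List.mem_append, mem_crossEdges, mem_leafEdges]
    grind

theorem Edge.ne {u v : OVVertex n d q} {w : ℕ} (h : I.Edge q (u, v, w)) : u ≠ v := by
  cases h <;> simp; grind

theorem Edge.one_or_two {e : OVVertex n d q × OVVertex n d q × ℕ} (h : I.Edge q e) :
    e.2.2 = 1 ∨ e.2.2 = 2 := by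
  cases h <;> simp

/-- The constructor and orientation of an edge are determined by the kinds and sides of its
endpoints, except for edges between two hubs `t`; these are listed only with `a' < a`. -/
theorem nodup_edges_sym2 : ((I.edges q).map fun e => s(e.1, e.2.1)).Nodup := by
  refine nodup_edges.map_on fun x hx y hy hxy => ?_
  rw [mem_edges] at hx hy
  cases hx <;> cases hy <;> simp_all
  grind

/-! #### Distances -/

theorem hasSolution_iff : I.HasSolution ↔
    ∃ a b c, ∀ x, ¬ (I 0 a x = true ∧ I 1 b x = true ∧ I 2 c x = true) := by
  simp only [HasSolution, Finset.sum_eq_zero_iff, Finset.mem_univ, true_imp_iff,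
    Fin.prod_univ_three, mul_eq_zero, Bool.toNat_eq_zero]
  constructor
  · rintro ⟨f, hf⟩
    refine ⟨f 0, f 1, f 2, fun x => ?_⟩
    have := hf x
    grind
  · rintro ⟨a, b, c, h⟩
    refine ⟨![a, b, c], fun x => ?_⟩
    have := h x
    simp
    grind

variable (I) in
/-- A lower bound for the distance from `s (0, a) b`, if `a`, `b`, `c` is a solution. -/
def potential (a b c : Fin n) : OVVertex n d q → ℕ
  -- The potential is antisymmetric about the center: the values on side 1 are 10 minus those on
  -- side 0, with `c` in place of `a`.
  | m => 5
  | p _ => 5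
  | t g => if g.1 = 0 then (if g.2 = a then 2 else 4) else (if g.2 = c then 8 else 6)
  | h g => if g.1 = 0 then (if g.2 = a then 3 else 5) else (if g.2 = c then 7 else 5)
  | s g b' => if g.1 = 0 then (if g.2 = a then (if b' = b then 0 else 4) else 6)
      else (if g.2 = c then (if b' = b then 10 else 6) else 4)
  | l g x y => if g.1 = 0 then (if g.2 = a then (if I.SL g b x y then 2 else 4) else 6)
      else (if g.2 = c then (if I.SL g b x y then 8 else 6) else 4)

/-- Only an edge from the block of `a` to the block of `c` uses that `a, b, c` is a solution: it
requires `a` and `c` to be 1 at `x` and `y`, hence `b` is 0 at both, so its ends have potential 4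
and 6 rather than 2 or 8. -/
theorem Edge.potential {a b c : Fin n}
    (hs : ∀ x, ¬ (I 0 a x = true ∧ I 1 b x = true ∧ I 2 c x = true))
    {e : OVVertex n d q × OVVertex n d q × ℕ} (h : I.Edge q e) :
    I.potential a b c e.1 ≤ I.potential a b c e.2.1 + e.2.2 ∧
      I.potential a b c e.2.1 ≤ I.potential a b c e.1 + e.2.2 := by
  rcases h with i | g | g | ⟨σ, a1, a2, ha⟩ | ⟨g, x, y⟩ | ⟨g, b'⟩ | ⟨g, b', x, y, h⟩ |
    ⟨a1, c1, x, y, h⟩ <;> simp only [OVInstance.potential]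
  · simp
  · split_ifs <;> simp
  · split_ifs <;> simp
  · split_ifs <;> simp
  · split_ifs <;> simp
  · split_ifs <;> simp
  -- If `b' = b`, the edge itself provides `SL`, so the `l` end has value 2 or 8, next to 0 or 10.
  · split_ifs <;> simp_all
  · have hx := hs x
    have hy := hs y
    clear hs
    simp only [LL] at h
    by_cases h1 : a1 = a <;> by_cases h2 : c1 = c <;> by_cases h3 : I 1 b x = true <;>
      by_cases h4 : I 1 b y = true <;> simp_all [SL, sideFamily]

section Near
variable {N : ℕ} {G : WeightedGraph (Fin N)} {code : OVVertex n d q → Fin N}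
  (hG : ∀ u v w, I.Edge q (u, v, w) → G.Near (code u) (code v) w)
include hG

theorem near_m_t (g : Fin 2 × Fin n) : G.Near (code m) (code (t g)) 3 :=
  (hG _ _ _ (.mh g)).trans (hG _ _ _ (.th g)).symm

theorem near_t_t (σ : Fin 2) (a a' : Fin n) : G.Near (code (t (σ, a))) (code (t (σ, a'))) 2 := by
  rcases lt_trichotomy a a' with h | rfl | h
  · exact (hG _ _ _ (.tt _ _ _ h)).symm
  · exact .refl _ _
  · exact hG _ _ _ (.tt _ _ _ h)

/-- Vertices other than the center and the leaves are close to a hub and to those `l a x y` that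
`s a b` is adjacent to, for some `a` and `b`. -/
theorem near_cases (u : OVVertex n d q) : G.Near (code u) (code m) 1 ∨
    ∃ (g : Fin 2 × Fin n) (b : Fin n), G.Near (code u) (code (t g)) 2 ∧
      ∀ x y, I.SL g b x y → G.Near (code u) (code (l g x y)) 2 := by
  cases u with
  | m => exact .inl (.refl _ _)
  | p i => exact .inl (hG _ _ _ (.mp i)).symm
  -- A hub reaches every `l g x y` of its block, so any middle vector will do; the index `g.2` is
  -- one at hand.
  | t g => exact .inr ⟨g, g.2, .refl _ _, fun x y _ => (hG _ _ _ (.th g)).trans (hG _ _ _ (.hl g x y))⟩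
  | h g => exact .inr ⟨g, g.2, (hG _ _ _ (.th g)).symm.mono (by simp),
      fun x y _ => (hG _ _ _ (.hl g x y)).mono (by simp)⟩
  | s g b => exact .inr ⟨g, b, (hG _ _ _ (.ts g b)).symm, fun x y h => hG _ _ _ (.sl g b x y h)⟩
  | l g x y => exact .inr ⟨g, g.2, (hG _ _ _ (.hl g x y)).symm.trans (hG _ _ _ (.th g)).symm,
      fun x' y' _ => (hG _ _ _ (.hl g x y)).symm.trans (hG _ _ _ (.hl g x' y'))⟩

/-- Holds for every instance, so the graph is connected with diameter at most 10 even when there is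
a solution. -/
theorem near_m (u : OVVertex n d q) : G.Near (code u) (code m) 5 := by
  rcases near_cases hG u with h | ⟨g, b, h, -⟩
  · exact h.mono (by simp)
  · exact h.trans (near_m_t hG g).symm

/-- If one end is within 1 of the center, the path has length at most 1 + 5; on the same side it
runs through two hubs, 2 + 2 + 2; on opposite sides it runs through an `ll` edge, again 2 + 2 + 2.
-/
theorem near_of_not_hasSolution (hI : ¬ I.HasSolution) (u v : OVVertex n d q) :
    G.Near (code u) (code v) 6 := by
  rcases near_cases hG u with hu | ⟨⟨σ, a⟩, b, hu, hu'⟩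
  · exact hu.trans (near_m hG v).symm
  rcases near_cases hG v with hv | ⟨⟨τ, c⟩, b', hv, hv'⟩
  · exact (near_m hG u).trans hv.symm
  by_cases hστ : σ = τ
  · subst hστ
    exact (hu.trans (near_t_t hG σ a c)).trans hv.symm
  rw [hasSolution_iff] at hI
  push Not at hI
  -- The coordinate `x` comes from the triple `a, b, c` and `y` from `a, b', c`; together they
  -- select the pair of `l` vertices.
  have key : ∀ {u v : OVVertex n d q} {a b c b' : Fin n},
      (∀ x y, I.SL (0, a) b x y → G.Near (code u) (code (l (0, a) x y)) 2) →
      (∀ x y, I.SL (1, c) b' x y → G.Near (code v) (code (l (1, c) x y)) 2) →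
      G.Near (code u) (code v) 6 := by
    intro u v a b c b' h1 h2
    obtain ⟨x, hx⟩ := hI a b c
    obtain ⟨y, hy⟩ := hI a b' c
    exact ((h1 x y ⟨hx.1, hy.1, hx.2.1⟩).trans (hG _ _ _ (.ll a c x y
      ⟨⟨hx.1, hy.1⟩, hx.2.2, hy.2.2⟩))).trans (h2 y x ⟨hy.2.2, hx.2.2, hy.2.1⟩).symm
  have h : (σ = 0 ∧ τ = 1) ∨ (σ = 1 ∧ τ = 0) := by omega
  rcases h with ⟨rfl, rfl⟩ | ⟨rfl, rfl⟩
  · exact key hu' hv'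
  · exact (key hv' hu').symm

end Near

end OVInstance


/-! ### Numbering the vertices -/

namespace OVVertex
variable {n d q : ℕ}

/-- The number of vertices in a block. -/
abbrev blockSize (n d : ℕ) : ℕ := n + d * d + 2

/-- The total number of vertices. -/
abbrev count (n d q : ℕ) : ℕ := q + 1 + 2 * n * blockSize n d

/-- The first number in a block. -/
def base (d q : ℕ) (g : Fin 2 × Fin n) : ℕ := q + 1 + (g.1 * n + g.2) * blockSize n d

def number : OVVertex n d q → ℕ
  | m => 0
  | p i => i + 1
  | t g => base d q g
  | h g => base d q g + 1
  | s g b => base d q g + (b + 2)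
  | l g x y => base d q g + (x * d + y + (n + 2))

theorem mul_add_lt {a b k r : ℕ} (ha : a < b) (hr : r < k) : a * k + r < b * k := by
  have : (a + 1) * k ≤ b * k := Nat.mul_le_mul_right _ ha
  rw [add_mul, one_mul] at this
  omega

theorem mul_add_inj {a b k r s : ℕ} (hr : r < k) (hs : s < k) (h : a * k + r = b * k + s) :
    a = b ∧ r = s := by
  have h1 : a = b := by
    rcases lt_trichotomy a b with hab | hab | hab
    · have := mul_add_lt hab hr; omega
    · exact hab
    · have := mul_add_lt hab hs; omega
  subst h1
  exact ⟨rfl, by omega⟩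

theorem side_lt (g : Fin 2 × Fin n) : (g.1 : ℕ) * n + g.2 < 2 * n := mul_add_lt g.1.2 g.2.2

theorem pair_lt (x y : Fin d) : (x : ℕ) * d + y < d * d := mul_add_lt x.2 y.2

theorem base_add_lt {g : Fin 2 × Fin n} {r : ℕ} (hr : r < blockSize n d) :
    base d q g + r < count n d q := by
  have := mul_add_lt (side_lt g) hr
  simp only [base, count]
  omega

theorem number_lt (u : OVVertex n d q) : u.number < count n d q := by
  cases u with
  | m => simp only [number, count]; omega
  | p i => simp only [number, count]; have := i.2; omega
  | t g => exact base_add_lt (r := 0) (by simp)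
  | h g => exact base_add_lt (by simp)
  | s g b => exact base_add_lt (by simp only [blockSize]; omega)
  | l g x y => exact base_add_lt (by simp only [blockSize]; have := pair_lt x y; omega)

theorem base_add_inj {g g' : Fin 2 × Fin n} {r r' : ℕ} (hr : r < blockSize n d)
    (hr' : r' < blockSize n d) (h : base d q g + r = base d q g' + r') : g = g' ∧ r = r' := by
  simp only [base] at h
  obtain ⟨h1, h2⟩ := mul_add_inj hr hr' (add_left_cancel (by rw [← add_assoc, h, add_assoc]))
  obtain ⟨h3, h4⟩ := mul_add_inj g.2.2 g'.2.2 h1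
  exact ⟨Prod.ext (Fin.ext h3) (Fin.ext h4), h2⟩

/-- Division and remainder invert the mixed-radix numbering. Surjectivity matters: an unused number
would be an isolated vertex and make the diameter infinite. -/
theorem number_surjective {k : ℕ} (hk : k < count n d q) : ∃ u : OVVertex n d q, u.number = k := by
  by_cases h0 : k = 0
  · exact ⟨m, h0.symm⟩
  by_cases h1 : k < q + 1
  · exact ⟨p ⟨k - 1, by omega⟩, by simp only [number]; omega⟩
  obtain ⟨j, rfl⟩ : ∃ j, k = q + 1 + j := ⟨k - (q + 1), by omega⟩
  have hQ : 0 < blockSize n d := by simp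
  have h2 : j / blockSize n d < 2 * n := by
    rw [Nat.div_lt_iff_lt_mul hQ]; simp only [count] at hk; omega
  have hn : 0 < n := Nat.pos_of_ne_zero fun h => by subst h; simp at h2
  have h3 : j / blockSize n d / n < 2 := by rwa [Nat.div_lt_iff_lt_mul hn]
  set r := j % blockSize n d with hr
  have hrlt : r < blockSize n d := Nat.mod_lt _ hQ
  let g : Fin 2 × Fin n := (⟨_, h3⟩, ⟨j / blockSize n d % n, Nat.mod_lt _ hn⟩)
  have hg : base d q g + r = q + 1 + j := by
    simp only [base, g]
    rw [mul_comm (_ / n), Nat.div_add_mod, mul_comm, add_assoc, Nat.div_add_mod]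
  rw [← hg]
  by_cases r0 : r = 0
  · exact ⟨t g, by simp [number, r0]⟩
  by_cases r1 : r = 1
  · exact ⟨h g, by simp [number, r1]⟩
  by_cases r2 : r < n + 2
  · exact ⟨s g ⟨r - 2, by omega⟩, by simp only [number]; omega⟩
  obtain ⟨z, hz⟩ : ∃ z, r = z + (n + 2) := ⟨r - (n + 2), by omega⟩
  have hzd : z < d * d := by simp only [blockSize] at hrlt; omega
  have hd : 0 < d := Nat.pos_of_ne_zero fun h => by simp [h] at hzd
  refine ⟨l g ⟨z / d, by rwa [Nat.div_lt_iff_lt_mul hd]⟩ ⟨z % d, Nat.mod_lt _ hd⟩, ?_⟩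
  simp only [number]
  rw [mul_comm, Nat.div_add_mod, hz]

theorem number_injective : Function.Injective (number : OVVertex n d q → ℕ) := by
  have key : ∀ {g g' : Fin 2 × Fin n} {r r' : ℕ}, base d q g + r = base d q g' + r' →
      r < blockSize n d → r' < blockSize n d → g = g' ∧ r = r' :=
    fun h hr hr' => base_add_inj hr hr' h
  have hb : ∀ g : Fin 2 × Fin n, q + 1 ≤ base d q g := fun g => by simp [base]
  have h1 : 1 < blockSize n d := by simp
  have h2 : ∀ b : Fin n, (b : ℕ) + 2 < blockSize n d := fun b => by simp only [blockSize]; omega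
  have h3 : ∀ x y : Fin d, (x : ℕ) * d + y + (n + 2) < blockSize n d := fun x y => by
    simp only [blockSize]; have := pair_lt x y; omega
  have key0 : ∀ {g g' : Fin 2 × Fin n} {r : ℕ}, base d q g + r = base d q g' →
      r < blockSize n d → g = g' ∧ r = 0 :=
    fun h hr => base_add_inj hr (by omega) (h.trans (add_zero _).symm)
  intro u v huv
  cases u <;> cases v <;> simp only [number] at huv
  case m.m => rfl
  case p.p i j => rw [Fin.ext (by omega : (i : ℕ) = j)]
  case t.t g g' => rw [(key0 (r := 0) huv (by omega)).1]
  case h.h g g' => rw [(key huv h1 h1).1]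
  case s.s g b g' b' =>
    obtain ⟨rfl, h⟩ := key huv (h2 b) (h2 b')
    rw [Fin.ext (by omega : (b : ℕ) = b')]
  case l.l g x y g' x' y' =>
    obtain ⟨rfl, h⟩ := key huv (h3 x y) (h3 x' y')
    obtain ⟨h4, h5⟩ := mul_add_inj y.2 y'.2 (add_right_cancel h)
    rw [Fin.ext h4, Fin.ext h5]
  all_goals exfalso
  case t.h g g' => have := (key0 huv.symm h1).2; omega
  case h.t g g' => have := (key0 huv h1).2; omega
  case t.s g g' b => have := (key0 huv.symm (h2 b)).2; omega
  case s.t g b g' => have := (key0 huv (h2 b)).2; omega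
  case t.l g g' x y => have := (key0 huv.symm (h3 x y)).2; omega
  case l.t g x y g' => have := (key0 huv (h3 x y)).2; omega
  case h.s g g' b => have := (key huv h1 (h2 b)).2; omega
  case s.h g b g' => have := (key huv (h2 b) h1).2; omega
  case h.l g g' x y => have := (key huv h1 (h3 x y)).2; omega
  case l.h g x y g' => have := (key huv (h3 x y) h1).2; omega
  case s.l g b g' x y => have := (key huv (h2 b) (h3 x y)).2; omega
  case l.s g x y g' b => have := (key huv (h3 x y) (h2 b)).2; omega
  all_goals first
    | omega
    | (rename_i g; have := hb g; omega)
    | (rename_i g _; have := hb g; omega)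
    | (rename_i g _ _; have := hb g; omega)
    | (rename_i g _ _ _; have := hb g; omega)

def toFin (u : OVVertex n d q) : Fin (count n d q) := ⟨u.number, u.number_lt⟩

theorem toFin_injective : Function.Injective (toFin : OVVertex n d q → _) :=
  fun _ _ h => number_injective (congrArg Fin.val h)

theorem toFin_surjective : Function.Surjective (toFin : OVVertex n d q → _) := fun k => by
  obtain ⟨u, hu⟩ := number_surjective k.2
  exact ⟨u, Fin.ext hu⟩

end OVVertex

/-! ### The gadget on numbered vertices, its distances and its size -/

namespace OVInstance
open OVVertex
variable {n d : ℕ} (I : OVInstance 3 n d) (q : ℕ)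

/-- The list of the edges after numbering the vertices. -/
def edgeList : List (Fin (count n d q) × Fin (count n d q) × ℕ) :=
  (I.edges q).map fun e => (e.1.toFin, e.2.1.toFin, e.2.2)

/-- The graph of a `3`-OV instance. -/
def graph : WeightedGraph (Fin (count n d q)) := .ofEdges (I.edgeList q)

theorem isEdgeList : IsEdgeList (I.graph q) (I.edgeList q) := by
  refine isEdgeList_ofEdges ?_ fun e he => ?_
  · rw [edgeList, List.map_map]
    have : (fun e : Fin (count n d q) × Fin (count n d q) × ℕ => s(e.1, e.2.1)) ∘
        (fun e : OVVertex n d q × OVVertex n d q × ℕ => (e.1.toFin, e.2.1.toFin, e.2.2)) =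
        Sym2.map toFin ∘ fun e => s(e.1, e.2.1) := by funext e; rfl
    rw [this, ← List.map_map]
    exact I.nodup_edges_sym2.map (Sym2.map.injective toFin_injective)
  · obtain ⟨⟨u, v, w⟩, hx, rfl⟩ := List.mem_map.1 he
    exact fun h => (mem_edges.1 hx).ne (toFin_injective h)

theorem near_toFin (u v : OVVertex n d q) (w : ℕ) (h : I.Edge q (u, v, w)) :
    (I.graph q).Near u.toFin v.toFin w :=
  (I.isEdgeList q).near (List.mem_map.2 ⟨_, mem_edges.2 h, rfl⟩)

theorem graph_weightsOneOrTwo : (I.graph q).WeightsOneOrTwo := by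
  refine (I.isEdgeList q).weightsOneOrTwo fun e he => ?_
  obtain ⟨x, hx, rfl⟩ := List.mem_map.1 he
  exact (mem_edges.1 hx).one_or_two

theorem graph_dist_le_ten (u v : Fin (count n d q)) : (I.graph q).dist u v ≤ 10 := by
  obtain ⟨u, rfl⟩ := toFin_surjective u
  obtain ⟨v, rfl⟩ := toFin_surjective v
  exact ((near_m (I.near_toFin q) u).trans (near_m (I.near_toFin q) v).symm).dist_le

variable {I} in
theorem graph_dist_le_six (hI : ¬ I.HasSolution) (u v : Fin (count n d q)) :
    (I.graph q).dist u v ≤ 6 := by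
  obtain ⟨u, rfl⟩ := toFin_surjective u
  obtain ⟨v, rfl⟩ := toFin_surjective v
  exact (near_of_not_hasSolution (I.near_toFin q) hI u v).dist_le

variable {I} in
theorem exists_ten_le_graph_dist (hI : I.HasSolution) :
    ∃ u v : Fin (count n d q), 10 ≤ (I.graph q).dist u v := by
  obtain ⟨a, b, c, hs⟩ := hasSolution_iff.1 hI
  -- The potential is transported along the inverse of the numbering.
  let φ : Fin (count n d q) → ℕ := fun k => I.potential a b c (Function.surjInv toFin_surjective k)
  have hφ : ∀ u : OVVertex n d q, φ u.toFin = I.potential a b c u := fun u => by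
    simp only [φ]
    rw [toFin_injective (Function.surjInv_eq toFin_surjective u.toFin)]
  refine ⟨(s (0, a) b).toFin, (s (1, c) b).toFin, ?_⟩
  have := WeightedGraph.le_dist_of_potential (G := I.graph q) (φ := φ)
    (u := (s (0, a) b).toFin) (v := (s (1, c) b).toFin)
    ((I.isEdgeList q).lipschitz fun e he => by
      obtain ⟨x, hx, rfl⟩ := List.mem_map.1 he
      simp only [hφ]
      exact (mem_edges.1 hx).potential hs) (by rw [hφ]; simp [potential])
  rw [hφ] at this
  simpa [potential] using this

theorem length_flatMap_finRange_le {β : Type*} {k c : ℕ} {f : Fin k → List β}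
    (h : ∀ i, (f i).length ≤ c) : ((List.finRange k).flatMap f).length ≤ k * c := by
  rw [List.length_flatMap]
  refine (List.sum_le_card_nsmul _ c fun x hx => ?_).trans (by simp)
  obtain ⟨i, -, rfl⟩ := List.mem_map.1 hx
  exact h i

theorem length_blockEdges_le (g : Fin 2 × Fin n) :
    (I.blockEdges q g).length ≤ 2 + n + d * d + n * (1 + d * d) := by
  have h1 : ((List.finRange n).flatMap fun a' => if a' < g.2 then
      [((t g, t (g.1, a'), 2) : OVVertex n d q × OVVertex n d q × ℕ)] else []).length ≤ n * 1 :=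
    length_flatMap_finRange_le fun i => by split_ifs <;> simp
  have h2 : ((List.finRange d).flatMap fun x => (List.finRange d).flatMap fun y =>
      [((OVVertex.h g, l g x y, 1) : OVVertex n d q × OVVertex n d q × ℕ)]).length ≤ d * (d * 1) :=
    length_flatMap_finRange_le fun i => length_flatMap_finRange_le fun j => by simp
  have h3 : ((List.finRange n).flatMap fun b => [((t g, s g b, 2) :
      OVVertex n d q × OVVertex n d q × ℕ)] ++
      ((List.finRange d).flatMap fun x => (List.finRange d).flatMap fun y =>
      if I.SL g b x y then [(s g b, l g x y, 2)] else [])).length ≤ n * (1 + d * (d * 1)) :=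
    length_flatMap_finRange_le fun b => by
      rw [List.length_append]
      exact Nat.add_le_add (by simp) (length_flatMap_finRange_le fun i =>
        length_flatMap_finRange_le fun j => by split_ifs <;> simp)
  simp only [blockEdges, List.length_append, List.length_singleton] at h3 ⊢
  simp only [mul_one] at h1 h2 h3
  omega

theorem length_edgeList_le : (I.edgeList q).length ≤
    q + 2 * (n * (2 + n + d * d + n * (1 + d * d))) + n * (n * (d * d)) := by
  have h1 : (leafEdges (n := n) (d := d) q).length ≤ q * 1 :=
    length_flatMap_finRange_le fun i => by simp
  have h2 : ((List.finRange 2).flatMap fun σ => (List.finRange n).flatMap fun a =>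
      I.blockEdges q (σ, a)).length ≤ 2 * (n * (2 + n + d * d + n * (1 + d * d))) :=
    length_flatMap_finRange_le fun σ => length_flatMap_finRange_le fun a =>
      I.length_blockEdges_le q _
  have h3 : (I.crossEdges q).length ≤ n * (n * (d * (d * 1))) :=
    length_flatMap_finRange_le fun i => length_flatMap_finRange_le fun j =>
      length_flatMap_finRange_le fun x => length_flatMap_finRange_le fun y => by
        split_ifs <;> simp
  simp only [edgeList, edges, List.length_map, List.length_append, mul_one] at *
  omega

end OVInstance

namespace WordRAM

section
variable (a b : Ex)
@[simp] theorem Ex.cost_c (k : ℕ) : cost (c k) = 1 := rfl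
@[simp] theorem Ex.cost_ofNat (k : ℕ) : cost (no_index (OfNat.ofNat k : Ex)) = 1 := rfl
@[simp] theorem Ex.cost_v (i : ℕ) : cost (v i) = 1 := rfl
@[simp] theorem Ex.cost_ld : cost (ld a) = a.cost + 1 := rfl
@[simp] theorem Ex.cost_o (op : Op) : cost (o op a b) = a.cost + (b.cost + 1) := rfl
@[simp] theorem Ex.cost_add : cost (a + b) = a.cost + (b.cost + 1) := rfl
@[simp] theorem Ex.cost_sub : cost (a - b) = a.cost + (b.cost + 1) := rfl
@[simp] theorem Ex.cost_mul : cost (a * b) = a.cost + (b.cost + 1) := rfl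
@[simp] theorem Ex.cost_div : cost (a / b) = a.cost + (b.cost + 1) := rfl
@[simp] theorem Ex.cost_mod : cost (a % b) = a.cost + (b.cost + 1) := rfl
end

/-! ### Rules with syntactic overflow checks -/

theorem Ex.Ok.ev_lt {W : ℕ} {Ro : Set ℕ} {ρ M : ℕ → ℕ} {e : Ex} (h : e.Ok W Ro ρ M) :
    e.ev ρ M < W := by
  cases e with
  | c k => exact h
  | v i => exact h
  | o op a b => exact h.2.2
  | ld a => exact h.2.2

theorem Ex.ev_congr {ρ ρ' M : ℕ → ℕ} (e : Ex) (h : ∀ i < e.varBound, ρ i = ρ' i) :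
    e.ev ρ M = e.ev ρ' M := by
  induction e with
  | c k => rfl
  | v i => exact h i (by simp [varBound])
  | o op a b iha ihb =>
    simp only [varBound, lt_max_iff] at h
    simp only [ev, iha fun i hi => h i (.inl hi), ihb fun i hi => h i (.inr hi)]
  | ld a iha => simp only [ev, iha h]

theorem Ex.loads_congr {Ro : Set ℕ} {ρ ρ' M : ℕ → ℕ} (e : Ex) (h : ∀ i < e.varBound, ρ i = ρ' i)
    (hl : e.Loads Ro ρ M) : e.Loads Ro ρ' M := by
  induction e with
  | c k => trivial
  | v i => trivial
  | o op a b iha ihb =>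
    simp only [varBound, lt_max_iff] at h
    exact ⟨iha (fun i hi => h i (.inl hi)) hl.1, ihb (fun i hi => h i (.inr hi)) hl.2⟩
  | ld a iha => exact ⟨iha h hl.1, by rw [← a.ev_congr h]; exact hl.2⟩

theorem Ex.varBound_le_of_fits {D k : ℕ} {e : Ex} (h : e.fits D k = true) : e.varBound ≤ k := by
  simp only [fits, Bool.and_eq_true, decide_eq_true_eq] at h
  exact h.2

namespace Ctx
variable {W X D : ℕ} {Ro : Set ℕ} {M : ℕ → ℕ} (h : Ctx W X D Ro M) {p : Prog} {T k : ℕ}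
  {Γ out : List ℕ}
include h

theorem two_le_word (hD : 1 ≤ D) : 2 ≤ W :=
  calc 2 ≤ X ^ 1 := by rw [pow_one]; exact h.two_le
    _ ≤ X ^ D := Nat.pow_le_pow_right (by have := h.two_le; omega) hD
    _ ≤ W := h.pow_le

theorem emit {w : ℕ} (hΓ : ∀ x ∈ Γ, x < X) (e : Ex) (hk : Γ.length = k)
    (hf : e.fits D k = true) (hl : e.Loads Ro (val Γ) M) (hw : e.ev (val Γ) M = w) :
    Exec W Ro M (emit k e) (e.cost + 3) Γ Γ [w] := by
  subst hk hw
  have := h.ok hΓ hf hl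
  exact Exec.emit e (Ex.varBound_le_of_fits hf) this this.ev_lt

theorem push {w : ℕ} (hΓ : ∀ x ∈ Γ, x < X) (e : Ex) (hk : Γ.length = k)
    (hf : e.fits D k = true) (hl : e.Loads Ro (val Γ) M) (hw : e.ev (val Γ) M = w) :
    Exec W Ro M (e.comp (k + 1)) e.cost Γ (Γ ++ [w]) [] := by
  subst hk hw
  exact Exec.push e (Ex.varBound_le_of_fits hf) (h.ok hΓ hf hl)

theorem ifThen {c : Prop} [Decidable c] (hΓ : ∀ x ∈ Γ, x < X) (e : Ex) (hk : Γ.length = k)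
    (hf : e.fits D k = true) (hl : e.Loads Ro (val Γ) M) (hc : e.ev (val Γ) M ≠ 0 ↔ c)
    (hT : 1 ≤ T) (hp : c → Exec W Ro M p T Γ Γ out) :
    Exec W Ro M (ifThen k e p) (e.cost + T + 1) Γ Γ (if c then out else []) := by
  subst hk
  simp only [← hc] at hp ⊢
  exact Exec.ifThen e (Ex.varBound_le_of_fits hf) (h.ok hΓ hf hl) hT hp

/-- A loop that threads some variables. -/
theorem forLoop' {n : ℕ} (F : ℕ → List ℕ) (f : Fin n → List ℕ) (e : Ex)
    (hk : ∀ i, (F i).length = k) (hD : 1 ≤ D) (hF : ∀ i ≤ n, ∀ x ∈ F i, x < X) (hn : n < X)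
    (hf : e.fits D k = true) (hl : ∀ i ≤ n, e.Loads Ro (val (F i)) M)
    (hev : ∀ i ≤ n, e.ev (val (F i)) M = n) (hT : 1 ≤ T)
    (hp : ∀ i : Fin n, Exec W Ro M p T (F i ++ [(i : ℕ)]) (F (i + 1) ++ [(i : ℕ)]) (f i)) :
    Exec W Ro M (forLoop k e p) ((2 * e.cost + 13) * ((n + 1) * T)) (F 0) (F n)
      ((List.finRange n).flatMap f) := by
  have hv := (Ex.varBound_le_of_fits hf)
  have hc : ∀ i, ∀ j < e.varBound, val (F i) j = val (F i ++ [i]) j := fun i j hj =>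
    (val_append_left _ (by rw [hk]; omega)).symm
  have hWD : X ≤ W := by
    calc X = X ^ 1 := (pow_one X).symm
      _ ≤ X ^ D := Nat.pow_le_pow_right (by have := h.two_le; omega) hD
      _ ≤ W := h.pow_le
  have := Exec.forLoop (W := W) (Ro := Ro) (M := M) (p := p) (T := T) (n := n) e F
    (fun i => if hi : i < n then f ⟨i, hi⟩ else []) hk (by omega)
    (fun i hi => ?_) (fun i hi => by rw [← e.ev_congr (hc i), hev i hi]) (hn.trans_le hWD)
    (h.two_le_word hD) (fun i hi => by simpa [hi] using hp ⟨i, hi⟩)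
  · have hout : (List.range n).flatMap (fun i => if hi : i < n then f ⟨i, hi⟩ else []) =
        (List.finRange n).flatMap f := by
      rw [← List.map_coe_finRange_eq_range, List.flatMap_map]
      congr 1
      funext i
      simp
    rw [hout] at this
    refine this.mono ?_
    have : T + (2 * e.cost + 12) ≤ (2 * e.cost + 13) * T := by nlinarith
    calc (n + 1) * (T + (2 * e.cost + 12)) ≤ (n + 1) * ((2 * e.cost + 13) * T) :=
          Nat.mul_le_mul_left _ this
      _ = _ := by ring
  · refine h.ok (fun x hx => ?_) ?_ ⟨trivial, e.loads_congr (hc i) (hl i hi)⟩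
    · rcases List.mem_append.1 hx with hx | hx
      · exact hF i hi x hx
      · rw [List.mem_singleton] at hx; omega
    · simp only [Ex.fits, Bool.and_eq_true, decide_eq_true_eq, Ex.std, Ex.deg, Ex.varBound,
        List.length_append, List.length_singleton, hk, true_and, max_le_iff] at hf ⊢
      exact ⟨⟨hf.1.1, hD, hf.1.2⟩, le_rfl, by omega⟩

theorem forLoop {n : ℕ} (f : Fin n → List ℕ) (hΓ : ∀ x ∈ Γ, x < X) (e : Ex)
    (hk : Γ.length = k) (hD : 1 ≤ D) (hn : n < X)
    (hf : e.fits D k = true) (hl : e.Loads Ro (val Γ) M)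
    (hev : e.ev (val Γ) M = n) (hT : 1 ≤ T)
    (hp : ∀ i : Fin n, Exec W Ro M p T (Γ ++ [(i : ℕ)]) (Γ ++ [(i : ℕ)]) (f i)) :
    Exec W Ro M (forLoop k e p) ((2 * e.cost + 13) * ((n + 1) * T)) Γ Γ
      ((List.finRange n).flatMap f) :=
  h.forLoop' (fun _ => Γ) f e (fun _ => hk) hD (fun _ _ => hΓ) hn hf (fun _ _ => hl)
    (fun _ _ => hev) hT hp

end Ctx

/-- Write three words. -/
def emit3 (k : ℕ) (e₁ e₂ e₃ : Ex) : Prog := .seq (emit k e₁) (.seq (emit k e₂) (emit k e₃))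

theorem Ctx.emit3 {W X D : ℕ} {Ro : Set ℕ} {M : ℕ → ℕ} (h : Ctx W X D Ro M) {k : ℕ}
    {Γ : List ℕ} {w₁ w₂ w₃ : ℕ} (hΓ : ∀ x ∈ Γ, x < X) (e₁ e₂ e₃ : Ex) (hk : Γ.length = k)
    (hf : (e₁.fits D k && e₂.fits D k && e₃.fits D k) = true)
    (hl : e₁.Loads Ro (val Γ) M ∧ e₂.Loads Ro (val Γ) M ∧ e₃.Loads Ro (val Γ) M)
    (hw : e₁.ev (val Γ) M = w₁ ∧ e₂.ev (val Γ) M = w₂ ∧ e₃.ev (val Γ) M = w₃) :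
    Exec W Ro M (WordRAM.emit3 k e₁ e₂ e₃) (e₁.cost + e₂.cost + e₃.cost + 9) Γ Γ [w₁, w₂, w₃] := by
  simp only [Bool.and_eq_true] at hf
  exact ((h.emit hΓ e₁ hk hf.1.1 hl.1 hw.1).seq ((h.emit hΓ e₂ hk hf.1.2 hl.2.1 hw.2.1).seq
    (h.emit hΓ e₃ hk hf.2 hl.2.2 hw.2.2))).mono (by omega)

theorem forall_mem_snoc_lt {Γ : List ℕ} {X x : ℕ} (hΓ : ∀ y ∈ Γ, y < X) (hx : x < X) :
    ∀ y ∈ Γ ++ [x], y < X := by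
  intro y hy
  rcases List.mem_append.1 hy with hy | hy
  · exact hΓ y hy
  · rw [List.mem_singleton] at hy; omega

/-! ### The program that writes the graph -/

namespace GraphProg
open Ex

/-- The number of the first vertex of a block; the variables are the number `0` of vectors, the
dimension `1`, the number `2` of leaves, the address `3` of the instance, and the size `4` of a
block. -/
def baseE (σ a : Ex) : Ex := v 2 + 1 + (σ * v 0 + a) * v 4

/-- A bit of the instance. -/
def bitE (j a x : Ex) : Ex := .ld (v 3 + ((j * v 0 + a) * v 1 + x))

def lE (x y : Ex) : Ex := x * v 1 + y + (v 0 + 2)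

def leaf : Prog := forLoop 5 (v 2) (emit3 6 0 (v 5 + 1) 1)

def hubs : Prog := forLoop 8 (v 0)
  (ifThen 9 (.o .lt (v 8) (v 6)) (emit3 9 (v 7) (baseE (v 5) (v 8)) 2))

def hubLinks : Prog := forLoop 8 (v 1) (forLoop 9 (v 1)
  (emit3 10 (v 7 + 1) (v 7 + lE (v 8) (v 9)) 1))

def pairs : Prog := forLoop 8 (v 0) (.seq (emit3 9 (v 7) (v 7 + (v 8 + 2)) 2)
  (forLoop 9 (v 1) (forLoop 10 (v 1)
    (ifThen 11 (bitE (2 * v 5) (v 6) (v 9) * (bitE (2 * v 5) (v 6) (v 10) * bitE 1 (v 8) (v 9)))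
      (emit3 11 (v 7 + (v 8 + 2)) (v 7 + lE (v 9) (v 10)) 2)))))

def block : Prog := .seq ((baseE (v 5) (v 6)).comp 8) (.seq (emit3 8 (v 7) (v 7 + 1) 1)
  (.seq (emit3 8 0 (v 7 + 1) 2) (.seq hubs (.seq hubLinks pairs))))

def blocks : Prog := forLoop 5 2 (forLoop 6 (v 0) block)

def cross : Prog := forLoop 5 (v 0) (forLoop 6 (v 0) (forLoop 7 (v 1) (forLoop 8 (v 1)
  (ifThen 9 (bitE 0 (v 5) (v 7) * bitE 0 (v 5) (v 8) * (bitE 2 (v 6) (v 7) * bitE 2 (v 6) (v 8)))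
    (emit3 9 (baseE 0 (v 5) + lE (v 7) (v 8)) (baseE 1 (v 6) + lE (v 8) (v 7)) 2)))))

/-- Write the number of vertices, a placeholder, and the edges. -/
def body : Prog := .seq ((v 0 + v 1 * v 1 + 2).comp 5) (.seq (emit 5 (v 2 + 1 + 2 * v 0 * v 4))
  (.seq (emit 5 0) (.seq leaf (.seq blocks cross))))

end GraphProg
end WordRAM

/-! ### Correctness of the program that writes the graph -/

namespace OVInstance
open OVVertex WordRAM GraphProg
variable {n d q : ℕ}

/-- The three words that encode an edge. -/
def words (e : OVVertex n d q × OVVertex n d q × ℕ) : List ℕ := [e.1.number, e.2.1.number, e.2.2]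

theorem encodeGraph_edgeList (I : OVInstance 3 n d) : encodeGraph (count n d q) (I.edgeList q) =
    count n d q :: (I.edgeList q).length :: (I.edges q).flatMap words := by
  simp only [encodeGraph, edgeList, List.flatMap_map]
  rfl

/-- The instance is stored at the address `B`, in the read-only part of the memory. -/
structure Stored (I : OVInstance 3 n d) (B : ℕ) (Ro : Set ℕ) (M : ℕ → ℕ) : Prop where
  mem : ∀ (j : Fin 3) (i : Fin n) (x : Fin d), B + ((j * n + i) * d + x) ∈ Ro
  eq : ∀ (j : Fin 3) (i : Fin n) (x : Fin d), M (B + ((j * n + i) * d + x)) = (I j i x).toNat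

section
variable {I : OVInstance 3 n d} {W X B : ℕ} {Ro : Set ℕ} {M : ℕ → ℕ}
  (hC : Ctx W X 40 Ro M) (hS : I.Stored B Ro M)
  (hΓ : ∀ x ∈ [n, d, q, B, blockSize n d], x < X) (hX : count n d q < X)
include hC hΓ hS hX

omit hS hX in
theorem exec_leaf : Exec W Ro M leaf (1000 * (q + 1)) [n, d, q, B, blockSize n d]
    [n, d, q, B, blockSize n d] ((leafEdges (n := n) (d := d) q).flatMap words) := by
  have hq : q < X := hΓ _ (by simp)
  rw [leafEdges, List.flatMap_assoc]
  -- The pattern for all loops: `decide` checks the degrees against the exponent 40, and the triple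
  -- of `rfl` works because the emitted expressions evaluate definitionally to the vertex numbers
  -- and the weight. The time constants are deliberately crude.
  refine Exec.mono (hC.forLoop _ hΓ _ rfl (by simp) hq (by decide) (by simp) rfl ?_ fun i =>
    hC.emit3 (forall_mem_snoc_lt hΓ (i.2.trans hq)) _ _ _ rfl (by decide) (by simp)
    ⟨rfl, rfl, rfl⟩) ?_
  · simp
  · simp; omega

omit hS hX in
theorem exec_hubs (σ : Fin 2) (a : Fin n)
    (hΓ2 : ∀ x ∈ [n, d, q, B, blockSize n d, (σ : ℕ), (a : ℕ), base d q (σ, a)], x < X) :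
    Exec W Ro M hubs (15 * ((n + 1) * 200)) [n, d, q, B, blockSize n d, σ, a, base d q (σ, a)]
      [n, d, q, B, blockSize n d, σ, a, base d q (σ, a)]
      (((List.finRange n).flatMap fun a' => if a' < a then
        [((t (σ, a), t (σ, a'), 2) : OVVertex n d q × OVVertex n d q × ℕ)] else []).flatMap words) := by
  have hn : n < X := hΓ _ (by simp)
  rw [List.flatMap_assoc]
  refine hC.forLoop _ hΓ2 _ rfl (by simp) hn (by decide) (by simp) rfl (by simp) fun a' => ?_
  have hΓ3 := forall_mem_snoc_lt hΓ2 (a'.2.trans hn)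
  rw [apply_ite (List.flatMap words)]
  exact Exec.mono (hC.ifThen (T := 100) hΓ3 _ rfl (by decide) (by simp) (by simp [val, Op.eval])
    (by simp) fun _ => Exec.mono (hC.emit3 hΓ3 _ _ _ rfl (by decide) (by simp [baseE])
      ⟨rfl, rfl, rfl⟩) (by decide)) (by decide)

omit hS hX in
theorem exec_hubLinks (σ : Fin 2) (a : Fin n)
    (hΓ2 : ∀ x ∈ [n, d, q, B, blockSize n d, (σ : ℕ), (a : ℕ), base d q (σ, a)], x < X) :
    Exec W Ro M hubLinks (15 * ((d + 1) * (15 * ((d + 1) * 100))))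
      [n, d, q, B, blockSize n d, σ, a, base d q (σ, a)]
      [n, d, q, B, blockSize n d, σ, a, base d q (σ, a)]
      (((List.finRange d).flatMap fun x => (List.finRange d).flatMap fun y =>
        [((OVVertex.h (σ, a), l (σ, a) x y, 1) : OVVertex n d q × OVVertex n d q × ℕ)]).flatMap
          words) := by
  have hd : d < X := hΓ _ (by simp)
  rw [List.flatMap_assoc]
  refine hC.forLoop _ hΓ2 _ rfl (by simp) hd (by decide) (by simp) rfl (Nat.succ_le_of_lt (by positivity)) fun x => ?_
  have hΓ3 := forall_mem_snoc_lt hΓ2 (x.2.trans hd)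
  rw [List.flatMap_assoc]
  refine hC.forLoop _ hΓ3 _ rfl (by simp) hd (by decide) (by simp) rfl (by simp) fun y => ?_
  have hΓ4 := forall_mem_snoc_lt hΓ3 (y.2.trans hd)
  exact Exec.mono (hC.emit3 hΓ4 _ _ _ rfl (by decide) (by simp [lE]) ⟨rfl, rfl, rfl⟩) (by decide)

omit hX in
theorem exec_pairs (σ : Fin 2) (a : Fin n)
    (hΓ2 : ∀ x ∈ [n, d, q, B, blockSize n d, (σ : ℕ), (a : ℕ), base d q (σ, a)], x < X) :
    Exec W Ro M pairs (15 * ((n + 1) * (50 + 15 * ((d + 1) * (15 * ((d + 1) * 400))))))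
      [n, d, q, B, blockSize n d, σ, a, base d q (σ, a)]
      [n, d, q, B, blockSize n d, σ, a, base d q (σ, a)]
      (((List.finRange n).flatMap fun b =>
        [((t (σ, a), s (σ, a) b, 2) : OVVertex n d q × OVVertex n d q × ℕ)] ++
        ((List.finRange d).flatMap fun x => (List.finRange d).flatMap fun y =>
          if I.SL (σ, a) b x y then [(s (σ, a) b, l (σ, a) x y, 2)] else [])).flatMap words) := by
  have hn : n < X := hΓ _ (by simp)
  have hd : d < X := hΓ _ (by simp)
  rw [List.flatMap_assoc]
  refine hC.forLoop _ hΓ2 _ rfl (by simp) hn (by decide) (by simp) rfl (Nat.succ_le_of_lt (by positivity)) fun b => ?_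
  have hΓ3 := forall_mem_snoc_lt hΓ2 (b.2.trans hn)
  rw [List.flatMap_append, List.flatMap_assoc]
  refine Exec.seq (Exec.mono (hC.emit3 hΓ3 _ _ _ rfl (by decide) (by simp) ⟨rfl, rfl, rfl⟩)
    (by decide)) ?_
  refine hC.forLoop _ hΓ3 _ rfl (by simp) hd (by decide) (by simp) rfl (Nat.succ_le_of_lt (by positivity)) fun x => ?_
  have hΓ4 := forall_mem_snoc_lt hΓ3 (x.2.trans hd)
  rw [List.flatMap_assoc]
  refine hC.forLoop _ hΓ4 _ rfl (by simp) hd (by decide) (by simp) rfl (Nat.succ_le_of_lt (by positivity)) fun y => ?_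
  have hΓ5 := forall_mem_snoc_lt hΓ4 (y.2.trans hd)
  rw [apply_ite (List.flatMap words)]
  refine Exec.mono (hC.ifThen (T := 100) hΓ5 _ rfl (by decide) ?_ ?_
    (by simp) fun _ => Exec.mono (hC.emit3 hΓ5 _ _ _ rfl (by decide) (by simp [lE])
      ⟨rfl, rfl, rfl⟩) (by decide)) (by decide)
  · have h1 := hS.mem (sideFamily σ) a x
    have h2 := hS.mem (sideFamily σ) a y
    have h3 := hS.mem 1 b x
    simp only [sideFamily, Fin.val_one, one_mul] at h1 h2 h3
    simpa [bitE, val] using ⟨h1, h2, h3⟩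
  · have h1 := hS.eq (sideFamily σ) a x
    have h2 := hS.eq (sideFamily σ) a y
    have h3 := hS.eq 1 b x
    simp only [sideFamily, Fin.val_one, one_mul] at h1 h2 h3
    simp [bitE, val, h1, h2, h3, SL, sideFamily]

theorem exec_block (σ : Fin 2) (a : Fin n) : Exec W Ro M block
    (10000000 * ((n + 1) * ((d + 1) * (d + 1))))
    [n, d, q, B, blockSize n d, σ, a] [n, d, q, B, blockSize n d, σ, a]
    ((I.blockEdges q (σ, a)).flatMap words) := by
  have hn : n < X := hΓ _ (by simp)
  have hd : d < X := hΓ _ (by simp)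
  have hX0 := hC.two_le
  have hΓ1 := forall_mem_snoc_lt (forall_mem_snoc_lt hΓ (σ.2.trans_le hX0)) (a.2.trans hn)
  have hP : base d q (σ, a) < X :=
    (base_add_lt (n := n) (d := d) (q := q) (g := (σ, a)) (r := 0) (by simp)).trans hX
  have hΓ2 := forall_mem_snoc_lt hΓ1 hP
  refine Exec.drop (Γ'' := [base d q (σ, a)]) ?_
  simp only [blockEdges, List.flatMap_append]
  -- The empty list is the output of the instruction that stores the base of the block.
  rw [← List.nil_append (List.flatMap _ _ ++ _)]
  have e1 : Exec W Ro M (emit3 8 (.v 7) (.v 7 + 1) 1) 100 _ _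
      (List.flatMap words [((t (σ, a), OVVertex.h (σ, a), 1) : OVVertex n d q × OVVertex n d q × ℕ)]) :=
    Exec.mono (hC.emit3 hΓ2 _ _ _ rfl (by decide) (by simp) ⟨rfl, rfl, rfl⟩) (by decide)
  have e2 : Exec W Ro M (emit3 8 0 (.v 7 + 1) 2) 100 _ _
      (List.flatMap words [((m, OVVertex.h (σ, a), 2) : OVVertex n d q × OVVertex n d q × ℕ)]) :=
    Exec.mono (hC.emit3 hΓ2 _ _ _ rfl (by decide) (by simp) ⟨rfl, rfl, rfl⟩) (by decide)
  refine Exec.mono (Exec.seq (hC.push hΓ1 _ rfl (by decide) (by simp [baseE]) rfl)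
    (Exec.seq e1 (Exec.seq e2 (Exec.seq (exec_hubs hC hΓ σ a hΓ2)
      (Exec.seq (exec_hubLinks hC hΓ σ a hΓ2) (exec_pairs hC hS hΓ σ a hΓ2)))))) ?_
  simp [baseE]
  nlinarith [Nat.zero_le (n * d), Nat.zero_le (n * d * d)]

theorem exec_blocks (h2 : 2 < X) : Exec W Ro M blocks
    (1000000000000 * ((n + 1) * ((n + 1) * ((d + 1) * (d + 1)))))
    [n, d, q, B, blockSize n d] [n, d, q, B, blockSize n d]
    (((List.finRange 2).flatMap fun σ => (List.finRange n).flatMap fun a =>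
      I.blockEdges q (σ, a)).flatMap words) := by
  have hn : n < X := hΓ _ (by simp)
  have hX0 := hC.two_le
  rw [List.flatMap_assoc]
  refine Exec.mono (hC.forLoop (T := 15 * ((n + 1) * (10000000 * ((n + 1) * ((d + 1) * (d + 1))))))
    _ hΓ _ rfl (by simp) h2 (by decide) (by simp) rfl (Nat.succ_le_of_lt (by positivity)) fun σ => ?_) ?_
  · have hΓ1 := forall_mem_snoc_lt hΓ (σ.2.trans_le hX0)
    rw [List.flatMap_assoc]
    exact hC.forLoop _ hΓ1 _ rfl (by simp) hn (by decide) (by simp) rfl (Nat.succ_le_of_lt (by positivity))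
      fun a => exec_block hC hS hΓ hX σ a
  · simp
    nlinarith [Nat.zero_le ((n + 1) * ((n + 1) * ((d + 1) * (d + 1))))]

omit hX in
theorem exec_cross : Exec W Ro M cross
    (1000000000 * ((n + 1) * ((n + 1) * ((d + 1) * (d + 1)))))
    [n, d, q, B, blockSize n d] [n, d, q, B, blockSize n d]
    ((I.crossEdges q).flatMap words) := by
  have hn : n < X := hΓ _ (by simp)
  have hd : d < X := hΓ _ (by simp)
  rw [crossEdges, List.flatMap_assoc]
  refine Exec.mono (T := 15 * ((n + 1) * (15 * ((n + 1) * (15 * ((d + 1) * (15 * ((d + 1) * 400))))))))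
    (hC.forLoop _ hΓ _ rfl (by simp) hn (by decide) (by simp) rfl (Nat.succ_le_of_lt (by positivity)) fun a => ?_) ?_
  · have hΓ1 := forall_mem_snoc_lt hΓ (a.2.trans hn)
    rw [List.flatMap_assoc]
    refine hC.forLoop _ hΓ1 _ rfl (by simp) hn (by decide) (by simp) rfl (Nat.succ_le_of_lt (by positivity)) fun c => ?_
    have hΓ2 := forall_mem_snoc_lt hΓ1 (c.2.trans hn)
    rw [List.flatMap_assoc]
    refine hC.forLoop _ hΓ2 _ rfl (by simp) hd (by decide) (by simp) rfl (Nat.succ_le_of_lt (by positivity)) fun x => ?_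
    have hΓ3 := forall_mem_snoc_lt hΓ2 (x.2.trans hd)
    rw [List.flatMap_assoc]
    refine hC.forLoop _ hΓ3 _ rfl (by simp) hd (by decide) (by simp) rfl (Nat.succ_le_of_lt (by positivity)) fun y => ?_
    have hΓ4 := forall_mem_snoc_lt hΓ3 (y.2.trans hd)
    rw [apply_ite (List.flatMap words)]
    refine Exec.mono (hC.ifThen (T := 100) hΓ4 _ rfl (by decide) ?_ ?_
      (by simp) fun _ => Exec.mono (hC.emit3 hΓ4 _ _ _ rfl (by decide) (by simp [baseE, lE])
        ?_) (by decide)) (by decide)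
    · have h1 := hS.mem 0 a x
      have h2 := hS.mem 0 a y
      have h3 := hS.mem 2 c x
      have h4 := hS.mem 2 c y
      simp only [Fin.val_zero, Fin.val_two, zero_mul, zero_add] at h1 h2 h3 h4
      simpa [bitE, val] using ⟨⟨h1, h2⟩, h3, h4⟩
    · have h1 := hS.eq 0 a x
      have h2 := hS.eq 0 a y
      have h3 := hS.eq 2 c x
      have h4 := hS.eq 2 c y
      simp only [Fin.val_zero, Fin.val_two, zero_mul, zero_add] at h1 h2 h3 h4
      simp [bitE, val, h1, h2, h3, h4, LL]
    · exact ⟨rfl, rfl, rfl⟩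
  -- Four nested loops with factor 15 around a body of cost 400: `15 ^ 4 * 400`.
  · apply le_of_eq_of_le (b := 20250000 * ((n + 1) * ((n + 1) * ((d + 1) * (d + 1)))))
    · ring
    · gcongr; simp

omit hΓ in
theorem exec_body (hΓ : ∀ x ∈ [n, d, q, B], x < X) (hQ : blockSize n d < X) (h2 : 2 < X) :
    Exec W Ro M body (10 ^ 13 * ((n + 1) * ((n + 1) * ((d + 1) * (d + 1))) + (q + 1)))
      [n, d, q, B] [n, d, q, B] (count n d q :: 0 :: (I.edges q).flatMap words) := by
  have hΓ' := forall_mem_snoc_lt hΓ hQ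
  refine Exec.drop (Γ'' := [blockSize n d]) ?_
  have e1 : Exec W Ro M (emit 5 (.v 2 + 1 + 2 * .v 0 * .v 4)) 100 _ _ [count n d q] :=
    Exec.mono (hC.emit hΓ' _ rfl (by decide) (by simp) rfl) (by decide)
  have e2 : Exec W Ro M (emit 5 0) 100 _ _ [0] :=
    Exec.mono (hC.emit hΓ' _ rfl (by decide) (by simp) rfl) (by decide)
  simp only [edges, List.flatMap_append]
  refine Exec.mono (Exec.seq (out := []) (hC.push hΓ _ rfl (by decide) (by simp) rfl)
    (Exec.seq e1 (Exec.seq e2 (Exec.seq (exec_leaf hC hΓ')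
      (Exec.seq (exec_blocks hC hS hΓ' hX h2) (exec_cross hC hS hΓ')))))) ?_
  simp
  nlinarith [Nat.zero_le ((n + 1) * ((n + 1) * ((d + 1) * (d + 1)))),
    Nat.succ_le_of_lt (show 0 < (n + 1) * ((n + 1) * ((d + 1) * (d + 1))) by positivity)]

end
end OVInstance

/-! ### Setting the write pointer and filling in the edge count -/

namespace WordRAM

/-- Set the write pointer to the value of register `r`. -/
def setPtr (r : ℕ) : Prog := .instr (.op .or 0 r r)

theorem setPtr_runs {W : ℕ} (r : ℕ) (s : State) (h : s.reg r < W) :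
    ∃ s', Runs W (setPtr r) s 1 s' ∧ s'.reg 0 = s.reg r ∧ (∀ i, s'.reg (i + 1) = s.reg (i + 1)) ∧
      s'.mem = s.mem :=
  ⟨_, .instr _ s (by simpa [Instr.value, Op.eval] using h),
    by simp [Instr.exec, Instr.value, Op.eval], fun i => by simp [Instr.exec], rfl⟩

/-- Set the write pointer to zero. -/
def zeroPtr : Prog := .instr (.const 0 0)

theorem zeroPtr_runs {W : ℕ} (s : State) (h : 0 < W) :
    ∃ s', Runs W zeroPtr s 1 s' ∧ s'.reg 0 = 0 ∧ (∀ i, s'.reg (i + 1) = s.reg (i + 1)) ∧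
      s'.mem = s.mem :=
  ⟨_, .instr _ s h, by simp [Instr.exec, Instr.value], fun i => by simp [Instr.exec], rfl⟩

theorem writeList_apply_of_lt {m : ℕ → ℕ} {p i : ℕ} {l : List ℕ} (h : i < l.length) :
    writeList m p l (p + i) = l.getD i 0 := by
  simp [writeList, h]

theorem update_writeList_second (m : ℕ → ℕ) (a b c : ℕ) (l : List ℕ) :
    Function.update (writeList m 0 (a :: b :: l)) 1 c = writeList m 0 (a :: c :: l) := by
  funext i
  simp only [Function.update_apply, writeList]
  rcases i with - | - | i <;> simp

namespace GraphProg

/-- Replace the placeholder by the number of edges. -/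
def fixCount : Prog := .seq (.instr (.const 5 2)) (.seq (.instr (.op .sub 5 0 5))
  (.seq (.instr (.const 6 3)) (.seq (.instr (.op .div 5 5 6)) (.seq (.instr (.const 6 1))
    (.instr (.store 6 5))))))

/-- The number of edges is known only after they are written; the pointer then stands at `2 + 3 *
c`, from which it is recovered. Registers 5 and 6 lie above the four live variables. -/
theorem fixCount_runs {W c : ℕ} (s : State) (h : s.reg 0 = 2 + 3 * c) (h0 : s.reg 0 < W)
    (h3 : 3 < W) : ∃ s', Runs W fixCount s 6 s' ∧ (∀ i < 5, s'.reg i = s.reg i) ∧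
      s'.mem = Function.update s.mem 1 c := by
  refine ⟨_, .seq (.instr _ _ ?_) (.seq (.instr _ _ ?_) (.seq (.instr _ _ ?_) (.seq (.instr _ _ ?_)
    (.seq (.instr _ _ ?_) (.instr _ _ ?_))))), fun i hi => ?_, ?_⟩
  · simp only [Instr.value]; omega
  · simp [Instr.value, Instr.exec, Op.eval]; omega
  · simpa only [Instr.value] using h3
  · simp [Instr.value, Instr.exec, Op.eval, h]; omega
  · simp only [Instr.value]; omega
  · simp [Instr.value, Instr.exec, Op.eval, h]; omega
  · simp [Instr.exec, show i ≠ 5 by omega, show i ≠ 6 by omega]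
  · simp [Instr.value, Instr.exec, Op.eval, h]

/-- Write the graph of the instance at the beginning of the memory. -/
def prog : Prog := .seq zeroPtr (.seq body fixCount)

end GraphProg

/-- Addresses of a block of memory. -/
def block (B k : ℕ) : Set ℕ := {a | B ≤ a ∧ a < B + k}

@[simp] theorem mem_block {B k a : ℕ} : a ∈ block B k ↔ B ≤ a ∧ a < B + k := Iff.rfl

end WordRAM

/-! ### The instance as a table of bits in memory -/

namespace OVInstance
open OVVertex WordRAM
variable {n d : ℕ} (I : OVInstance 3 n d)

/-- All bits of the instance. -/
def bits : List ℕ := (List.finRange 3).flatMap fun j => (List.finRange n).flatMap fun i =>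
  (List.finRange d).map fun x => (I j i x).toNat

theorem encode_eq : I.encode = n :: d :: I.bits := rfl

theorem length_flatMap_finRange {β : Type*} {k c : ℕ} {f : Fin k → List β}
    (h : ∀ i, (f i).length = c) : ((List.finRange k).flatMap f).length = k * c := by
  simp [List.length_flatMap, h]

theorem getD_flatMap_finRange {k c r : ℕ} {f : Fin k → List ℕ} (h : ∀ i, (f i).length = c)
    (i : Fin k) (hr : r < c) :
    ((List.finRange k).flatMap f).getD (i * c + r) 0 = (f i).getD r 0 := by
  induction k with
  | zero => exact i.elim0
  | succ k ih =>
    rw [List.finRange_succ, List.flatMap_cons, List.flatMap_map]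
    refine Fin.cases ?_ (fun i => ?_) i
    · rw [List.getD_append _ _ _ _ (by simp [h, hr])]
      simp
    · rw [List.getD_append_right _ _ _ _ (by rw [h, Fin.val_succ, add_mul]; omega), h]
      have := ih (f := fun i => f i.succ) (fun i => h _) i
      rw [← this]
      congr 1
      rw [Fin.val_succ, add_mul]
      omega

theorem length_bits : I.bits.length = 3 * (n * d) :=
  length_flatMap_finRange fun _ => length_flatMap_finRange fun _ => by simp

theorem bit_lt (j : Fin 3) (i : Fin n) (x : Fin d) : (j * n + i) * d + x < 3 * (n * d) := by
  rw [← mul_assoc]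
  exact mul_add_lt (mul_add_lt j.2 i.2) x.2

theorem getD_bits (j : Fin 3) (i : Fin n) (x : Fin d) :
    I.bits.getD ((j * n + i) * d + x) 0 = (I j i x).toNat := by
  have h := getD_flatMap_finRange (f := fun j => (List.finRange n).flatMap fun i =>
    (List.finRange d).map fun x => (I j i x).toNat) (c := n * d) (r := i * d + x)
    (fun _ => length_flatMap_finRange fun _ => by simp) j (mul_add_lt i.2 x.2)
  rw [bits, add_mul, mul_assoc, add_assoc, h, getD_flatMap_finRange (fun _ => by simp) i x.2]
  simp

theorem le_one_of_mem_bits {x : ℕ} (hx : x ∈ I.bits) : x ≤ 1 := by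
  simp only [bits, List.mem_flatMap, List.mem_map] at hx
  obtain ⟨j, -, i, -, y, -, rfl⟩ := hx
  exact Bool.toNat_le _

theorem length_encodeGraph (q : ℕ) :
    (encodeGraph (count n d q) (I.edgeList q)).length = 2 + 3 * (I.edgeList q).length := by
  simp [encodeGraph, List.length_flatMap]
  ring

theorem stored_writeList (m : ℕ → ℕ) (B : ℕ) :
    I.Stored B (WordRAM.block B (3 * (n * d))) (writeList m B I.bits) where
  mem j i x := by
    have := bit_lt j i x
    simp only [mem_block]
    omega
  eq j i x := by
    rw [writeList_apply_of_lt (by rw [length_bits]; exact bit_lt j i x), getD_bits]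

/-- The bits at `B` stay readable while the graph is written from address 0, since by `hB` the
output ends before `B`. -/
theorem graphProg_runs {q W X B : ℕ} {m : ℕ → ℕ} (s : State) (hX : 3 < X) (hW : X ^ 40 ≤ W)
    (hΓ : ∀ x ∈ [n, d, q, B], x < X) (hQ : blockSize n d < X) (hc : count n d q < X)
    (hreg : ∀ i < 4, s.reg (i + 1) = val [n, d, q, B] i) (hm : s.mem = writeList m B I.bits)
    (hB : 2 + 3 * (I.edgeList q).length ≤ B) :
    ∃ t ≤ 10 ^ 13 * ((n + 1) * ((n + 1) * ((d + 1) * (d + 1))) + (q + 1)) + 7, ∃ s',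
      Runs W GraphProg.prog s t s' ∧ (∀ i < 4, s'.reg (i + 1) = val [n, d, q, B] i) ∧
      s'.mem = writeList s.mem 0 (encodeGraph (count n d q) (I.edgeList q)) := by
  have hXW : X ≤ W := by
    calc X = X ^ 1 := (pow_one X).symm
      _ ≤ X ^ 40 := Nat.pow_le_pow_right (by omega) (by norm_num)
      _ ≤ W := hW
  have hBX : B < X := hΓ _ (by simp)
  have hC : Ctx W X 40 (WordRAM.block B (3 * (n * d))) s.mem := by
    refine ⟨by omega, hW, fun a ha => ?_⟩
    obtain ⟨i, rfl⟩ := Nat.exists_eq_add_of_le ha.1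
    have hi : i < I.bits.length := by rw [length_bits]; have := ha.2; omega
    rw [hm, writeList_apply_of_lt hi, List.getD_eq_getElem _ _ hi]
    have := I.le_one_of_mem_bits (List.getElem_mem hi)
    omega
  have hlen := I.length_encodeGraph q
  rw [encodeGraph_edgeList] at hlen ⊢
  obtain ⟨s1, r1, p1, g1, m1⟩ := zeroPtr_runs (W := W) s (by omega)
  obtain ⟨t2, ht2, s2, r2, p2, g2, m2⟩ := exec_body hC (hm ▸ I.stored_writeList m B) hc hΓ hQ
    (by omega) s1 (fun i hi => by rw [g1, hreg i hi]) (fun a _ => by rw [m1])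
    (fun a ha h => by
      simp only [mem_block, List.length_cons] at ha h hlen
      omega)
    (by simp only [List.length_cons] at hlen ⊢; omega)
  have hp : s2.reg 0 = 2 + 3 * (I.edgeList q).length := by
    simp only [List.length_cons] at p2 hlen; omega
  obtain ⟨s3, r3, g3, m3⟩ := GraphProg.fixCount_runs (W := W) s2 hp (by omega) (by omega)
  refine ⟨_, ?_, s3, .seq r1 (.seq r2 r3), fun i hi => ?_, ?_⟩
  · omega
  · rw [g3 _ (by omega), g2 i hi]
  · rw [m3, m2, p1, m1, update_writeList_second]

end OVInstance

/-! ### The reduction of part (i): move the instance out of the way, then write the graph -/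

namespace WordRAM
namespace CopyProg
open Ex

/-- The first free address is above this bound. -/
def boundE (c : ℕ) : Ex := .c c * ((v 0 + 1) * ((v 0 + 1) * ((v 1 + 1) * (v 1 + 1))))

/-- Read `n` and `d`. -/
def params : Prog := .seq ((ld 0).comp 1) (.seq ((ld 1).comp 2) (.seq ((Ex.c 0).comp 3)
  ((boundE 100).comp 4)))

/-- Copy the bits of the instance. -/
def copy : Prog := forLoop 4 (3 * (v 0 * v 1)) (emit 5 (ld (2 + v 4)))

/-- The reduction from `3`-OV to the diameter. -/
def prog : Prog := .seq params (.seq (setPtr 4) (.seq copy GraphProg.prog))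

end CopyProg
end WordRAM

namespace OVInstance
open OVVertex WordRAM
variable {n d : ℕ} (I : OVInstance 3 n d)

/-- A bound for the space and the time. -/
abbrev size (n d : ℕ) : ℕ := (n + 1) * ((n + 1) * ((d + 1) * (d + 1)))

/-- Expanded into monomials, the bounds below become linear with nonnegative coefficients, within
reach of `omega`. -/
theorem size_expand (n d : ℕ) : size n d =
    n * n * (d * d) + 2 * (n * n * d) + n * n + 2 * (n * (d * d)) + 4 * (n * d) + 2 * n +
      d * d + 2 * d + 1 := by
  simp only [size]; ring

theorem two_add_length_le (q : ℕ) : 2 + 3 * (I.edgeList q).length ≤ 20 * size n d + 3 * q := by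
  have h := I.length_edgeList_le q
  have e : q + 2 * (n * (2 + n + d * d + n * (1 + d * d))) + n * (n * (d * d)) =
      q + 4 * n + 4 * (n * n) + 2 * (n * (d * d)) + 3 * (n * n * (d * d)) := by ring
  rw [e] at h
  rw [size_expand]
  omega

theorem three_mul_le_size (n d : ℕ) : 3 * (n * d) + 2 ≤ 2 * size n d := by
  rw [size_expand]; omega

theorem count_le (n d q : ℕ) : count n d q ≤ 4 * size n d + q := by
  have e : count n d q = q + 1 + 2 * (n * n) + 2 * (n * (d * d)) + 4 * n := by
    simp only [count, blockSize]; ring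
  rw [e, size_expand]; omega

theorem self_le_size (n d : ℕ) : n ≤ size n d ∧ d ≤ size n d ∧ blockSize n d ≤ 2 * size n d ∧
    1 ≤ size n d := by
  rw [size_expand]; simp only [blockSize]; omega

theorem size_lt (n d : ℕ) : 256 * size n d < (n + d + 2) ^ 13 := by
  have h2 : 2 ^ 9 ≤ (n + d + 2) ^ 9 := Nat.pow_le_pow_left (by omega) 9
  have h3 : size n d ≤ (n + d + 2) ^ 4 := by
    have e : (n + d + 2) ^ 4 = (n + d + 2) * ((n + d + 2) * ((n + d + 2) * (n + d + 2))) := by ring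
    rw [e]
    simp only [size]
    gcongr <;> omega
  have h4 : 1 ≤ size n d := (self_le_size n d).2.2.2
  calc 256 * size n d < 2 ^ 9 * size n d := by omega
    _ ≤ (n + d + 2) ^ 9 * (n + d + 2) ^ 4 := Nat.mul_le_mul h2 h3
    _ = _ := by rw [← pow_add]

theorem copyProg_runs : ∃ t ≤ 10 ^ 14 * size n d, ∃ s',
    HaltsOn ((n + d + 2) ^ 2600) CopyProg.prog I.encode t s' ∧
      s'.Outputs (encodeGraph (count n d 0) (I.edgeList 0)) := by
  obtain ⟨X, hXdef⟩ : ∃ X, X = (n + d + 2) ^ 13 := ⟨_, rfl⟩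
  have hXlt : 256 * size n d < X := hXdef ▸ size_lt n d
  obtain ⟨hn, hd, hQ, h1⟩ := self_le_size n d
  -- The exponent must cover the degree 113 of `boundE 100`, where the constant 100 alone counts
  -- 101. Together with `X` being a 13th power this gives 2600.
  obtain ⟨W, hW⟩ : ∃ W, W = X ^ 200 := ⟨_, rfl⟩
  have hWX : (n + d + 2) ^ 2600 = W := by rw [hW, hXdef, ← pow_mul]
  rw [hWX]
  -- This address is beyond the input, at most `2 * size n d` words, and beyond the output, at most
  -- `20 * size n d` words.
  obtain ⟨B, hB⟩ : ∃ B, B = 100 * size n d := ⟨_, rfl⟩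
  have hlen : I.encode.length ≤ B := by
    have := three_mul_le_size n d
    rw [encode_eq, List.length_cons, List.length_cons, length_bits]
    omega
  have hinput : ∀ x ∈ I.encode, x < X := by
    intro x hx
    rw [encode_eq, List.mem_cons, List.mem_cons] at hx
    rcases hx with rfl | rfl | hx
    · omega
    · omega
    · have := I.le_one_of_mem_bits hx; omega
  set s0 := initState I.encode with hs0
  have hmem : ∀ a, s0.mem a < X := fun a => val_lt (by omega) hinput a
  have hXW : X ≤ W := hW ▸ Nat.le_self_pow (by norm_num) X
  have hC : Ctx W X 200 {a | a < B} s0.mem := ⟨by omega, hW.ge, fun a _ => hmem a⟩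
  have hΓ : ∀ x ∈ [n, d, 0, B], x < X := by
    intro x hx; simp at hx; omega
  have hparams : Exec W {a | a < B} s0.mem CopyProg.params 100 [] [n, d, 0, B] [] := by
    refine Exec.mono (Exec.seq (out := []) (hC.push (w := n) (by simp) _ rfl (by decide) ?_ rfl) (Exec.seq
      (out := []) (out' := []) (hC.push (w := d) ?_ _ rfl (by decide) ?_ rfl)
      (Exec.seq (out := []) (out' := []) (hC.push (w := 0) ?_ _ rfl (by decide) trivial rfl)
      (hC.push (w := B) ?_ _ rfl (by decide) ?_ (by rw [hB]; rfl))))) (by decide)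
    · simp; omega
    · intro x hx; simp at hx; omega
    · simp; omega
    · intro x hx; simp at hx; omega
    · intro x hx; simp at hx; omega
    · simp [CopyProg.boundE]
  have hcopy : Exec W {a | a < B} s0.mem CopyProg.copy (23 * ((3 * (n * d) + 1) * 10))
      [n, d, 0, B] [n, d, 0, B] I.bits := by
    have : I.bits = (List.finRange (3 * (n * d))).flatMap
        fun i : Fin (3 * (n * d)) => [I.bits.getD i 0] := by
      rw [← List.map_eq_flatMap]
      apply List.ext_getElem
      · simp [length_bits]
      · intro i h1 h2
        simp [h1]
    rw [this]
    have h3 := three_mul_le_size n d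
    refine hC.forLoop (T := 10) _ hΓ _ rfl (by simp) (by omega) (by decide) (by simp)
      (by simp [val]) (by simp) fun i => ?_
    refine Exec.mono (hC.emit (forall_mem_snoc_lt hΓ (by omega)) _ rfl (by decide) ?_ ?_) (by decide)
    · simp [val]; omega
    · simp [val, hs0, initState, encode_eq, Nat.add_comm 2]
  obtain ⟨t1, ht1, s1, r1, p1, g1, m1⟩ := hparams s0 (by simp) (fun _ _ => rfl) (by simp)
    (by simp [hs0, initState]; omega)
  simp only [List.length_nil, add_zero, writeList_nil] at p1 m1
  have hB1 : s1.reg 4 = B := g1 3 (by simp)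
  obtain ⟨s2, r2, p2, g2, m2⟩ := setPtr_runs (W := W) 4 s1 (by omega)
  obtain ⟨t3, ht3, s3, r3, p3, g3, m3⟩ := hcopy s2 (fun i hi => by rw [g2, g1 i hi])
    (fun a _ => by rw [m2, m1]) (fun a ha h => by
      have : a < B := ha
      omega) (by have := three_mul_le_size n d; rw [length_bits]; omega)
  obtain ⟨t4, ht4, s4, r4, g4, m4⟩ := I.graphProg_runs (q := 0) (W := W) (X := X) (B := B)
    (m := s2.mem) s3 (by omega) (hW ▸ Nat.pow_le_pow_right (by omega) (by norm_num)) hΓ (by omega)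
    (by have := count_le n d 0; omega) g3 (by rw [m3, p2, hB1])
    (by have := I.two_add_length_le 0; omega)
  refine ⟨_, ?_, s4, ⟨fun x hx => (hinput x hx).trans_le hXW, .seq r1 (.seq r2 (.seq r3 r4))⟩, ?_⟩
  · have := three_mul_le_size n d
    simp only [size] at *
    omega
  · intro i hi
    have := writeList_apply_of_lt (m := s3.mem) (p := 0) hi
    rw [zero_add] at this
    rw [m4, this, List.getD_eq_getElem _ _ hi]

end OVInstance


/-! ### From satisfiability to orthogonal vectors -/

namespace CNF
variable {N : ℕ} (φ : CNF N)

/-- The number of variables in each of three blocks. -/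
abbrev blockVars (N : ℕ) : ℕ := (N + 2) / 3

/-- The partial assignment with the number `i` to the block `j` satisfies the literal. -/
def LitSat (j i : ℕ) (l : Fin N × Bool) : Prop :=
  (l.1 : ℕ) / blockVars N = j ∧ i.testBit (l.1 % blockVars N) = l.2

instance (j i : ℕ) (l : Fin N × Bool) : Decidable (LitSat j i l) :=
  inferInstanceAs (Decidable (_ ∧ _))

/-- The vectors are the partial assignments to the three blocks, the coordinates are the clauses,
and a coordinate is zero if the clause is satisfied. -/
def toOV : OVInstance 3 (2 ^ blockVars N) φ.length :=
  fun j i x => !decide (∃ l ∈ φ[x], LitSat j i l)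

/-- A product of bits vanishes exactly when some factor does, that is, when one of the three partial
assignments satisfies the clause. The blocks are disjoint and cover all variables, so triples of
partial assignments glue to total assignments. -/
theorem toOV_hasSolution_iff : φ.toOV.HasSolution ↔ φ.Satisfiable := by
  have h1 : φ.toOV.HasSolution ↔ ∃ f : Fin 3 → Fin (2 ^ blockVars N),
      ∀ cl ∈ φ, ∃ l ∈ cl, ∃ j : Fin 3, LitSat j (f j) l := by
    simp only [OVInstance.HasSolution, Finset.sum_eq_zero_iff, Finset.mem_univ, true_imp_iff,
      Finset.prod_eq_zero_iff, true_and, toOV, Bool.toNat_eq_zero, Bool.not_eq_false',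
      decide_eq_true_eq]
    refine exists_congr fun f => ⟨fun h cl hcl => ?_, fun h x => ?_⟩
    · obtain ⟨x, hx, rfl⟩ := List.mem_iff_getElem.1 hcl
      obtain ⟨j, l, hl, hs⟩ := h ⟨x, hx⟩
      exact ⟨l, hl, j, hs⟩
    · obtain ⟨l, hl, j, hs⟩ := h φ[x] (List.getElem_mem x.2)
      exact ⟨j, l, hl, hs⟩
  rw [h1]
  have hlt : ∀ v : Fin N, (v : ℕ) / blockVars N < 3 := fun v => by
    have := v.2
    have hk : blockVars N = (N + 2) / 3 := rfl
    rw [Nat.div_lt_iff_lt_mul (by omega)]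
    omega
  constructor
  · rintro ⟨f, hf⟩
    refine ⟨fun v => (f ⟨v / blockVars N, hlt v⟩ : ℕ).testBit (v % blockVars N),
      fun cl hcl => ?_⟩
    obtain ⟨l, hl, j, h1, h2⟩ := hf cl hcl
    refine ⟨l, hl, ?_⟩
    simp only
    rw [← h2, show (⟨l.1 / blockVars N, hlt l.1⟩ : Fin 3) = j from Fin.ext h1]
  · rintro ⟨σ, hσ⟩
    -- Three blocks may provide more than `N` positions; the surplus ones are set to `false`.
    let f : Fin 3 → Fin (2 ^ blockVars N) := fun j =>
      ⟨Nat.ofBits fun b : Fin (blockVars N) =>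
        if h : j * blockVars N + b < N then σ ⟨_, h⟩ else false, Nat.ofBits_lt_two_pow _⟩
    refine ⟨f, fun cl hcl => ?_⟩
    obtain ⟨l, hl, h⟩ := hσ cl hcl
    have hk : 0 < blockVars N := by have := l.1.2; simp only [blockVars]; omega
    refine ⟨l, hl, ⟨_, hlt l.1⟩, rfl, ?_⟩
    have hb : (l.1 : ℕ) % blockVars N < blockVars N := Nat.mod_lt _ hk
    have he : (l.1 : ℕ) / blockVars N * blockVars N + l.1 % blockVars N = l.1 := by
      rw [mul_comm, Nat.div_add_mod]
    simp only [f]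
    rw [Nat.testBit_ofBits_lt _ _ hb]
    simp [he, h]

/-- The words that encode a clause. -/
def clauseWords (cl : List (Fin N × Bool)) : List ℕ :=
  cl.length :: cl.map fun l => 2 * (l.1 : ℕ) + l.2.toNat

/-- The address of a clause. -/
def clauseAddr (x : ℕ) : ℕ := 2 + ((φ.take x).flatMap clauseWords).length

theorem encode_eq : φ.encode = N :: φ.length :: φ.flatMap clauseWords := rfl

theorem getD_encode (x : Fin φ.length) (r : ℕ) (hr : r < (φ[x]).length + 1) :
    φ.encode.getD (φ.clauseAddr x + r) 0 = (clauseWords φ[x]).getD r 0 := by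
  have h1 : φ.flatMap clauseWords = (φ.take x).flatMap clauseWords ++
      (clauseWords φ[x] ++ (φ.drop (x + 1)).flatMap clauseWords) := by
    have h : φ.take x ++ (φ[x] :: φ.drop (x + 1)) = φ := by
      rw [Fin.getElem_fin, ← List.drop_eq_getElem_cons x.2, List.take_append_drop]
    rw [← List.flatMap_cons, ← List.flatMap_append, h]
  rw [encode_eq, h1, clauseAddr, show ∀ a, 2 + a + r = a + r + 1 + 1 by intros; omega,
    List.getD_cons_succ, List.getD_cons_succ, List.getD_append_right _ _ _ _ (by omega),
    List.getD_append _ _ _ _ (by simp [clauseWords] at hr ⊢; omega)]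
  congr 1
  omega

theorem clauseAddr_succ (x : Fin φ.length) :
    φ.clauseAddr (x + 1) = φ.clauseAddr x + (φ[x]).length + 1 := by
  rw [clauseAddr, clauseAddr, List.take_add_one, List.getElem?_eq_getElem x.2]
  simp [clauseWords]
  omega

theorem clauseAddr_le {K : ℕ} (hK : ∀ cl ∈ φ, cl.length ≤ K) (x : ℕ) :
    φ.clauseAddr x ≤ 2 + (K + 1) * φ.length := by
  have : ∀ L : CNF N, (∀ cl ∈ L, cl.length ≤ K) →
      (L.flatMap clauseWords).length ≤ (K + 1) * L.length := by
    intro L hL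
    induction L with
    | nil => simp
    | cons a L ih =>
      have h1 := ih fun cl hcl => hL cl (by simp [hcl])
      have h2 := hL a (by simp)
      simp only [List.flatMap_cons, List.length_append, clauseWords, List.length_cons,
        List.length_map, mul_add] at h1 ⊢
      omega
  have h1 := this (φ.take x) fun cl hcl => hK cl (List.mem_of_mem_take hcl)
  have h2 : (K + 1) * (φ.take x).length ≤ (K + 1) * φ.length :=
    Nat.mul_le_mul_left _ (by simp)
  rw [clauseAddr]
  omega

theorem length_encode : φ.encode.length = φ.clauseAddr φ.length := by
  simp [encode_eq, clauseAddr]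
  omega

theorem lt_of_mem_encode {K x : ℕ} (hK : ∀ cl ∈ φ, cl.length ≤ K) (hx : x ∈ φ.encode) :
    x ≤ 2 * N + φ.length + K := by
  simp only [encode_eq, clauseWords, List.mem_cons, List.mem_flatMap, List.mem_map] at hx
  rcases hx with rfl | rfl | ⟨cl, hcl, rfl | ⟨l, -, rfl⟩⟩
  · omega
  · omega
  · have := hK cl hcl; omega
  · have := l.1.2
    have := Bool.toNat_le l.2
    omega

end CNF

/-! ### The program that turns a formula into vectors -/

namespace WordRAM

/-- Change the variable `i` to the value of `e`; `k` is the number of variables. -/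
def assign (k i : ℕ) (e : Ex) : Prog :=
  .seq (e.comp (k + 1)) (.instr (.op .or (i + 1) (k + 1) (k + 1)))

theorem Ctx.assign {W X D : ℕ} {Ro : Set ℕ} {M : ℕ → ℕ} (h : Ctx W X D Ro M) {k i w : ℕ}
    {Γ : List ℕ} (hΓ : ∀ x ∈ Γ, x < X) (e : Ex) (hk : Γ.length = k) (hi : i < k)
    (hf : e.fits D k = true) (hl : e.Loads Ro (val Γ) M) (hw : e.ev (val Γ) M = w) :
    Exec W Ro M (assign k i e) (e.cost + 1) Γ (Γ.set i w) [] := by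
  subst hk hw
  have hok := h.ok hΓ hf hl
  intro s h1 h2 h3 h4
  obtain ⟨s', r, e1, k1, m1⟩ := e.comp_runs (Γ.length + 1) s h1 h2 (Ex.varBound_le_of_fits hf)
    (by omega) hok
  refine ⟨_, le_rfl, _, .seq r (.instr _ _ ?_), ?_, fun j hj => ?_, ?_⟩
  · simpa [Instr.value, Op.eval, e1] using hok.ev_lt
  · simp [Instr.exec, k1 0 (by omega)]
  · rw [List.length_set] at hj
    by_cases hij : j = i
    · subst hij
      simp [Instr.exec, Instr.value, Op.eval, e1, val, hj]
    · simp [Instr.exec, hij, k1 (j + 1) (by omega), h1 j hj, val, Ne.symm hij]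
  · simp [Instr.exec, m1]

namespace SatProg
open Ex

/-- Whether the literal `l` of the current clause exists and is satisfied. The variables are
the number `0` of vectors, the number `1` of clauses, the number `2` of leaves, the address `3` of
the instance, the number `4` of variables in a block, the block `5`, the partial assignment `6` and
the address `7` of the clause. -/
def litE (l : ℕ) : Ex :=
  .o .lt (.c l) (ld (v 7)) * (.o .eq (ld (v 7 + .c (l + 1)) / 2 / v 4) (v 5) *
    .o .eq (.o .shr (v 6) (ld (v 7 + .c (l + 1)) / 2 % v 4) % 2) (ld (v 7 + .c (l + 1)) % 2))

/-- Whether none of the first `K` literals is satisfied. -/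
def clauseE : ℕ → Ex
  | 0 => 1
  | K + 1 => clauseE K * (1 - litE K)

def clauses (K : ℕ) : Prog := forLoop 8 (v 1)
  (.seq (emit 9 (clauseE K)) (assign 9 7 (v 7 + ld (v 7) + 1)))

/-- Write the bits of the instance. -/
def bits (K : ℕ) : Prog := forLoop 5 3 (forLoop 6 (v 0) (.seq ((Ex.c 2).comp 8) (clauses K)))

theorem litE_deg (l : ℕ) : (litE l).deg = max (l + 1) 1 + (max (max (max (max 1 (l + 2) + 1) 3) 1) 1
    + max (max (max 1 (max (max (max 1 (l + 2) + 1) 3) 1)) 3) (max (max 1 (l + 2) + 1) 3)) := rfl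

theorem litE_varBound (l : ℕ) : (litE l).varBound = 8 := rfl

theorem litE_std (l : ℕ) : (litE l).std = true := rfl

theorem litE_cost (l : ℕ) : (litE l).cost ≤ 60 := by simp [litE]

theorem clauseE_std (K : ℕ) : (clauseE K).std = true := by
  induction K with
  | zero => rfl
  | succ K ih =>
    have h : (clauseE (K + 1)).std = ((clauseE K).std && (1 - litE K).std) := rfl
    rw [h, ih]
    exact litE_std K

/-- The test of a clause is unrolled into a product of `K` factors, possible since `K` is fixed.
Each factor has degree linear in `K` because the offset of its literal is a constant, so the total
is quadratic. -/
theorem clauseE_deg_le (K : ℕ) : (clauseE K).deg ≤ 20 * (K + 1) * (K + 1) := by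
  induction K with
  | zero => decide
  | succ K ih =>
    have h : (clauseE (K + 1)).deg = (clauseE K).deg + max 2 (litE K).deg := rfl
    have h4 : (litE K).deg ≤ 3 * K + 12 := by rw [litE_deg]; omega
    have h5 : max 2 (litE K).deg ≤ 3 * K + 12 := by omega
    nlinarith

theorem clauseE_varBound_le (K : ℕ) : (clauseE K).varBound ≤ 8 := by
  induction K with
  | zero => decide
  | succ K ih =>
    have h : (clauseE (K + 1)).varBound = max (clauseE K).varBound (max 0 (litE K).varBound) := rfl
    rw [h, litE_varBound]
    omega

theorem clauseE_fits {D k K : ℕ} (hD : 20 * (K + 1) * (K + 1) ≤ D) (hk : 8 ≤ k) :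
    (clauseE K).fits D k = true := by
  have h1 := clauseE_deg_le K
  have h2 := clauseE_varBound_le K
  simp only [Ex.fits, clauseE_std, Bool.and_eq_true, decide_eq_true_eq, true_and]
  omega

theorem clauseE_cost_le (K : ℕ) : (clauseE K).cost ≤ 1 + 100 * K := by
  induction K with
  | zero => decide
  | succ K ih =>
    have := litE_cost K
    show (clauseE K).cost + ((1 + ((litE K).cost + 1)) + 1) ≤ _
    omega

end SatProg
end WordRAM

namespace WordRAM
namespace SatProg
open Ex CNF

/-- The literal `l` of the current clause exists and is satisfied. -/
def LitHolds (ρ M : ℕ → ℕ) (l : ℕ) : Prop :=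
  l < M (ρ 7) ∧ M (ρ 7 + (l + 1)) / 2 / ρ 4 = ρ 5 ∧
    (ρ 6 >>> (M (ρ 7 + (l + 1)) / 2 % ρ 4)) % 2 = M (ρ 7 + (l + 1)) % 2

instance (ρ M : ℕ → ℕ) (l : ℕ) : Decidable (LitHolds ρ M l) :=
  inferInstanceAs (Decidable (_ ∧ _))

theorem ev_litE (ρ M : ℕ → ℕ) (l : ℕ) : (litE l).ev ρ M = if LitHolds ρ M l then 1 else 0 := by
  simp only [litE, LitHolds, ev_mul, ev_o, ev_c, ev_ld, ev_v, ev_div, ev_mod, ev_add, ev_ofNat,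
    Op.eval]
  by_cases h1 : l < M (ρ 7)
  · by_cases h2 : M (ρ 7 + (l + 1)) / 2 / ρ 4 = ρ 5
    · by_cases h3 : (ρ 6 >>> (M (ρ 7 + (l + 1)) / 2 % ρ 4)) % 2 = M (ρ 7 + (l + 1)) % 2 <;>
        simp [h1, h2, h3]
    · simp [h2]
  · simp [h1]

theorem ev_clauseE (ρ M : ℕ → ℕ) (K : ℕ) :
    (clauseE K).ev ρ M = if ∃ l < K, LitHolds ρ M l then 0 else 1 := by
  induction K with
  | zero => simp [clauseE]
  | succ K ih =>
    simp only [clauseE, ev_mul, ev_sub, ev_ofNat, ih, ev_litE, Nat.lt_succ_iff_lt_or_eq,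
      or_and_right, exists_or, exists_eq_left]
    by_cases h1 : ∃ l < K, LitHolds ρ M l
    · simp [h1]
    · by_cases h2 : LitHolds ρ M K <;> simp [h1, h2]

/-- There is no short-circuit: words past the end of a short clause are loaded too and must be
readable. The comparison with the clause length multiplies their contribution by zero. -/
theorem loads_clauseE {Ro : Set ℕ} {ρ M : ℕ → ℕ} {K : ℕ} (h : ∀ l ≤ K, ρ 7 + l ∈ Ro) :
    (clauseE K).Loads Ro ρ M := by
  induction K with
  | zero => trivial
  | succ K ih =>
    have h0 : ρ 7 ∈ Ro := h 0 (by omega)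
    simp only [clauseE, litE, loads_mul, loads_sub, loads_o, loads_ofNat, loads_c, loads_v,
      loads_ld, loads_div, loads_mod, loads_add, ev_v, ev_add, ev_c, true_and, and_true]
    exact ⟨ih fun l hl => h l (by omega), by simp [h0, h (K + 1) le_rfl]⟩

variable {N K : ℕ} {φ : CNF N} (hK : ∀ cl ∈ φ, cl.length ≤ K)
include hK

/-- Halving a literal word gives the variable and its parity gives the sign; quotient and remainder
by `blockVars N` give the block and the bit of the partial assignment. -/
theorem ev_clauseE_eq {ρ : ℕ → ℕ} {M : ℕ → ℕ} (hM : ∀ a, M a = φ.encode.getD a 0)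
    (h4 : ρ 4 = blockVars N) (j : Fin 3) (h5 : ρ 5 = j) (i : Fin (2 ^ blockVars N)) (h6 : ρ 6 = i)
    (x : Fin φ.length) (h7 : ρ 7 = φ.clauseAddr x) :
    (clauseE K).ev ρ M = (φ.toOV j i x).toNat := by
  have hlen : M (φ.clauseAddr x) = (φ[x]).length := by
    rw [hM, ← add_zero (φ.clauseAddr x), φ.getD_encode x 0 (by omega)]
    rfl
  have hlit : ∀ l (hl : l < (φ[x]).length), M (φ.clauseAddr x + (l + 1)) =
      2 * ((φ[x])[l].1 : ℕ) + (φ[x])[l].2.toNat := by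
    intro l hl
    rw [hM, φ.getD_encode x (l + 1) (by omega), clauseWords, List.getD_cons_succ,
      List.getD_eq_getElem _ _ (by simpa using hl)]
    simp
  have key : (∃ l < K, LitHolds ρ M l) ↔ ∃ l ∈ φ[x], LitSat j i l := by
    have h1 : ∀ l (hl : l < (φ[x]).length), LitHolds ρ M l ↔ LitSat j i (φ[x])[l] := by
      intro l hl
      have e1 : ∀ v b : ℕ, b ≤ 1 → (2 * v + b) / 2 = v ∧ (2 * v + b) % 2 = b := by omega
      obtain ⟨e2, e3⟩ := e1 (φ[x])[l].1 _ (Bool.toNat_le (φ[x])[l].2)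
      rw [LitHolds, h7, h4, h5, h6, hlen, hlit l hl, e2, e3, LitSat, Nat.shiftRight_eq_div_pow,
        ← Nat.toNat_testBit]
      simp only [hl, true_and]
      refine and_congr_right fun _ => ?_
      generalize (i : ℕ).testBit _ = b
      generalize (φ[x])[l].2 = b'
      cases b <;> cases b' <;> simp
    constructor
    · rintro ⟨l, -, hl⟩
      have hl' : l < (φ[x]).length := by rw [← hlen, ← h7]; exact hl.1
      exact ⟨_, List.getElem_mem hl', (h1 l hl').1 hl⟩
    · rintro ⟨c, hc, hs⟩
      obtain ⟨l, hl, rfl⟩ := List.mem_iff_getElem.1 hc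
      exact ⟨l, hl.trans_le (hK _ (List.getElem_mem x.2)), (h1 l hl).2 hs⟩
  rw [ev_clauseE, toOV]
  by_cases h : ∃ l ∈ φ[x], LitSat j i l
  · rw [if_pos (key.2 h), decide_eq_true h]; rfl
  · rw [if_neg (mt key.1 h), decide_eq_false h]; rfl

theorem exec_bits {W X D q B : ℕ} {M : ℕ → ℕ} (hC : Ctx W X D {a | a < B} M)
    (hD : 20 * (K + 1) * (K + 1) + 60 ≤ D)
    (hM : ∀ a, M a = φ.encode.getD a 0)
    (hB : (K + 1) * φ.length + K + 3 ≤ B) (h3 : 3 < X)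
    (hΓ : ∀ x ∈ [2 ^ blockVars N, φ.length, q, B, blockVars N], x < X) :
    Exec W {a | a < B} M (bits K) (15 * (4 * (15 * ((2 ^ blockVars N + 1) *
        (15 * ((φ.length + 1) * (20 + 100 * K)) + 1)))))
      [2 ^ blockVars N, φ.length, q, B, blockVars N]
      [2 ^ blockVars N, φ.length, q, B, blockVars N] φ.toOV.bits := by
  have hn : 2 ^ blockVars N < X := hΓ _ (by simp)
  have hd : φ.length < X := hΓ _ (by simp)
  have hBX : B < X := hΓ _ (by simp)
  have hC' : Ctx W X 60 {a | a < B} M := hC.mono (by omega)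
  refine hC'.forLoop _ hΓ _ rfl (by simp) h3 (by decide) (by simp) rfl
    (Nat.succ_le_of_lt (by positivity)) fun j => ?_
  have hΓ1 := forall_mem_snoc_lt hΓ (j.2.trans h3)
  refine hC'.forLoop _ hΓ1 _ rfl (by simp) hn (by decide) (by simp) rfl
    (Nat.succ_le_of_lt (by positivity)) fun i => ?_
  have hΓ2 := forall_mem_snoc_lt hΓ1 (i.2.trans hn)
  have haddr : ∀ x, φ.clauseAddr x + K < B := fun x => by
    have := φ.clauseAddr_le hK x
    omega
  have hΓ3 : ∀ x, ∀ y ∈ [2 ^ blockVars N, φ.length, q, B, blockVars N, (j : ℕ), (i : ℕ),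
      φ.clauseAddr x], y < X := fun x =>
    forall_mem_snoc_lt hΓ2 (by have := haddr x; omega)
  refine Exec.drop (Γ'' := [φ.clauseAddr φ.length]) ?_
  rw [← List.nil_append (List.map _ _), List.map_eq_flatMap, add_comm]
  refine Exec.seq (hC'.push (w := 2) hΓ2 _ rfl (by decide) trivial rfl) ?_
  -- Clauses have different lengths, so the address of the current clause is carried through the
  -- loop as a variable.
  refine hC'.forLoop' (fun x => [2 ^ blockVars N, φ.length, q, B, blockVars N, j, i,
      φ.clauseAddr x]) _ _ (fun _ => rfl) (by simp) (fun x _ => hΓ3 x) hd (by decide)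
    (fun _ _ => by simp) (fun _ _ => rfl) (Nat.succ_le_of_lt (by positivity)) fun x => ?_
  have hΓ4 := forall_mem_snoc_lt (hΓ3 x) (x.2.trans hd)
  have hcost := clauseE_cost_le K
  refine Exec.mono (Exec.seq (out' := []) (hC.emit hΓ4 _ rfl (clauseE_fits (by omega) (by simp)) ?_ ?_)
    (hC'.assign (w := φ.clauseAddr (x + 1)) hΓ4 _ rfl (by simp) (by decide) ?_ ?_)) ?_
  · refine loads_clauseE fun l hl => ?_
    have := haddr x
    simp [val]
    omega
  · exact ev_clauseE_eq hK hM rfl j rfl i rfl x rfl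
  · have := haddr x
    simp [val]
    omega
  · have := φ.getD_encode x 0 (by omega)
    simp only [add_zero] at this
    simp only [ev_add, ev_ld, ev_v, ev_ofNat]
    rw [φ.clauseAddr_succ]
    simp only [val, List.cons_append, List.nil_append, List.getD_cons_succ, List.getD_cons_zero]
    rw [hM, this]
    rfl
  · simp; omega

end SatProg
end WordRAM

/-! ### The complete reduction from a formula to an initial state that encodes a graph -/

namespace WordRAM

theorem writeList_comm (m : ℕ → ℕ) {p p' : ℕ} {l l' : List ℕ} (h : p + l.length ≤ p') :
    writeList (writeList m p' l') p l = writeList (writeList m p l) p' l' := by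
  funext a
  simp only [writeList]
  split_ifs <;> first | rfl | omega

namespace SatProg
open Ex CNF OVVertex OVInstance

/-- Write zeros; there are four variables. -/
def zeros (e : Ex) : Prog := forLoop 4 e (emit 5 0)

theorem exec_zeros {W X c : ℕ} {M : ℕ → ℕ} {Γ : List ℕ} (hC : Ctx W X 60 ∅ M)
    (hΓ : ∀ x ∈ Γ, x < X) (e : Ex) (hk : Γ.length = 4) (hf : e.fits 60 4 = true)
    (hl : e.Loads ∅ (val Γ) M) (hc : e.ev (val Γ) M = c) (hcX : c < X) :
    Exec W ∅ M (zeros e) ((2 * e.cost + 13) * ((c + 1) * 4)) Γ Γ (List.replicate c 0) := by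
  have h : List.replicate c 0 = (List.finRange c).flatMap fun _ : Fin c => [0] := by
    rw [← List.map_eq_flatMap, List.map_const', List.length_finRange]
  rw [h]
  refine hC.forLoop _ hΓ _ hk (by simp) hcX hf hl hc (by simp) fun i => ?_
  exact hC.emit (forall_mem_snoc_lt hΓ (i.2.trans hcX)) _ (by simp [hk]) (by decide) trivial rfl

/-- Compute the parameters. -/
def params (K : ℕ) : Prog := .seq ((Ex.o .shl 1 ((ld 0 + 2) / 3)).comp 1) (.seq ((ld 1).comp 2)
  (.seq ((v 0 * v 0 * (v 1 * v 1)).comp 3) (.seq ((CopyProg.boundE (K + 100)).comp 4)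
    (((ld 0 + 2) / 3).comp 5))))

/-- Replace a formula by the graph of the corresponding `3`-OV instance. -/
def graphProg (K : ℕ) : Prog := .seq (params K) (.seq (setPtr 4) (.seq (bits K) (.seq zeroPtr
  (.seq (zeros (v 3)) (.seq GraphProg.prog (.seq (setPtr 4) (zeros (3 * (v 0 * v 1)))))))))

/-- Replace a formula by the graph of the corresponding `3`-OV instance, and set all registers to
zero. -/
def reduction (K : ℕ) : Prog := .seq (graphProg K) (clearRegs (graphProg K).regBound)

/-- The diameter algorithm is only specified on initial states, so no trace of earlier work may
remain. The bits go to `B`, the input below `B` is erased, the graph is written from 0 on, and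
finally the bits are erased. -/
theorem graphProg_runs {n d q B k W X T T' : ℕ} {P Q : Prog} {m : ℕ → ℕ} (I : OVInstance 3 n d)
    (hX : 3 < X) (hW : X ^ 60 ≤ W) (hΓ : ∀ x ∈ [n, d, q, B], x < X) (hQ : blockSize n d < X)
    (hc : count n d q < X) (hBW : 2 * B < W) (hI : 3 * (n * d) ≤ B)
    (hB : 2 + 3 * (I.edgeList q).length ≤ B) (hm : ∀ a, B ≤ a → m a = 0)
    (hP : Exec W {a | a < B} m P T [] [n, d, q, B, k] [])
    (hQ' : Exec W {a | a < B} m Q T' [n, d, q, B, k] [n, d, q, B, k] I.bits)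
    (s : State) (hs : s.mem = m) (hs0 : s.reg 0 = 0) :
    ∃ t ≤ T + T' + 60 * (B + 1) + (10 ^ 13 * (size n d + (q + 1)) + 7) + 92 * (3 * (n * d) + 1) + 3,
    ∃ s', Runs W (.seq P (.seq (setPtr 4) (.seq Q (.seq zeroPtr (.seq (zeros (v 3))
      (.seq GraphProg.prog (.seq (setPtr 4) (zeros (3 * (v 0 * v 1)))))))))) s t s' ∧
      s'.mem = (initState (encodeGraph (count n d q) (I.edgeList q))).mem := by
  have hXW : X ≤ W := (Nat.le_self_pow (by norm_num) X).trans hW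
  have hBX : B < X := hΓ _ (by simp)
  have henc := I.length_encodeGraph q
  have hlen := I.length_bits
  have hC : ∀ M, Ctx W X 60 ∅ M := fun M => ⟨by omega, hW, by simp⟩
  have hz1 : ∀ M, _ := fun M => exec_zeros (c := B) (hC M) hΓ (v 3) rfl (by decide) (by simp) rfl
    (by omega)
  have hz2 : ∀ M, _ := fun M => exec_zeros (c := 3 * (n * d)) (hC M) hΓ (3 * (v 0 * v 1)) rfl
    (by decide) (by simp) rfl (by omega)
  obtain ⟨t1, ht1, s1, r1, p1, g1, m1⟩ := hP s (by simp) (fun _ _ => by rw [hs]) (by simp)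
    (by simp only [List.length_nil]; omega)
  simp only [List.length_nil, add_zero, writeList_nil] at p1 m1
  have hB1 : s1.reg 4 = B := g1 3 (by simp)
  obtain ⟨s2, r2, p2, g2, m2⟩ := setPtr_runs (W := W) 4 s1 (by omega)
  obtain ⟨t3, ht3, s3, r3, p3, g3, m3⟩ := hQ' s2 (fun i hi => by rw [g2, g1 i hi])
    (fun a _ => by rw [m2, m1, hs]) (fun a ha h => by
      have : a < B := ha
      omega) (by omega)
  obtain ⟨s4, r4, p4, g4, m4⟩ := zeroPtr_runs (W := W) s3 (by omega)
  obtain ⟨t5, ht5, s5, r5, p5, g5, m5⟩ := hz1 s4.mem s4 (fun i hi => by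
    rw [g4, g3 i (by simp at hi ⊢; omega)]
    exact val_append_left [k] hi) (by simp) (by simp) (by simp; omega)
  obtain ⟨t6, ht6, s6, r6, g6, m6⟩ := I.graphProg_runs (W := W) (X := X) (B := B)
    (m := writeList m 0 (List.replicate B 0)) s5 hX
    ((Nat.pow_le_pow_right (by omega) (by norm_num)).trans hW) hΓ hQ hc g5 (by
      rw [m5, p4, m4, m3, p2, hB1, m2, m1, hs]
      -- The bits were written before the zeros; as the ranges are disjoint, the writes may be
      -- exchanged into the form required.
      exact writeList_comm _ (by simp)) hB
  have hB6 : s6.reg 4 = B := g6 3 (by simp)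
  obtain ⟨s7, r7, p7, g7, m7⟩ := setPtr_runs (W := W) 4 s6 (by omega)
  obtain ⟨t8, ht8, s8, r8, p8, g8, m8⟩ := hz2 s7.mem s7 (fun i hi => by rw [g7, g6 i hi]) (by simp)
    (by simp) (by simp; omega)
  refine ⟨_, ?_, s8, .seq r1 (.seq r2 (.seq r3 (.seq r4 (.seq r5 (.seq r6 (.seq r7 r8)))))), ?_⟩
  · simp at ht5 ht8
    simp only [size] at *
    omega
  · funext a
    rw [m8, p7, hB6, m7, m6, m5, p4, m4, m3, p2, hB1, m2, m1, hs]
    simp only [writeList, List.length_replicate, henc, hlen, initState]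
    have h0 : ∀ r c, (List.replicate r 0 : List ℕ).getD c 0 = 0 := by
      intro r c
      rw [List.getD_eq_getElem?_getD, List.getElem?_replicate]
      split_ifs <;> rfl
    have h1 : ¬ (a < 2 + 3 * (I.edgeList q).length) →
        (encodeGraph (count n d q) (I.edgeList q)).getD a 0 = 0 := fun h =>
      List.getD_eq_default _ _ (by omega)
    simp only [h0, zero_le, true_and, zero_add, Nat.sub_zero]
    split_ifs with h2 h3 h4
    · rw [h1 (by omega)]
    · rfl
    · rw [h1 h3]
    · rw [h1 h3, hm a (by omega)]

/-- The number of leaves of the graph. -/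
abbrev leaves (n d : ℕ) : ℕ := n * n * (d * d)

theorem leaves_le_size (n d : ℕ) : leaves n d ≤ size n d := by
  rw [size_expand]; simp only [leaves]; omega

theorem boundE_fits (K : ℕ) {D : ℕ} (hD : K + 200 ≤ D) :
    (CopyProg.boundE (K + 100)).fits D 3 = true := by
  have h1 : (CopyProg.boundE (K + 100)).deg = (K + 100 + 1) + 12 := rfl
  have h2 : (CopyProg.boundE (K + 100)).std = true := rfl
  have h3 : (CopyProg.boundE (K + 100)).varBound = 2 := rfl
  simp only [Ex.fits, h1, h2, h3, Bool.and_eq_true, decide_eq_true_eq, true_and]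
  omega

/-- The word size that the reduction needs is this power of the size of the formula. -/
abbrev wordDeg (K : ℕ) : ℕ := 20 * (K + 1) * (K + 1) + K + 200

theorem exec_params {W X D N n d q B K : ℕ} {m : ℕ → ℕ} (hC : Ctx W X D {a | a < B} m)
    (hD : K + 200 ≤ D) (hB2 : 2 ≤ B) (h0 : m 0 = N) (h1 : m 1 = d)
    (hn : n = 2 ^ blockVars N) (hq : q = leaves n d) (hB : B = (K + 100) * size n d)
    (hN : N < X) (hΓ : ∀ x ∈ [n, d, q, B], x < X) :
    Exec W {a | a < B} m (params K) (K + 200) [] [n, d, q, B, blockVars N] [] := by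
  have hC' : Ctx W X 60 {a | a < B} m := hC.mono (by omega)
  have hW : X ≤ W := (Nat.le_self_pow (by norm_num) X).trans hC'.pow_le
  have hnX : n < X := hΓ _ (by simp)
  have hdX : d < X := hΓ _ (by simp)
  have hqX : q < X := hΓ _ (by simp)
  have hBX : B < X := hΓ _ (by simp)
  have hbv : blockVars N < X := by simp only [blockVars]; omega
  have e : Op.shl.eval 1 ((m 0 + 2) / 3) = n := by
    rw [h0, hn]; exact Nat.one_shiftLeft _
  -- A shift is not polynomially bounded and fails `fits`; its value is `n`, which is known to be
  -- small, so overflow is excluded by hand.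
  have p1 : Exec W {a | a < B} m ((Ex.o .shl 1 ((ld 0 + 2) / 3)).comp 1) 8 [] [n] [] := by
    have := Exec.push (W := W) (Ro := {a | a < B}) (M := m) (Γ := []) (Ex.o .shl 1 ((ld 0 + 2) / 3))
      (by decide) ?_
    · simp only [List.nil_append, ev_o, ev_ofNat, ev_div, ev_add, ev_ld, e] at this
      exact this
    · have h2 : (ld 0 + 2 : Ex).Ok W {a | a < B} (val []) m :=
        hC'.ok (Γ := []) (by simp) (by decide) (by simp; omega)
      have h4 : ((ld 0 + 2) / 3 : Ex).Ok W {a | a < B} (val []) m :=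
        hC'.ok (Γ := []) (by simp) (by decide) (by simp; omega)
      refine ⟨show 1 < W by omega, h4, ?_⟩
      have : Op.shl.eval 1 ((m 0 + 2) / 3) < W := by omega
      exact this
  have p2 : Exec W {a | a < B} m ((ld 1).comp 2) 2 [n] [n, d] [] :=
    hC'.push (k := 1) (by simpa using hnX) _ rfl (by decide) (by simp; omega) (by simpa using h1)
  have p3 : Exec W {a | a < B} m ((v 0 * v 0 * (v 1 * v 1)).comp 3) 7 [n, d] [n, d, q] [] :=
    hC'.push (k := 2) (by simp [hnX, hdX]) _ rfl (by decide) (by simp) (by rw [hq]; rfl)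
  have p4 : Exec W {a | a < B} m ((CopyProg.boundE (K + 100)).comp 4) 17 [n, d, q] [n, d, q, B]
      [] :=
    hC.push (k := 3) (by simp [hnX, hdX, hqX]) _ rfl (boundE_fits K hD)
      (by simp [CopyProg.boundE]) (by rw [hB]; rfl)
  have p5 : Exec W {a | a < B} m (((ld 0 + 2) / 3).comp 5) 6 [n, d, q, B]
      [n, d, q, B, blockVars N] [] :=
    hC'.push (k := 4) hΓ _ rfl (by decide) (by simp; omega) (by simp [h0])
  exact (p1.seq (p2.seq (p3.seq (p4.seq p5)))).mono (by omega)

variable {N K : ℕ} (φ : CNF N) (hK : ∀ cl ∈ φ, cl.length ≤ K)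

/-- With `Y = 2 ^ N * (φ.length + 2)`, the size is at most `Y ^ 4` and the constant is below `2 ^ (K
+ 400) ≤ Y ^ (K + 400)`. Words of `O(N + log M)` bits therefore suffice for fixed `K`. -/
theorem size_lt_pow (K : ℕ) : (K + 400) * size (2 ^ blockVars N) φ.length <
    (2 ^ N * (φ.length + 2)) ^ (K + 404) := by
  obtain ⟨Y, hY⟩ : ∃ Y, Y = 2 ^ N * (φ.length + 2) := ⟨_, rfl⟩
  have h0 : 1 ≤ 2 ^ N := Nat.one_le_two_pow
  have h1 : 2 ^ blockVars N ≤ 2 ^ N := Nat.pow_le_pow_right (by norm_num) (by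
    simp only [blockVars]; omega)
  have h2 : 2 ^ blockVars N + 1 ≤ Y := by rw [hY]; nlinarith
  have h3 : φ.length + 1 ≤ Y := by rw [hY]; nlinarith
  have h4 : size (2 ^ blockVars N) φ.length ≤ Y ^ 4 := by
    have e : Y ^ 4 = Y * (Y * (Y * Y)) := by ring
    rw [e]
    simp only [size]
    gcongr
  have h5 : 2 ≤ Y := by have : 1 ≤ 2 ^ blockVars N := Nat.one_le_two_pow; omega
  have h6 : K + 400 < Y ^ (K + 400) :=
    Nat.lt_two_pow_self.trans_le (Nat.pow_le_pow_left h5 _)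
  have h7 : 0 < size (2 ^ blockVars N) φ.length := (self_le_size _ _).2.2.2
  rw [← hY]
  calc (K + 400) * size (2 ^ blockVars N) φ.length
      < Y ^ (K + 400) * size (2 ^ blockVars N) φ.length := Nat.mul_lt_mul_of_pos_right h6 h7
    _ ≤ Y ^ (K + 400) * Y ^ 4 := Nat.mul_le_mul_left _ h4
    _ = _ := by rw [← pow_add]

theorem two_mul_add_le_size :
    2 * N + φ.length + K < (K + 400) * size (2 ^ blockVars N) φ.length := by
  have h1 : N ≤ 3 * blockVars N := by simp only [blockVars]; omega
  have h2 : blockVars N < 2 ^ blockVars N := Nat.lt_two_pow_self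
  obtain ⟨h3, h4, -, h5⟩ := self_le_size (2 ^ blockVars N) φ.length
  nlinarith


theorem add_one_le_size (n d : ℕ) : d + 1 ≤ size n d := by
  rw [size_expand]; omega

theorem add_one_mul_le_size (n d : ℕ) : (n + 1) * (d + 1) ≤ size n d := by
  have e : (n + 1) * (d + 1) = n * d + n + d + 1 := by ring
  rw [size_expand, e]; omega

/-- Of the input only its first two words, crude bounds and the run of `bits` matter, so `n`, `d`,
`q`, `B` stay opaque and the estimates remain linear. -/
theorem reduction_runs_of_exec_bits {N K n d q B D X W : ℕ} (I : OVInstance 3 n d) (l : List ℕ)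
    (hn : n = 2 ^ blockVars N) (hq : q = leaves n d) (hB : B = (K + 100) * size n d)
    (h0 : l.getD 0 0 = N) (h1 : l.getD 1 0 = d) (hl : l.length ≤ B) (hlX : ∀ x ∈ l, x < X)
    (hD : K + 200 ≤ D) (hW : X ^ D ≤ W) (hX : (K + 400) * size n d < X) (hN : N < X)
    (hbits : (∀ x ∈ [n, d, q, B, blockVars N], x < X) →
      Exec W {a | a < B} (initState l).mem (bits K) (15 * (4 * (15 * ((n + 1) * (15 * ((d + 1) *
        (20 + 100 * K)) + 1))))) [n, d, q, B, blockVars N] [n, d, q, B, blockVars N] I.bits) :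
    ∃ t ≤ (10 ^ 14 + 10 ^ 7 * (K + 100) + (reduction K).regBound) * size n d,
      HaltsOn W (reduction K) l t (initState (encodeGraph (count n d q) (I.edgeList q))) := by
  obtain ⟨hn1, hd1, hQ, hS⟩ := self_le_size n d
  have hq1 := leaves_le_size n d
  have h3 := three_mul_le_size n d
  have hc := count_le n d q
  have hlen := I.two_add_length_le q
  have hnd := add_one_mul_le_size n d
  have hbv : blockVars N < n := hn ▸ Nat.lt_two_pow_self
  have hW60 : X ^ 60 ≤ W := (Nat.pow_le_pow_right (by omega) (by omega)).trans hW
  have hXW : X ≤ W := (Nat.le_self_pow (by norm_num) X).trans hW60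
  have hXX : X * X ≤ W := by
    rw [← pow_two]; exact (Nat.pow_le_pow_right (by omega) (by norm_num)).trans hW60
  have hKX : 400 * size n d + K * size n d < X := by rw [← add_mul, add_comm]; exact hX
  have hBK : B = K * size n d + 100 * size n d := by rw [hB, add_mul]
  have hBW : 2 * B < W := by
    have : 2 * X ≤ X * X := Nat.mul_le_mul_right X (by omega)
    omega
  have hC : Ctx W X D {a | a < B} (initState l).mem :=
    ⟨by omega, hW, fun a _ => val_lt (by omega) hlX a⟩
  have hΓ : ∀ x ∈ [n, d, q, B, blockVars N], x < X := by
    intro x hx; simp at hx; omega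
  have hΓ' : ∀ x ∈ [n, d, q, B], x < X := fun x hx => hΓ x (by simp at hx ⊢; omega)
  obtain ⟨t, ht, s, r, hm⟩ := graphProg_runs I (by omega) hW60 hΓ' (by omega) (by omega)
    hBW (by omega) (by omega) (fun a ha => List.getD_eq_default _ _ (by omega))
    (exec_params hC hD (by omega) h0 h1 hn hq hB hN hΓ') (hbits hΓ) (initState l) rfl rfl
  obtain ⟨s', r', z1, z2, m'⟩ := clearRegs_runs (show 0 < W by omega) (graphProg K).regBound s
  -- Registers below the bound have just been cleared, and those above it were never written.
  have hs' : s' = initState (encodeGraph (count n d q) (I.edgeList q)) := by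
    obtain ⟨reg, mem⟩ := s'
    simp only at z1 z2 m'
    rw [m', hm, show reg = fun _ => 0 from funext fun i => ?_]
    · rfl
    by_cases hi : i < (graphProg K).regBound
    · exact z1 i hi
    · exact (z2 i (by omega)).trans (r.reg_eq (by exact Nat.le_of_not_lt hi))
  rw [← hs']
  refine ⟨_, ?_, fun x hx => (hlX x hx).trans_le hXW, Runs.seq r r'⟩
  · have hR : (graphProg K).regBound ≤ (reduction K).regBound := le_max_left _ _
    have e1 : (n + 1) * (15 * ((d + 1) * (20 + 100 * K)) + 1) ≤
        301 * size n d + 1500 * (K * size n d) := by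
      calc (n + 1) * (15 * ((d + 1) * (20 + 100 * K)) + 1)
          = 300 * ((n + 1) * (d + 1)) + 1500 * (K * ((n + 1) * (d + 1))) + (n + 1) := by ring
        _ ≤ 300 * size n d + 1500 * (K * size n d) + size n d := by gcongr; nlinarith
        _ = _ := by ring
    have e2 : (graphProg K).regBound ≤ (reduction K).regBound * size n d :=
      hR.trans (Nat.le_mul_of_pos_right _ hS)
    have e3 : K ≤ K * size n d := Nat.le_mul_of_pos_right _ hS
    have e4 : (10 ^ 14 + 10 ^ 7 * (K + 100) + (reduction K).regBound) * size n d =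
      10 ^ 14 * size n d + 10 ^ 7 * (K * size n d) + 10 ^ 9 * size n d +
        (reduction K).regBound * size n d := by ring
    rw [e4]
    generalize (n + 1) * (15 * ((d + 1) * (20 + 100 * K)) + 1) = A at *
    generalize (reduction K).regBound * size n d = A' at *
    generalize (graphProg K).regBound = A' at *
    generalize K * size n d = A' at *
    generalize size n d = S at *
    norm_num at ht ⊢
    omega

include hK

theorem reduction_runs : ∃ t ≤ (10 ^ 14 + 10 ^ 7 * (K + 100) + (reduction K).regBound) *
      size (2 ^ blockVars N) φ.length,
    HaltsOn ((2 ^ N * (φ.length + 2)) ^ ((K + 404) * wordDeg K)) (reduction K) φ.encode t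
      (initState (encodeGraph (count (2 ^ blockVars N) φ.length (leaves (2 ^ blockVars N) φ.length))
        (φ.toOV.edgeList (leaves (2 ^ blockVars N) φ.length)))) := by
  obtain ⟨X, hXdef⟩ : ∃ X, X = (2 ^ N * (φ.length + 2)) ^ (K + 404) := ⟨_, rfl⟩
  have hXlt := size_lt_pow φ K
  rw [pow_mul, ← hXdef]
  rw [← hXdef] at hXlt
  have hin := two_mul_add_le_size (K := K) φ
  have hinput : ∀ x ∈ φ.encode, x < X := fun x hx => by
    have := φ.lt_of_mem_encode hK hx
    omega
  obtain ⟨-, hd, -, h1⟩ := self_le_size (2 ^ blockVars N) φ.length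
  have hd1 := add_one_le_size (2 ^ blockVars N) φ.length
  have hB : (K + 1) * φ.length + K + 3 ≤ (K + 100) * size (2 ^ blockVars N) φ.length := by
    nlinarith
  refine reduction_runs_of_exec_bits (D := wordDeg K) φ.toOV φ.encode rfl rfl rfl rfl rfl ?_ hinput
    (by simp only [wordDeg]; omega) le_rfl hXlt (by omega) fun hΓ =>
      exec_bits hK ⟨by omega, le_rfl, fun a _ => val_lt (by omega) hinput a⟩
        (by simp only [wordDeg]; omega) (fun _ => rfl) hB (by nlinarith) hΓ
  rw [φ.length_encode]
  exact (φ.clauseAddr_le hK _).trans (by omega)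

end SatProg
end WordRAM

/-! ### Word sizes, sparsity and the diameter in both cases -/

theorem WordRAM.HaltsOn.mono {W W' t : ℕ} {p : WordRAM.Prog} {l : List ℕ} {s : WordRAM.State}
    (h : HaltsOn W p l t s) (hW : W ≤ W') : HaltsOn W' p l t s :=
  ⟨fun x hx => (h.1 x hx).trans_le hW, h.2.mono hW⟩

theorem WordRAM.HaltsOn.bounded {W t : ℕ} {p : WordRAM.Prog} {l : List ℕ} {s : WordRAM.State}
    (h : HaltsOn W p l t s) (hW : 0 < W) (k : ℕ) : s.reg k < W :=
  (h.2.bounded ⟨fun _ => hW, val_lt hW h.1⟩).1 k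

namespace OVInstance
open OVVertex
variable {n d : ℕ}

theorem size_le_of_pos (hn : 1 ≤ n) (hd : 1 ≤ d) : size n d ≤ 16 * (n ^ 2 * d ^ 2) := by
  calc size n d ≤ (n + n) * ((n + n) * ((d + d) * (d + d))) := by simp only [size]; gcongr
    _ = _ := by ring

theorem count_le_of_pos (hn : 1 ≤ n) : count n d 0 ≤ 9 * (n ^ 2 + n * d ^ 2) := by
  have h1 : n ≤ n ^ 2 := Nat.le_self_pow (by norm_num) n
  have h2 : 1 ≤ n ^ 2 := Nat.one_le_pow _ _ hn
  have e : count n d 0 = 1 + 2 * n ^ 2 + 2 * (n * d ^ 2) + 4 * n := by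
    simp only [count, blockSize]; ring
  omega

theorem length_edgeList_le_of_pos (I : OVInstance 3 n d) (hd : 1 ≤ d) :
    (I.edgeList 0).length ≤ 13 * (n ^ 2 * d ^ 2) := by
  refine (I.length_edgeList_le 0).trans ?_
  have h1 : 1 ≤ d ^ 2 := Nat.one_le_pow _ _ hd
  have h2 : n ≤ n ^ 2 := Nat.le_self_pow (by norm_num) n
  have h3 : n ^ 2 ≤ n ^ 2 * d ^ 2 := Nat.le_mul_of_pos_right _ h1
  have h4 : n * d ^ 2 ≤ n ^ 2 * d ^ 2 := Nat.mul_le_mul_right _ h2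
  have e : 0 + 2 * (n * (2 + n + d * d + n * (1 + d * d))) + n * (n * (d * d)) =
    4 * n + 4 * n ^ 2 + 2 * (n * d ^ 2) + 3 * (n ^ 2 * d ^ 2) := by ring
  omega

/-- The `n * n * (d * d)` leaves pay for the dominant edge term `3 * (n * n * (d * d))` and for
their own edges; this is the source of the density 4. -/
theorem length_edgeList_le_count (I : OVInstance 3 n d) (q : ℕ) (hq : q = n * n * (d * d)) :
    (I.edgeList q).length ≤ 4 * count n d q := by
  refine (I.length_edgeList_le q).trans ?_
  have e : 4 * count n d q = 4 * q + 4 + 8 * (n * n) + 8 * (n * (d * d)) + 16 * n := by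
    simp only [count, blockSize]; ring
  have e' : q + 2 * (n * (2 + n + d * d + n * (1 + d * d))) + n * (n * (d * d)) =
    q + 3 * (n * n * (d * d)) + 4 * n + 4 * (n * n) + 2 * (n * (d * d)) := by ring
  omega

variable (I : OVInstance 3 n d) (q : ℕ)

theorem exists_graph_diameter_eq : ∃ D : ℕ, (I.graph q).diameter = D := by
  have h : (I.graph q).diameter ≤ 10 := iSup₂_le (I.graph_dist_le_ten q)
  obtain ⟨D, hD⟩ := ENat.ne_top_iff_exists.1 (ne_top_of_le_ne_top (by simp) h)
  exact ⟨D, hD.symm⟩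

theorem graph_diameter_le_six {D : ℕ} (hD : (I.graph q).diameter = D) (hI : ¬ I.HasSolution) :
    D ≤ 6 := by
  have h : (I.graph q).diameter ≤ 6 := iSup₂_le (I.graph_dist_le_six q hI)
  rw [hD] at h
  exact_mod_cast h

theorem ten_le_graph_diameter {D : ℕ} (hD : (I.graph q).diameter = D) (hI : I.HasSolution) :
    10 ≤ D := by
  obtain ⟨u, v, h⟩ := I.exists_ten_le_graph_dist q hI
  have h' : (10 : ℕ∞) ≤ (I.graph q).diameter :=
    h.trans (le_iSup₂ (f := fun u v => (I.graph q).dist u v) u v)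
  rw [hD] at h'
  exact_mod_cast h'

end OVInstance

open OVVertex OVInstance WordRAM in
/-- The reduction from `3`-OV. -/
theorem exists_reduction : ∃ (P : Prog) (c : ℕ), ∀ (n d : ℕ), 1 ≤ n → 1 ≤ d →
    ∀ I : OVInstance 3 n d, ∃ (t : ℕ) (s : State) (N : ℕ) (G : WeightedGraph (Fin N))
      (L : List (Fin N × Fin N × ℕ)),
      HaltsOn ((n + d + 2) ^ c) P I.encode t s ∧
      t ≤ c * (n ^ 2 * d ^ 2) ∧
      IsEdgeList G L ∧
      s.Outputs (encodeGraph N L) ∧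
      N ≤ c * (n ^ 2 + n * d ^ 2) ∧
      L.length ≤ c * (n ^ 2 * d ^ 2) ∧
      G.WeightsOneOrTwo ∧
      (¬ I.HasSolution → ∀ u v : Fin N, G.dist u v ≤ 6) ∧
      (I.HasSolution → ∃ u v : Fin N, 10 ≤ G.dist u v) := by
  obtain ⟨c, hc1, hc2⟩ : ∃ c, 10 ^ 14 * 16 ≤ c ∧ 2600 ≤ c := ⟨10 ^ 14 * 16, le_rfl, by norm_num⟩
  refine ⟨CopyProg.prog, c, fun n d hn hd I => ?_⟩
  obtain ⟨t, ht, s, hs, hout⟩ := I.copyProg_runs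
  refine ⟨t, s, _, I.graph 0, I.edgeList 0, hs.mono (Nat.pow_le_pow_right (by omega) hc2), ?_,
    I.isEdgeList 0, hout, ?_, ?_, I.graph_weightsOneOrTwo 0, I.graph_dist_le_six 0,
    I.exists_ten_le_graph_dist 0⟩
  · calc t ≤ 10 ^ 14 * (16 * (n ^ 2 * d ^ 2)) :=
          ht.trans (Nat.mul_le_mul_left _ (size_le_of_pos hn hd))
      _ = 10 ^ 14 * 16 * (n ^ 2 * d ^ 2) := (mul_assoc _ _ _).symm
      _ ≤ _ := Nat.mul_le_mul_right _ hc1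
  · exact (count_le_of_pos hn).trans (Nat.mul_le_mul_right _ (by omega))
  · exact (I.length_edgeList_le_of_pos hd).trans (Nat.mul_le_mul_right _ (by omega))

/-! ### From an approximation of the diameter to satisfiability -/

namespace WordRAM

/-- Test if the fraction in the registers `0` and `1` is greater than `a / b`. -/
def exceeds (a b : ℕ) : Prog := .seq (.instr (.const 2 b)) (.seq (.instr (.op .mul 0 0 2))
  (.seq (.instr (.const 2 a)) (.seq (.instr (.op .mul 1 1 2)) (.instr (.op .lt 0 1 0)))))

/-- Cross-multiplication compares the fractions exactly, without rounding. -/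
theorem exceeds_runs {W V a b : ℕ} (s : State) (h0 : s.reg 0 < V) (h1 : s.reg 1 < V)
    (hW : V * (a + b + 2) ≤ W) :
    ∃ s', Runs W (exceeds a b) s 5 s' ∧ (s'.reg 0 ≠ 0 ↔ a * s.reg 1 < s.reg 0 * b) := by
  have h : a < W ∧ b < W ∧ 1 < W ∧ s.reg 0 * b < W ∧ s.reg 1 * a < W := by
    refine ⟨?_, ?_, ?_, ?_, ?_⟩ <;> nlinarith
  obtain ⟨ha, hb, hW1, hb', ha'⟩ := h
  refine ⟨_, .seq (.instr _ _ hb) (.seq (.instr _ _ ?_) (.seq (.instr _ _ ha) (.seq (.instr _ _ ?_)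
    (.instr _ _ ?_)))), ?_⟩
  · simpa [Instr.exec, Instr.value, Op.eval] using hb'
  · simpa [Instr.exec, Instr.value, Op.eval] using ha'
  · simp only [Instr.value, Op.eval]; split_ifs <;> omega
  · simp [Instr.exec, Instr.value, Op.eval, mul_comm a]

end WordRAM

theorem exists_natCast_div_mem_Ioo {x y : ℝ} (hxy : x < y) (hy : 0 < y) :
    ∃ a b : ℕ, 0 < b ∧ 0 < (a : ℝ) / b ∧ x < (a : ℝ) / b ∧ (a : ℝ) / b < y := by
  obtain ⟨r, h1, h2⟩ := exists_rat_btwn (max_lt hxy hy)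
  obtain ⟨h3, h4⟩ := max_lt_iff.1 h1
  have hr : ((r.num.toNat : ℕ) : ℝ) / (r.den : ℕ) = r := by
    have h5 : 0 < r := by exact_mod_cast h4
    have h6 : ((r.num.toNat : ℕ) : ℤ) = r.num := Int.toNat_of_nonneg (Rat.num_pos.2 h5).le
    have h7 : ((r.num.toNat : ℕ) : ℝ) = (r.num : ℝ) := by exact_mod_cast h6
    rw [h7, Rat.cast_def r]
  exact ⟨r.num.toNat, r.den, r.den_pos, by rwa [hr], by rwa [hr], by rwa [hr]⟩

namespace CNF

/-- Since `3 * blockVars N ≤ N + 2`, the exponent is at most `(N + 2) * (1 - 2 * δ / 3)`; the factor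
4 absorbs the rounding up of `N / 3`. -/
theorem blockVars_rpow_le {δ : ℝ} (h1 : 0 ≤ δ) (N : ℕ) {β : ℝ} (h0 : 0 ≤ β)
    (hβ : β ≤ 3 / 2 - δ) :
    (((2 : ℝ) ^ blockVars N) ^ 2) ^ β ≤ 4 * (2 : ℝ) ^ ((1 - 2 * δ / 3) * N) := by
  have hb : (3 : ℝ) * blockVars N ≤ N + 2 := by
    have : 3 * blockVars N ≤ N + 2 := by simp only [blockVars]; omega
    exact_mod_cast this
  have hN : (0 : ℝ) ≤ N := N.cast_nonneg
  calc (((2 : ℝ) ^ blockVars N) ^ 2) ^ β = (2 : ℝ) ^ ((blockVars N * 2 : ℕ) * β) := by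
        rw [← pow_mul, Real.rpow_mul (by norm_num), Real.rpow_natCast]
    _ ≤ (2 : ℝ) ^ (2 + (1 - 2 * δ / 3) * N) := by
        refine Real.rpow_le_rpow_of_exponent_le (by norm_num) ?_
        push_cast
        nlinarith
    _ = _ := by rw [Real.rpow_add (by norm_num)]; norm_num

end CNF

namespace OVInstance
open CNF OVVertex WordRAM.SatProg

theorem size_le_four_mul {n : ℕ} (d : ℕ) (hn : 1 ≤ n) : size n d ≤ 4 * (n ^ 2 * (d + 1) ^ 2) := by
  calc size n d ≤ (n + n) * ((n + n) * ((d + 1) * (d + 1))) := by simp only [size]; gcongr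
    _ = _ := by ring

/-- Writing the graph takes only about `2 ^ (2 * N / 3)` steps. This is the case `β = 1` above, and
fits the budget because `δ ≤ 1 / 2`. -/
theorem size_blockVars_le {δ : ℝ} (h0 : 0 ≤ δ) (h1 : δ ≤ 1 / 2) (N d : ℕ) :
    (size (2 ^ blockVars N) d : ℝ) ≤
      16 * ((2 : ℝ) ^ ((1 - 2 * δ / 3) * N) * ((d : ℝ) + 1) ^ 4) := by
  have h2 : (size (2 ^ blockVars N) d : ℝ) ≤ 4 * (((2 : ℝ) ^ blockVars N) ^ 2 * ((d : ℝ) + 1) ^ 2) := by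
    exact_mod_cast size_le_four_mul d Nat.one_le_two_pow
  have h3 := blockVars_rpow_le h0 N zero_le_one (by linarith : (1 : ℝ) ≤ 3 / 2 - δ)
  rw [Real.rpow_one] at h3
  have h4 : ((d : ℝ) + 1) ^ 2 ≤ ((d : ℝ) + 1) ^ 4 :=
    pow_le_pow_right₀ (by linarith [d.cast_nonneg (α := ℝ)]) (by norm_num)
  calc _ ≤ _ := h2
    _ ≤ 4 * (4 * (2 : ℝ) ^ ((1 - 2 * δ / 3) * N) * ((d : ℝ) + 1) ^ 4) := by gcongr
    _ = _ := by ring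

theorem count_blockVars_rpow_le {δ : ℝ} (h0 : 0 ≤ δ) (h1 : δ ≤ 1 / 2) (N d : ℕ) :
    (count (2 ^ blockVars N) d (leaves (2 ^ blockVars N) d) : ℝ) ^ (3 / 2 - δ) ≤
      1600 * ((2 : ℝ) ^ ((1 - 2 * δ / 3) * N) * ((d : ℝ) + 1) ^ 4) := by
  have h2 : (count (2 ^ blockVars N) d (leaves (2 ^ blockVars N) d) : ℝ) ≤
      20 * (((2 : ℝ) ^ blockVars N) ^ 2 * ((d : ℝ) + 1) ^ 2) := by
    have h3 := size_le_four_mul (n := 2 ^ blockVars N) d Nat.one_le_two_pow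
    have h4 := count_le (2 ^ blockVars N) d (leaves (2 ^ blockVars N) d)
    have h5 := leaves_le_size (2 ^ blockVars N) d
    have : count (2 ^ blockVars N) d (leaves (2 ^ blockVars N) d) ≤
      20 * ((2 ^ blockVars N) ^ 2 * (d + 1) ^ 2) := by omega
    exact_mod_cast this
  have hd : (1 : ℝ) ≤ (d : ℝ) + 1 := by linarith [d.cast_nonneg (α := ℝ)]
  have h6 : ∀ x : ℝ, 1 ≤ x → x ^ (3 / 2 - δ) ≤ x ^ 2 := fun x hx => by
    rw [← Real.rpow_natCast]
    exact Real.rpow_le_rpow_of_exponent_le hx (by push_cast; linarith)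
  calc _ ≤ (20 * (((2 : ℝ) ^ blockVars N) ^ 2 * ((d : ℝ) + 1) ^ 2)) ^ (3 / 2 - δ) :=
        Real.rpow_le_rpow (by positivity) h2 (by linarith)
    _ = 20 ^ (3 / 2 - δ) * ((((2 : ℝ) ^ blockVars N) ^ 2) ^ (3 / 2 - δ) *
          (((d : ℝ) + 1) ^ 2) ^ (3 / 2 - δ)) := by
        rw [Real.mul_rpow (by norm_num) (by positivity),
          Real.mul_rpow (by positivity) (by positivity)]
    _ ≤ 20 ^ 2 * ((4 * (2 : ℝ) ^ ((1 - 2 * δ / 3) * N)) * (((d : ℝ) + 1) ^ 2) ^ 2) := by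
        gcongr
        · exact h6 _ (by norm_num)
        · exact blockVars_rpow_le h0 N (by linarith) le_rfl
        · exact h6 _ (one_le_pow₀ hd)
    _ = _ := by ring

end OVInstance

open CNF OVVertex OVInstance WordRAM SatProg in
/-- An approximation of the diameter that can tell `10` from `6` decides satisfiability. -/
theorem ksatSolvable_of_sparseDiameterApprox {lo hi δ ε : ℝ} (hδ : 0 ≤ δ) (hδ' : δ ≤ 1 / 2)
    (hε : 0 < ε) (hlo : 0 < lo) (hhi : hi ≤ (5 / 3 - ε) * lo)
    (h : SparseDiameterApprox 4 lo hi (3 / 2 - δ)) (K : ℕ) : KSATSolvable K (2 * δ / 3) := by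
  obtain ⟨P, c, hP⟩ := h
  -- The threshold `a / b` separates the two cases: `6 * hi ≤ (10 - 6 * ε) * lo < 10 * lo`.
  obtain ⟨a, b, hb, hab0, hab, hab'⟩ := exists_natCast_div_mem_Ioo
    (x := 6 * hi) (y := 10 * lo) (by nlinarith) (by linarith)
  obtain ⟨C, E, hred⟩ : ∃ C E, ∀ (N : ℕ) (φ : CNF N), (∀ cl ∈ φ, cl.length ≤ K) →
      ∃ t ≤ C * size (2 ^ blockVars N) φ.length,
        HaltsOn ((2 ^ N * (φ.length + 2)) ^ E) (reduction K) φ.encode t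
          (initState (encodeGraph _ (φ.toOV.edgeList (leaves (2 ^ blockVars N) φ.length)))) :=
    ⟨_, _, fun _ φ => reduction_runs φ⟩
  obtain ⟨c', h1, h2, h3, h4⟩ : ∃ c' : ℕ, 16 * C + 1600 * c + 5 ≤ c' ∧ E ≤ c' ∧
      (K + 404) * c + (a + b + 2) ≤ c' ∧ 4 ≤ c' :=
    ⟨16 * C + 1600 * c + 5 + E + ((K + 404) * c + (a + b + 2)) + 4, by omega, by omega, by omega,
      by omega⟩
  refine ⟨.seq (reduction K) (.seq P (exceeds a b)), c', fun N φ hK => ?_⟩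
  obtain ⟨Y, hY⟩ : ∃ Y, Y = 2 ^ N * (φ.length + 2) := ⟨_, rfl⟩
  have hY2 : 2 ≤ Y := by
    rw [hY]; exact Nat.mul_le_mul Nat.one_le_two_pow (Nat.le_add_left 2 _)
  obtain ⟨t, ht, hr⟩ := hred N φ hK
  rw [← hY] at hr
  obtain ⟨I, hI⟩ : ∃ I, I = φ.toOV := ⟨_, rfl⟩
  rw [← hI] at hr
  have hsize := size_lt_pow φ K
  rw [← hY] at hsize
  obtain ⟨D, hD⟩ := I.exists_graph_diameter_eq (leaves (2 ^ blockVars N) φ.length)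
  obtain ⟨t', s, hs, ht', hs1, hx1, hx2⟩ := hP _ D _ _ (by simp [count])
    (I.isEdgeList (leaves (2 ^ blockVars N) φ.length))
    (I.length_edgeList_le_count _ rfl) (I.graph_weightsOneOrTwo _) hD
  -- The words of the diameter algorithm, polynomial in the number of vertices, are polynomial in
  -- `Y` as well.
  have hYc : (count (2 ^ blockVars N) φ.length (leaves (2 ^ blockVars N) φ.length) + 2) ^ c ≤
      Y ^ ((K + 404) * c) := by
    rw [pow_mul]
    refine Nat.pow_le_pow_left ?_ c
    have := count_le (2 ^ blockVars N) φ.length (leaves (2 ^ blockVars N) φ.length)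
    have := leaves_le_size (2 ^ blockVars N) φ.length
    have := (self_le_size (2 ^ blockVars N) φ.length).2.2.2
    nlinarith
  have hs' := hs.mono hYc
  have hYW : Y ^ ((K + 404) * c) * (a + b + 2) ≤ Y ^ c' := by
    calc _ ≤ Y ^ ((K + 404) * c) * Y ^ (a + b + 2) := by
          refine Nat.mul_le_mul_left _ (Nat.lt_two_pow_self.le.trans (Nat.pow_le_pow_left hY2 _))
      _ = Y ^ ((K + 404) * c + (a + b + 2)) := (pow_add _ _ _).symm
      _ ≤ _ := Nat.pow_le_pow_right (by omega) h3
  have hY0 : 0 < Y ^ ((K + 404) * c) := Nat.pow_pos (by omega)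
  obtain ⟨s2, r2, hs2⟩ := exceeds_runs s (hs'.bounded hY0 0) (hs'.bounded hY0 1) hYW
  have hr' := hr.mono (Nat.pow_le_pow_right (by omega) h2 : Y ^ E ≤ Y ^ c')
  have hs'' := hs'.mono ((Nat.le_mul_of_pos_right _ (by omega)).trans hYW)
  rw [← hY]
  refine ⟨_, s2, ⟨hr'.1, .seq hr'.2 (.seq hs''.2 r2)⟩, ?_, ?_⟩
  · have e1 := size_blockVars_le hδ hδ' N φ.length
    have e2 := count_blockVars_rpow_le hδ hδ' N φ.length
    obtain ⟨F, hF⟩ : ∃ F, F = (2 : ℝ) ^ ((1 - 2 * δ / 3) * N) := ⟨_, rfl⟩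
    obtain ⟨Z, hZ⟩ : ∃ Z : ℝ, Z = N + φ.length + 1 := ⟨_, rfl⟩
    have hZ1 : ((φ.length : ℝ) + 1) ^ 4 ≤ Z ^ 4 := by rw [hZ]; gcongr; simp
    have hF1 : 1 ≤ F := by
      rw [hF]; exact Real.one_le_rpow (by norm_num) (mul_nonneg (by linarith) N.cast_nonneg)
    have hZ2 : 1 ≤ Z := by
      rw [hZ]; linarith [N.cast_nonneg (α := ℝ), φ.length.cast_nonneg (α := ℝ)]
    have hG1 : 1 ≤ F * Z ^ 4 := one_le_mul_of_one_le_of_one_le hF1 (one_le_pow₀ hZ2)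
    rw [← hF, ← hZ]
    rw [← hF] at e1 e2
    have ht1 : (t : ℝ) ≤ C * (size (2 ^ blockVars N) φ.length : ℝ) := by exact_mod_cast ht
    have hG : F * ((φ.length : ℝ) + 1) ^ 4 ≤ F * Z ^ 4 := by gcongr
    calc ((t + (t' + 5) : ℕ) : ℝ) = t + t' + 5 := by push_cast; ring
      _ ≤ C * (16 * (F * Z ^ 4)) + c * (1600 * (F * Z ^ 4)) + 5 * (F * Z ^ 4) := by
          refine add_le_add (add_le_add ?_ ?_) (by linarith)
          · exact ht1.trans (by gcongr; linarith)
          · exact ht'.trans (by gcongr; linarith)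
      _ = (16 * C + 1600 * c + 5 : ℕ) * (F * Z ^ 4) := by push_cast; ring
      _ ≤ c' * (F * Z ^ c') := by gcongr
      _ = _ := by ring
  · have hb' : (0 : ℝ) < b := by exact_mod_cast hb
    have hs1' : (0 : ℝ) < s.reg 1 := by exact_mod_cast Nat.pos_of_ne_zero hs1
    have key : a * s.reg 1 < s.reg 0 * b ↔ (a : ℝ) / b < (s.reg 0 : ℝ) / s.reg 1 := by
      rw [div_lt_div_iff₀ hb' hs1']
      exact_mod_cast Iff.rfl
    rw [hs2, key, ← toOV_hasSolution_iff, ← hI]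
    refine ⟨fun hlt => ?_, fun hsol => ?_⟩
    · by_contra hns
      have hD6 : (D : ℝ) ≤ 6 := by exact_mod_cast I.graph_diameter_le_six _ hD hns
      have hD0 : (0 : ℝ) ≤ D := D.cast_nonneg
      -- `hi` is not assumed positive; if it is not, the output is at most 0 and the positivity of
      -- `a / b` decides.
      rcases le_total hi 0 with h0 | h0 <;> nlinarith
    · have hD10 : (10 : ℝ) ≤ D := by exact_mod_cast I.ten_le_graph_diameter _ hD hsol
      nlinarith

theorem SparseDiameterApprox.mono {C₀ : ℕ} {lo hi τ τ' : ℝ} (hτ : τ ≤ τ')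
    (h : SparseDiameterApprox C₀ lo hi τ) : SparseDiameterApprox C₀ lo hi τ' := by
  obtain ⟨P, c, hP⟩ := h
  refine ⟨P, c, fun n D G L hn h1 h2 h3 h4 => ?_⟩
  obtain ⟨t, s, h5, h6, h7⟩ := hP n D G L hn h1 h2 h3 h4
  refine ⟨t, s, h5, h6.trans ?_, h7⟩
  have : (1 : ℝ) ≤ n := by exact_mod_cast hn
  gcongr

theorem mainTheorem3 :
    (∃ (P : WordRAM.Prog) (c : ℕ), ∀ (n d : ℕ), 1 ≤ n → 1 ≤ d → ∀ I : OVInstance 3 n d,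
      ∃ (t : ℕ) (s : WordRAM.State) (N : ℕ) (G : WeightedGraph (Fin N))
        (L : List (Fin N × Fin N × ℕ)),
        WordRAM.HaltsOn ((n + d + 2) ^ c) P I.encode t s ∧
        t ≤ c * (n ^ 2 * d ^ 2) ∧
        IsEdgeList G L ∧
        s.Outputs (encodeGraph N L) ∧
        N ≤ c * (n ^ 2 + n * d ^ 2) ∧
        L.length ≤ c * (n ^ 2 * d ^ 2) ∧
        G.WeightsOneOrTwo ∧
        (¬ I.HasSolution → ∀ u v : Fin N, G.dist u v ≤ 6) ∧
        (I.HasSolution → ∃ u v : Fin N, 10 ≤ G.dist u v)) ∧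
    (SETH → ∃ C₀ : ℕ, ∀ ε δ lo hi : ℝ, 0 < ε → 0 < δ → 0 < lo → hi ≤ (5 / 3 - ε) * lo →
      ¬ SparseDiameterApprox C₀ lo hi (3 / 2 - δ)) := by
  refine ⟨exists_reduction, fun hS => ⟨4, fun ε δ lo hi hε hδ hlo hhi h => ?_⟩⟩
  -- Replacing `δ` by a smaller value only allows more time; the bound 1/2 leaves room for the
  -- reduction itself.
  have hδ' : 0 < min δ (1 / 2) := lt_min hδ (by norm_num)
  obtain ⟨K, hK⟩ := hS (2 * min δ (1 / 2) / 3) (by linarith)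
  exact hK (ksatSolvable_of_sparseDiameterApprox hδ'.le (min_le_right _ _) hε hlo hhi
    (h.mono (by linarith [min_le_left δ (1 / 2)])) K)
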